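/- Let $p>1$, $q>p-1$ and $c\in\mathbb R$. Put $$\beta_q=\frac{p}{q+1-p},\qquad \lambda_q=\beta_q(q\beta_q-2),\qquad c_q=\beta_q^{p-2}\lambda_q ,$$ and consider the $2\pi$-periodic solutions $\omega:\mathbb R\to\mathbb R$ (equivalently, solutions on $S^1=\mathbb R/2\pi\mathbb Z$) of $$\frac{d}{d\sigma}\Big[\big(\beta_q^2\omega^2+\omega'^2\big)^{(p-2)/2}\omega'\Big]+\lambda_q\big(\beta_q^2\omega^2+\omega'^2\big)^{(p-2)/2}\omega+|\omega|^{q-1}\omega-c|\omega|^{p-2}\omega=0, \tag{E}$$ that is, $2\pi$-periodic $C^1$ functions for which the bracket is differentiable and (E) holds everywhere (products of the form $0^{s}\cdot 0$ are read as $0$). Let $\mathcal E^+$ be the set of everywhere positive solutions and $\mathcal E$ the set of sign-changing solutions (those that take both a positive and a negative value). (i) There are functions $\omega_k$ of least period $2\pi/k$ such that $$\mathcal E=\bigcup_{k\ge k_q}\{\omega_k(\cdot+\psi):\psi\in S^1\},$$ where $k_q=1$ if $c\ge c_q$, and, if $c<c_q$, $k_q$ is the smallest positive integer such that $k_q>M_q$,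 with $$M_q=\frac{\pi\,\beta_q^{1-p}}{2\displaystyle\int_0^{\pi/2}\frac{1+(p-1)\tan^2\theta}{\beta_q^p(p-1)\tan^2\theta+c_q-c\cos^{p-2}\theta}\,d\theta},$$ in which the integral converges and is positive when $c<c_q$. (ii) If $c\le c_q$, then $\mathcal E^+=\emptyset$. If $0<c-c_q\le\beta_q^{p-1}/p$, then $\mathcal E^+$ consists of the constant function $(c-c_q)^{1/(q+1-p)}$ only. If $c-c_q>\beta_q^{p-1}/p$, then $\mathcal E^+$ contains the constant function $(c-c_q)^{1/(q+1-p)}$ and a set $$\mathcal E^+_*=\bigcup_{k=1}^{k_q^+}\{\omega_k^+(\cdot+\psi):\psi\in S^1\},$$ where $\omega_k^+$ is a nonconstant positive function of least period $2\pi/k$ and $k_q^+$ is the largest integer smaller than $\big(p\,\beta_q^{1-p}(c-c_q)\big)^{1/2}$. -/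

import Mathlib

noncomputable section

namespace SeparableSolutions

/-- The exponent `β_q = p / (q + 1 - p)`. -/
def betaq (p q : ℝ) : ℝ := p / (q + 1 - p)

/-- The coefficient `λ_q = β_q (q β_q - 2)`. -/
def lambdaq (p q : ℝ) : ℝ := betaq p q * (q * betaq p q - 2)

/-- The critical value `c_q = β_q ^ (p - 2) λ_q`. -/
def cq (p q : ℝ) : ℝ := betaq p q ^ (p - 2) * lambdaq p q

/-- The weight `(β_q² ω² + ω'²) ^ ((p - 2) / 2)`. -/
def weight (p q : ℝ) (ω : ℝ → ℝ) (σ : ℝ) : ℝ :=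
  (betaq p q ^ 2 * ω σ ^ 2 + deriv ω σ ^ 2) ^ ((p - 2) / 2)

/-- `ω` is a `2π`-periodic (classical) solution, i.e. a solution on the circle, of
`((β_q² ω² + ω'²)^((p-2)/2) ω')' + λ_q (β_q² ω² + ω'²)^((p-2)/2) ω
  + |ω|^(q-1) ω - c |ω|^(p-2) ω = 0`:
it is continuously differentiable, the quantity in the outer derivative is differentiable,
and the equation holds everywhere. At a point where `ω = 0` the terms `|ω|^(q-1) ω` and
`|ω|^(p-2) ω` are `0`, and where `ω = ω' = 0` the products of the weight with `ω'` and `ω`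
are `0`, which are the values by continuity because `p > 1` and `q > 0`. -/
structure IsPeriodicSolution (p q c : ℝ) (ω : ℝ → ℝ) : Prop where
  periodic : Function.Periodic ω (2 * Real.pi)
  contDiff : ContDiff ℝ 1 ω
  differentiable_flux : Differentiable ℝ (fun s => weight p q ω s * deriv ω s)
  equation : ∀ σ : ℝ,
    deriv (fun s => weight p q ω s * deriv ω s) σ
      + lambdaq p q * weight p q ω σ * ω σ
      + |ω σ| ^ (q - 1) * ω σ - c * |ω σ| ^ (p - 2) * ω σ = 0

/-- The set of positive solutions on the circle. -/
def positiveSolutions (p q c : ℝ) : Set (ℝ → ℝ) :=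
  {ω | IsPeriodicSolution p q c ω ∧ ∀ σ, 0 < ω σ}

/-- The set of sign changing solutions on the circle. -/
def signChangingSolutions (p q c : ℝ) : Set (ℝ → ℝ) :=
  {ω | IsPeriodicSolution p q c ω ∧ (∃ σ, 0 < ω σ) ∧ ∃ σ, ω σ < 0}

/-- `T` is the least (positive) period of `f`. -/
def HasLeastPeriod (f : ℝ → ℝ) (T : ℝ) : Prop :=
  IsLeast {S : ℝ | 0 < S ∧ Function.Periodic f S} T

/-- The integrand in the definition of `M_q`. -/
def integrandMq (p q c θ : ℝ) : ℝ :=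
  (1 + (p - 1) * Real.tan θ ^ 2) /
    (betaq p q ^ p * (p - 1) * Real.tan θ ^ 2 + cq p q - c * Real.cos θ ^ (p - 2))

/-- The number `M_q`. -/
def Mq (p q c : ℝ) : ℝ :=
  Real.pi * betaq p q ^ (1 - p) / (2 * ∫ θ in (0 : ℝ)..(Real.pi / 2), integrandMq p q c θ)

open Classical in
/-- `k_q = 1` if `c ≥ c_q`; otherwise the smallest positive integer larger than `M_q`. -/
def kq (p q c : ℝ) : ℕ :=
  if cq p q ≤ c then 1 else sInf {k : ℕ | 0 < k ∧ Mq p q c < (k : ℝ)}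

/-- The largest integer smaller than `(p β_q ^ (1 - p) (c - c_q)) ^ (1 / 2)`. -/
def kqPlus (p q c : ℝ) : ℕ :=
  sSup {k : ℕ | (k : ℝ) < Real.sqrt (p * betaq p q ^ (1 - p) * (c - cq p q))}

end SeparableSolutions

end

/-! Write β for β_q, r = q + 1 - p, and c = b β^(p-1). Then β r = p, and c < c_q means b < (p-1)β +
(p-2).

Sign-changing solutions. In the phase plane put βω = ρ cos θ, ω' = -ρ sin θ and W = β^(-q) ρ^r. By
homogeneity the equation becomes θ' = (A + W C)/D and W' = r W sin θ (M + W E)/D, where A, C, M, E,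
D depend on θ only and D > 0. The identity cos θ (M + W E) = A + W C - β D (`cos_mul_polM`) ties the
two speeds together. A trajectory meeting the axis ω = 0 never stops turning: where A + W C is a
small fraction of W C, W grows so fast that a barrier function cannot vanish (`barrier_deriv_pos`).
Such a trajectory is therefore a graph W(θ) over the whole line (`exists_isOrbit`), even and
π-periodic by symmetry and uniqueness, and is determined by its value a at θ = -π/2.

Its solution has least period 4T(a), where T(a) is the integral of D/(A + W C) over (-π/2, 0).
Graphs do not cross, so T is strictly decreasing; it is continuous, tends to 0 as a grows, and as a
tends to 0 it tends to the integral of D/A if b is subcritical and to infinity otherwise. Hence T(a)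
= π/(2k) has at most one root, and for c < c_q it has one exactly when π/(2k) lies below the
integral of D/A, that is, when k > M_q; otherwise every k ≥ 1 occurs. Conversely, a nontrivial
solution avoids the origin of the phase plane, hence is regular enough to be lifted to polar
coordinates; if it has a zero, it follows one of these graphs up to a time shift
(`IsPeriodicSolution.exists_eq_polSolution`).

Positive solutions. With the logarithmic slope y = ω'/(βω), the power v = β^(1-p) ω^r and e =
β^(1-p)(c - c_q), the equation becomes v' = p y v, F(y)' = e - v - η(y), where F is increasing, η ≥
0 and η(0) = 0. If e ≤ 0, then at a minimum of ω one has y = 0 and y' < 0, which is impossible. The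
linearization at the equilibrium (0, e) has frequency √(pe). If pe ≤ 1, a Picone-type argument, in
which a function vanishing at both ends of an arc has positive derivative, excludes arcs of constant
sign of y of length at most π (`not_positive_arc`). Between a maximum and a minimum of v at distance
at most π this forces v to be constant.

If k² < pe, shoot from (y, v/e) = (0, μ) over the time π/k. For μ = 0 the slope stays positive; for
μ near 1 it becomes negative too early, by comparison with sin(kt). A critical μ in between has its
first zero exactly at π/k (`ShootingData.exists_first_zero`), and the reversibility of the system
closes that arc to a trajectory of period 2π/k. -/

noncomputable section

namespace SeparableSolutions

open Set Filter Topology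

/-! ### Differential inequalities and elementary analysis on the line -/

/-- Global existence for a bounded, globally Lipschitz, time dependent vector field. -/
theorem exists_global_solution {E : Type*} [NormedAddCommGroup E] [NormedSpace ℝ E]
    [CompleteSpace E] {v : ℝ → E → E} {K L : NNReal} (hK : ∀ t, LipschitzWith K (v t))
    (hc : ∀ x, Continuous fun t => v t x) (hL : ∀ t x, ‖v t x‖ ≤ L) (t₀ : ℝ) (x₀ : E) :
    ∃ f : ℝ → E, f t₀ = x₀ ∧ ∀ t, HasDerivAt f (v t (f t)) t := by
  have hex : ∀ n : ℕ, ∃ f : ℝ → E, f t₀ = x₀ ∧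
      ∀ t ∈ Icc (t₀ - n) (t₀ + n), HasDerivWithinAt f (v t (f t)) (Icc (t₀ - n) (t₀ + n)) t := by
    intro n
    have hn : (0 : ℝ) ≤ n := n.cast_nonneg
    have hpl : IsPicardLindelof v (tmin := t₀ - n) (tmax := t₀ + n)
        ⟨t₀, by constructor <;> linarith⟩ x₀ (L * n) 0 L K :=
      { lipschitzOnWith := fun t _ => (hK t).lipschitzOnWith
        continuousOn := fun x _ => (hc x).continuousOn
        norm_le := fun t _ x _ => hL t x
        mul_max_le := by simp }
    obtain ⟨f, h1, h2⟩ := hpl.exists_eq_forall_mem_Icc_hasDerivWithinAt₀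
    exact ⟨f, h1, h2⟩
  choose f hf0 hf using hex
  have hd : ∀ n : ℕ, ∀ t ∈ Ioo (t₀ - n) (t₀ + n), HasDerivAt (f n) (v t (f n t)) t :=
    fun n t ht => (hf n t (Ioo_subset_Icc_self ht)).hasDerivAt (Icc_mem_nhds ht.1 ht.2)
  have heq : ∀ m n : ℕ, 0 < m → m ≤ n → EqOn (f m) (f n) (Ioo (t₀ - m) (t₀ + m)) := by
    intro m n hm hmn
    have hm' : (0 : ℝ) < m := by exact_mod_cast hm
    have hmn' : (m : ℝ) ≤ n := by exact_mod_cast hmn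
    refine ODE_solution_unique_of_mem_Ioo (v := v) (s := fun _ => univ) (K := K) (t₀ := t₀)
      (fun t _ => (hK t).lipschitzOnWith) ⟨by linarith, by linarith⟩
      (fun t ht => ⟨hd m t ht, trivial⟩)
      (fun t ht => ⟨hd n t ⟨by linarith [ht.1], by linarith [ht.2]⟩, trivial⟩) ?_
    rw [hf0, hf0]
  -- The index is at least 1, so that the base point is interior to the interval. Near `t` all
  -- indices that occur are at most `⌈|t - t₀|⌉₊ + 2`, so the glued function is locally a single
  -- local solution.
  refine ⟨fun t => f (⌈|t - t₀|⌉₊ + 1) t, by simp [hf0], fun t => ?_⟩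
  set N := ⌈|t - t₀|⌉₊ + 2 with hN
  have key : ∀ s, |s - t₀| < ⌈|t - t₀|⌉₊ + 1 → f (⌈|s - t₀|⌉₊ + 1) s = f N s := by
    intro s hs
    have h1 : ⌈|s - t₀|⌉₊ ≤ ⌈|t - t₀|⌉₊ + 1 := by
      apply Nat.ceil_le.mpr
      push_cast
      exact hs.le
    apply heq _ _ (Nat.succ_pos _) (by omega)
    have h2 : |s - t₀| ≤ ⌈|s - t₀|⌉₊ := Nat.le_ceil _
    have h3 := abs_le.mp h2
    push_cast
    constructor <;> linarith [h3.1, h3.2]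
  have ht : |t - t₀| < ⌈|t - t₀|⌉₊ + 1 := lt_of_le_of_lt (Nat.le_ceil _) (lt_add_one _)
  have hev : (fun s => f (⌈|s - t₀|⌉₊ + 1) s) =ᶠ[𝓝 t] f N := by
    have : ∀ᶠ s in 𝓝 t, |s - t₀| < ⌈|t - t₀|⌉₊ + 1 :=
      (continuous_abs.comp (continuous_id.sub continuous_const)).continuousAt.eventually_lt
        continuousAt_const ht
    exact this.mono key
  have hmem : t ∈ Ioo (t₀ - N) (t₀ + N) := by
    have h3 := abs_lt.mp ht
    rw [hN]
    push_cast
    constructor <;> linarith [h3.1, h3.2]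
  have := (hd N t hmem).congr_of_eventuallyEq hev
  rw [← key t ht] at this
  exact this

/-- Gronwall for a signed function: u² exp(-2Kx) decreases. Squaring avoids differentiating the
absolute value at the zeros of u. -/
theorem abs_le_of_abs_deriv_le_right {u u' : ℝ → ℝ} {K s t : ℝ} (hst : s ≤ t)
    (hu : ContinuousOn u (Icc s t)) (hd : ∀ x ∈ Ioo s t, HasDerivAt u (u' x) x)
    (hK : ∀ x ∈ Ioo s t, |u' x| ≤ K * |u x|) :
    |u t| ≤ |u s| * Real.exp (K * (t - s)) := by
  have hanti : AntitoneOn (fun x => u x ^ 2 * Real.exp (-(2 * K) * x)) (Icc s t) := by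
    apply antitoneOn_of_hasDerivWithinAt_nonpos (convex_Icc s t)
      (f' := fun x => 2 * u x * u' x * Real.exp (-(2 * K) * x)
        + u x ^ 2 * (Real.exp (-(2 * K) * x) * (-(2 * K))))
    · exact (hu.pow 2).mul (by fun_prop)
    · intro x hx
      rw [interior_Icc] at hx
      have h1 := ((hd x hx).pow 2)
      have h2 : HasDerivAt (fun x => Real.exp (-(2 * K) * x))
          (Real.exp (-(2 * K) * x) * (-(2 * K))) x := by
        simpa using ((hasDerivAt_id x).const_mul (-(2 * K))).exp
      refine ((h1.mul h2).congr_deriv ?_).hasDerivWithinAt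
      simp only [Pi.pow_apply]
      push_cast
      ring
    · intro x hx
      rw [interior_Icc] at hx
      have h := hK x hx
      have h3 : u x * u' x ≤ K * u x ^ 2 := by
        calc u x * u' x ≤ |u x * u' x| := le_abs_self _
          _ = |u x| * |u' x| := abs_mul _ _
          _ ≤ |u x| * (K * |u x|) := by gcongr
          _ = K * u x ^ 2 := by rw [← sq_abs (u x)]; ring
      have h4 := Real.exp_pos (-(2 * K) * x)
      nlinarith
  have h := hanti (left_mem_Icc.mpr hst) (right_mem_Icc.mpr hst) hst
  simp only at h
  have h2 : u t ^ 2 ≤ (|u s| * Real.exp (K * (t - s))) ^ 2 := by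
    have h3 : (|u s| * Real.exp (K * (t - s))) ^ 2
        = (u s ^ 2 * Real.exp (-(2 * K) * s)) * Real.exp (2 * K * t) := by
      rw [mul_pow, sq_abs, ← Real.exp_nat_mul, mul_assoc, ← Real.exp_add]
      congr 2
      push_cast; ring
    have h4 : u t ^ 2 = (u t ^ 2 * Real.exp (-(2 * K) * t)) * Real.exp (2 * K * t) := by
      rw [mul_assoc, ← Real.exp_add]
      simp
    rw [h3, h4]
    gcongr
  exact abs_le_of_sq_le_sq' h2 (by positivity) |> abs_le.mpr

theorem abs_le_of_abs_deriv_le_left {u u' : ℝ → ℝ} {K s t : ℝ} (hst : s ≤ t)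
    (hu : ContinuousOn u (Icc s t)) (hd : ∀ x ∈ Ioo s t, HasDerivAt u (u' x) x)
    (hK : ∀ x ∈ Ioo s t, |u' x| ≤ K * |u x|) :
    |u s| ≤ |u t| * Real.exp (K * (t - s)) := by
  have h := abs_le_of_abs_deriv_le_right (u := fun x => u (-x)) (u' := fun x => -u' (-x)) (K := K)
    (s := -t) (t := -s) (by linarith)
    (hu.comp (by fun_prop) (fun x hx => ⟨by linarith [hx.2], by linarith [hx.1]⟩))
    (fun x hx => by
      have := (hd (-x) ⟨by linarith [hx.2], by linarith [hx.1]⟩).scomp x (hasDerivAt_neg x)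
      simpa [Function.comp_def] using this)
    (fun x hx => by
      rw [abs_neg]
      exact hK (-x) ⟨by linarith [hx.2], by linarith [hx.1]⟩)
  simp only [neg_neg] at h
  convert h using 3
  ring

/-- A function satisfying `|u'| ≤ K |u|` that vanishes at one point vanishes identically. -/
theorem eq_zero_of_abs_deriv_le {u u' : ℝ → ℝ} {t₀ : ℝ} (hd : ∀ x, HasDerivAt u (u' x) x)
    (hK : ∀ m : ℝ, ∃ K, ∀ x ∈ Icc (t₀ - m) (t₀ + m), |u' x| ≤ K * |u x|) (h0 : u t₀ = 0) (t : ℝ) :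
    u t = 0 := by
  obtain ⟨K, hK⟩ := hK |t - t₀|
  have hc : Continuous u := continuous_iff_continuousAt.mpr fun x => (hd x).continuousAt
  have ha := abs_le.mp (le_refl |t - t₀|)
  rcases le_total t₀ t with h | h
  · have := abs_le_of_abs_deriv_le_right (u := u) h hc.continuousOn (fun x _ => hd x)
      (fun x hx => hK x ⟨by linarith [hx.1, ha.1, abs_nonneg (t - t₀)], by linarith [hx.2, ha.2]⟩)
    rw [h0] at this
    simpa using this
  · have := abs_le_of_abs_deriv_le_left (u := u) h hc.continuousOn (fun x _ => hd x)
      (fun x hx => hK x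
        ⟨by linarith [hx.1, ha.1, ha.2], by linarith [hx.2, ha.2, abs_nonneg (t - t₀)]⟩)
    rw [h0] at this
    simpa using this

/-- A nonnegative function that is differentiable where positive, with `f' ≥ -K f` there, stays
positive to the right. -/
theorem pos_right_of_deriv_ge {f f' : ℝ → ℝ} {K t₀ t : ℝ} (hc : Continuous f) (h0 : ∀ x, 0 ≤ f x)
    (hd : ∀ x, 0 < f x → HasDerivAt f (f' x) x) (hK : ∀ x, 0 < f x → -K * f x ≤ f' x)
    (ht₀ : 0 < f t₀) (ht : t₀ ≤ t) : 0 < f t := by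
  by_contra hcon
  have hz : f t = 0 := le_antisymm (not_lt.mp hcon) (h0 t)
  set S := {x | x ∈ Icc t₀ t ∧ f x = 0} with hS
  have hne : S.Nonempty := ⟨t, right_mem_Icc.mpr ht, hz⟩
  have hcl : IsClosed S := (isClosed_Icc).inter (isClosed_eq hc continuous_const)
  have hbd : BddBelow S := ⟨t₀, fun x hx => hx.1.1⟩
  have hmem := hcl.csInf_mem hne hbd
  set z := sInf S
  have hpos : ∀ x ∈ Ico t₀ z, 0 < f x := by
    intro x hx
    rcases (h0 x).lt_or_eq with h | h
    · exact h
    · exact absurd (csInf_le hbd ⟨⟨hx.1, hx.2.le.trans hmem.1.2⟩, h.symm⟩) (not_le.mpr hx.2)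
  have hmono : MonotoneOn (fun x => f x * Real.exp (K * x)) (Icc t₀ z) := by
    apply monotoneOn_of_hasDerivWithinAt_nonneg (convex_Icc _ _)
      (f' := fun x => f' x * Real.exp (K * x) + f x * (Real.exp (K * x) * K))
    · exact (hc.mul (by fun_prop)).continuousOn
    · intro x hx
      rw [interior_Icc] at hx
      have h2 : HasDerivAt (fun x => Real.exp (K * x)) (Real.exp (K * x) * K) x := by
        simpa using ((hasDerivAt_id x).const_mul K).exp
      exact ((hd x (hpos x ⟨hx.1.le, hx.2⟩)).mul h2).hasDerivWithinAt
    · intro x hx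
      rw [interior_Icc] at hx
      have := hK x (hpos x ⟨hx.1.le, hx.2⟩)
      have h4 := Real.exp_pos (K * x)
      nlinarith
  have h := hmono (left_mem_Icc.mpr hmem.1.1) (right_mem_Icc.mpr hmem.1.1) hmem.1.1
  simp only [hmem.2, zero_mul] at h
  have := mul_pos ht₀ (Real.exp_pos (K * t₀))
  linarith

/-- Differentiability is demanded only where f is positive because f will be the squared phase
radius of a solution, whose second derivative is not yet available at the origin of the phase plane.
-/
theorem pos_of_abs_deriv_le {f f' : ℝ → ℝ} {K t₀ : ℝ} (hc : Continuous f) (h0 : ∀ x, 0 ≤ f x)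
    (hd : ∀ x, 0 < f x → HasDerivAt f (f' x) x) (hK : ∀ x, 0 < f x → |f' x| ≤ K * f x)
    (ht₀ : 0 < f t₀) (t : ℝ) : 0 < f t := by
  rcases le_total t₀ t with h | h
  · exact pos_right_of_deriv_ge (K := K) hc h0 hd
      (fun x hx => by linarith [(abs_le.mp (hK x hx)).1]) ht₀ h
  · have := pos_right_of_deriv_ge (f := fun x => f (-x)) (f' := fun x => -f' (-x)) (K := K)
      (t₀ := -t₀) (t := -t) (hc.comp continuous_neg) (fun x => h0 _)
      (fun x hx => by
        have := (hd (-x) hx).scomp x (hasDerivAt_neg x)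
        simpa [Function.comp_def] using this)
      (fun x hx => by linarith [(abs_le.mp (hK (-x) hx)).2]) (by simpa using ht₀) (by linarith)
    simpa using this

/-- If `f' ≤ C` wherever `f ≥ m`, then `f` exceeds `max (f a) m` by at most `C (t - a)`. -/
theorem le_max_add_of_deriv_le {f f' : ℝ → ℝ} {a b m C : ℝ} (hC : 0 ≤ C)
    (hf : ∀ t ∈ Icc a b, HasDerivAt f (f' t) t) (h : ∀ t ∈ Icc a b, m ≤ f t → f' t ≤ C)
    {t : ℝ} (ht : t ∈ Icc a b) : f t ≤ max (f a) m + C * (t - a) := by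
  -- The slope `C + ε` makes the comparison strict at a contact point; ε tends to 0 afterwards.
  have key : ∀ ε > 0, f t ≤ max (f a) m + (C + ε) * (t - a) := by
    intro ε hε
    apply image_le_of_deriv_right_lt_deriv_boundary' (f := f) (f' := f') (a := a) (b := b)
      (B := fun t => max (f a) m + (C + ε) * (t - a)) (B' := fun _ => C + ε) _ _ _ _ _ _ ht
    · exact fun x hx => (hf x hx).continuousAt.continuousWithinAt
    · exact fun x hx => (hf x (Ico_subset_Icc_self hx)).hasDerivWithinAt
    · simp
    · fun_prop
    · intro x hx
      have : HasDerivAt (fun t => max (f a) m + (C + ε) * (t - a)) ((C + ε) * 1) x :=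
        (((hasDerivAt_id x).sub_const a).const_mul (C + ε)).const_add _
      simpa using this.hasDerivWithinAt
    · intro x hx hxe
      have h1 : m ≤ f x := by
        rw [hxe]
        have := mul_nonneg (by linarith : 0 ≤ C + ε) (by linarith [hx.1] : 0 ≤ x - a)
        linarith [le_max_right (f a) m]
      linarith [h x (Ico_subset_Icc_self hx) h1]
  have hlim : Tendsto (fun ε => max (f a) m + (C + ε) * (t - a)) (𝓝[>] 0)
      (𝓝 (max (f a) m + (C + 0) * (t - a))) := by
    apply Tendsto.mono_left _ nhdsWithin_le_nhds
    exact Continuous.tendsto (by fun_prop) _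
  rw [add_zero] at hlim
  exact ge_of_tendsto hlim (eventually_mem_nhdsWithin.mono fun ε hε => key ε hε)

/-- A function positive at the left end point, with positive derivative at every later zero, is
positive. -/
theorem pos_of_deriv_pos_at_zero {f f' : ℝ → ℝ} {a b : ℝ} (hc : ContinuousOn f (Icc a b))
    (ha : 0 < f a) (hf : ∀ t ∈ Ioc a b, f t = 0 → HasDerivAt f (f' t) t ∧ 0 < f' t)
    {t : ℝ} (ht : t ∈ Icc a b) : 0 < f t := by
  by_contra hcon
  push Not at hcon
  set S := {x | x ∈ Icc a t ∧ f x ≤ 0} with hS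
  have hne : S.Nonempty := ⟨t, right_mem_Icc.mpr ht.1, hcon⟩
  have hct : ContinuousOn f (Icc a t) := hc.mono (Icc_subset_Icc_right ht.2)
  have hcl : IsClosed S := by
    have := hct.preimage_isClosed_of_isClosed isClosed_Icc (isClosed_Iic (a := (0:ℝ)))
    exact this
  have hbd : BddBelow S := ⟨a, fun x hx => hx.1.1⟩
  have hmem := hcl.csInf_mem hne hbd
  set z := sInf S
  have haz : a < z := by
    rcases hmem.1.1.lt_or_eq with h | h
    · exact h
    · have := hmem.2
      rw [← h] at this
      linarith
  have hpos : ∀ x ∈ Ico a z, 0 < f x := by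
    intro x hx
    by_contra hx'
    exact absurd (csInf_le hbd ⟨⟨hx.1, hx.2.le.trans hmem.1.2⟩, not_lt.mp hx'⟩) (not_le.mpr hx.2)
  have hz0 : f z = 0 := by
    apply le_antisymm hmem.2
    have hcw : ContinuousWithinAt f (Iio z) z := by
      have := (hct z hmem.1).mono_of_mem_nhdsWithin (s := Iio z) ?_
      · exact this
      · exact mem_of_superset (Ico_mem_nhdsLT haz) (fun x hx => ⟨hx.1, hx.2.le.trans hmem.1.2⟩)
    apply ge_of_tendsto hcw
    filter_upwards [Ico_mem_nhdsLT haz] with x hx using (hpos x hx).le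
  obtain ⟨h1, h2⟩ := hf z ⟨haz, hmem.1.2.trans ht.2⟩ hz0
  have h3 := h1.tendsto_slope
  have h4 : ∀ᶠ x in 𝓝[<] z, 0 < slope f z x :=
    (h3.mono_left (nhdsWithin_mono z (fun x hx => ne_of_lt hx))).eventually_const_lt h2
  obtain ⟨x, hx1, hx2⟩ := (h4.and (Ico_mem_nhdsLT haz)).exists
  rw [slope_def_field, hz0] at hx1
  have := div_neg_of_pos_of_neg (by linarith [hpos x hx2] : 0 < f x - 0)
    (by linarith [hx2.2] : x - z < 0)
  linarith

/-- The quotient is X times X/g, and X/g is a quotient of difference quotients with a finite limit.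
So it tends to 0, which is also the value that division by zero gives at the point itself. Needed at
the ends of an arc, where a squared numerator meets a simple zero of a sine. -/
theorem continuousAt_sq_div_of_zero {X g : ℝ → ℝ} {X' g' t₀ : ℝ} (hX : HasDerivAt X X' t₀)
    (hg : HasDerivAt g g' t₀) (hX0 : X t₀ = 0) (hg0 : g t₀ = 0) (hg' : g' ≠ 0) :
    ContinuousAt (fun t => X t ^ 2 / g t) t₀ := by
  have h1 : ContinuousAt (dslope X t₀) t₀ := continuousAt_dslope_same.mpr hX.differentiableAt
  have h2 : ContinuousAt (dslope g t₀) t₀ := continuousAt_dslope_same.mpr hg.differentiableAt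
  have h3 : dslope g t₀ t₀ ≠ 0 := by rwa [dslope_same, hg.deriv]
  have h4 : ContinuousAt (fun t => X t * (dslope X t₀ t / dslope g t₀ t)) t₀ :=
    hX.continuousAt.mul (h1.div h2 h3)
  refine h4.congr (Eventually.of_forall fun t => ?_)
  rcases eq_or_ne t t₀ with rfl | h
  · simp [hX0]
  · have hne : t - t₀ ≠ 0 := sub_ne_zero.mpr h
    simp only [dslope_of_ne _ h, slope_def_field, hX0, hg0, sub_zero]
    rw [div_div_div_cancel_right₀ hne]
    ring

/-- For s < 1 the first factor is unbounded near 0, but the product has absolute value |x|^s. This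
makes all exponents p > 1 and q > 0 admissible in the coefficients. -/
theorem continuous_abs_rpow_mul {s : ℝ} (hs : 0 < s) :
    Continuous fun x : ℝ => |x| ^ (s - 1) * x := by
  rw [continuous_iff_continuousAt]
  intro x
  rcases eq_or_ne x 0 with rfl | hx
  · have h1 : Tendsto (fun x : ℝ => |x| ^ s) (𝓝 0) (𝓝 0) := by
      have : Continuous fun x : ℝ => |x| ^ s := continuous_abs.rpow_const (fun _ => Or.inr hs.le)
      have h := this.tendsto 0
      simpa [Real.zero_rpow hs.ne'] using h
    have h2 : Tendsto (fun x : ℝ => |x| ^ (s - 1) * x) (𝓝 0) (𝓝 0) := by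
      refine squeeze_zero_norm (fun x => ?_) h1
      rw [Real.norm_eq_abs, abs_mul, abs_of_nonneg (Real.rpow_nonneg (abs_nonneg x) _)]
      rcases eq_or_ne x 0 with rfl | hx
      · simp [Real.zero_rpow hs.ne']
      · rw [← Real.rpow_add_one (abs_ne_zero.mpr hx)]
        simp
    simpa [ContinuousAt] using h2
  · exact (continuous_abs.continuousAt.rpow_const (Or.inl (abs_ne_zero.mpr hx))).mul continuousAt_id

/-! ### Coefficients of the equation in polar coordinates -/

/-- The standing relations between the exponents: `p > 1` and `β = p / (q + 1 - p) > 0`. -/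
structure Exponents (p q β : ℝ) : Prop where
  one_lt : 1 < p
  pos : 0 < β
  rel : β * (q + 1 - p) = p

namespace Exponents
variable {p q β : ℝ} (h : Exponents p q β)
include h

theorem r_pos : 0 < q + 1 - p := by
  have h1 := h.one_lt
  have h2 := h.rel
  by_contra hcon
  have := mul_nonpos_of_nonneg_of_nonpos h.pos.le (not_lt.mp hcon)
  linarith

theorem q_pos : 0 < q := by linarith [h.r_pos, h.one_lt]

end Exponents

theorem exponents_betaq {p q : ℝ} (hp : 1 < p) (hq : p - 1 < q) : Exponents p q (betaq p q) where
  one_lt := hp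
  pos := div_pos (by linarith) (by linarith)
  rel := div_mul_cancel₀ _ (by linarith)

/-- The numerator of the angular speed in polar coordinates, at radius zero. -/
def polA (p β b θ : ℝ) : ℝ :=
  (p - 1) * β + (p - 2) * Real.cos θ ^ 2 - b * |Real.cos θ| ^ p

/-- The coefficient of the radial variable in the numerator of the angular speed. -/
def polC (q θ : ℝ) : ℝ := |Real.cos θ| ^ (q + 1)

/-- The numerator of the radial speed, at radius zero. -/
def polM (p β b θ : ℝ) : ℝ :=
  (p - 2) * (β + 1) * Real.cos θ - b * (|Real.cos θ| ^ (p - 2) * Real.cos θ)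

/-- The coefficient of the radial variable in the numerator of the radial speed. -/
def polE (q θ : ℝ) : ℝ := |Real.cos θ| ^ (q - 1) * Real.cos θ

/-- The denominator of the angular and radial speeds. -/
def polD (p θ : ℝ) : ℝ := Real.cos θ ^ 2 + (p - 1) * Real.sin θ ^ 2

section coefficients
variable {p q β b : ℝ}

theorem abs_rpow_eq_mul (x : ℝ) {s : ℝ} (hs : 0 < s) :
    |x| ^ (s + 1) = x * (|x| ^ (s - 1) * x) := by
  rcases eq_or_ne x 0 with rfl | hx
  · simp [Real.zero_rpow (by linarith : s + 1 ≠ 0)]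
  · rw [show s + 1 = (s - 1) + 2 by ring, Real.rpow_add (abs_pos.mpr hx)]
    norm_cast
    rw [sq_abs]; ring

/-- This expresses the compatibility of ω = ρ cos θ/β with ω' = -ρ sin θ. It recovers the angular
speed from the radial one and bounds the former below by β D where the radial numerator and the
cosine are nonnegative. -/
theorem cos_mul_polM (h : Exponents p q β) (θ W : ℝ) :
    Real.cos θ * (polM p β b θ + W * polE q θ) = polA p β b θ + W * polC q θ - β * polD p θ := by
  have h1 := abs_rpow_eq_mul (Real.cos θ) (s := p - 1) (by linarith [h.one_lt])
  have h2 := abs_rpow_eq_mul (Real.cos θ) h.q_pos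
  rw [show p - 1 + 1 = p by ring, show p - 1 - 1 = p - 2 by ring] at h1
  unfold polM polE polA polC polD
  rw [h1, h2, Real.sin_sq]
  ring

theorem continuous_polA (h : Exponents p q β) : Continuous (polA p β b) := by
  have : Continuous fun θ => |Real.cos θ| ^ p :=
    Continuous.rpow_const (by fun_prop) fun _ => Or.inr (by linarith [h.one_lt])
  unfold polA
  fun_prop

theorem continuous_polC (h : Exponents p q β) : Continuous (polC q) :=
  Continuous.rpow_const (by fun_prop) fun _ => Or.inr (by linarith [h.q_pos])

theorem continuous_polM (h : Exponents p q β) : Continuous (polM p β b) := by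
  have h1 := (continuous_abs_rpow_mul (s := p - 1) (by linarith [h.one_lt])).comp
    Real.continuous_cos
  rw [show p - 1 - 1 = p - 2 by ring] at h1
  have : Continuous fun θ => |Real.cos θ| ^ (p - 2) * Real.cos θ := h1
  unfold polM
  fun_prop

theorem continuous_polE (h : Exponents p q β) : Continuous (polE q) :=
  (continuous_abs_rpow_mul h.q_pos).comp Real.continuous_cos

theorem continuous_polD : Continuous (polD p) := by
  unfold polD
  fun_prop

theorem polD_ge (p θ : ℝ) : min 1 (p - 1) ≤ polD p θ := by
  have h1 := Real.sin_sq_add_cos_sq θ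
  unfold polD
  nlinarith [min_le_left 1 (p - 1), min_le_right 1 (p - 1), sq_nonneg (Real.sin θ),
    sq_nonneg (Real.cos θ)]

theorem polD_pos (h : Exponents p q β) (θ : ℝ) : 0 < polD p θ :=
  lt_of_lt_of_le (lt_min one_pos (by linarith [h.one_lt])) (polD_ge p θ)

theorem polA_neg (θ : ℝ) : polA p β b (-θ) = polA p β b θ := by simp [polA]
theorem polC_neg (θ : ℝ) : polC q (-θ) = polC q θ := by simp [polC]
theorem polM_neg (θ : ℝ) : polM p β b (-θ) = polM p β b θ := by simp [polM]
theorem polE_neg (θ : ℝ) : polE q (-θ) = polE q θ := by simp [polE]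
theorem polD_neg (θ : ℝ) : polD p (-θ) = polD p θ := by simp [polD]
theorem polA_add_pi (θ : ℝ) : polA p β b (θ + Real.pi) = polA p β b θ := by simp [polA]
theorem polC_add_pi (θ : ℝ) : polC q (θ + Real.pi) = polC q θ := by simp [polC]
theorem polM_add_pi (θ : ℝ) : polM p β b (θ + Real.pi) = -polM p β b θ := by
  simp only [polM, Real.cos_add_pi, abs_neg]; ring
theorem polE_add_pi (θ : ℝ) : polE q (θ + Real.pi) = -polE q θ := by
  simp only [polE, Real.cos_add_pi, abs_neg]; ring
theorem polD_add_pi (θ : ℝ) : polD p (θ + Real.pi) = polD p θ := by simp [polD]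

theorem polA_of_cos_eq_zero (h : Exponents p q β) {θ : ℝ} (hθ : Real.cos θ = 0) :
    polA p β b θ = (p - 1) * β := by
  simp [polA, hθ, Real.zero_rpow (by linarith [h.one_lt] : p ≠ 0)]

theorem polC_nonneg (θ : ℝ) : 0 ≤ polC q θ := by unfold polC; positivity

theorem polC_le_one (h : Exponents p q β) (θ : ℝ) : polC q θ ≤ 1 :=
  Real.rpow_le_one (abs_nonneg _) (Real.abs_cos_le_one θ) (by linarith [h.q_pos])

theorem abs_polE_le (h : Exponents p q β) (θ : ℝ) : |polE q θ| ≤ 1 := by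
  unfold polE
  rcases eq_or_ne (Real.cos θ) 0 with hx | hx
  · simp [hx]
  · rw [abs_mul, abs_of_nonneg (by positivity : 0 ≤ |Real.cos θ| ^ (q - 1)),
      ← Real.rpow_add_one (abs_ne_zero.mpr hx)]
    exact Real.rpow_le_one (abs_nonneg _) (Real.abs_cos_le_one θ) (by linarith [h.q_pos])

theorem abs_polM_le (h : Exponents p q β) (θ : ℝ) :
    |polM p β b θ| ≤ |p - 2| * (β + 1) + |b| := by
  have h1 := abs_rpow_eq_mul
  unfold polM
  have h2 : |(|Real.cos θ| ^ (p - 2) * Real.cos θ)| ≤ 1 := by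
    rcases eq_or_ne (Real.cos θ) 0 with hx | hx
    · simp [hx]
    · rw [abs_mul, abs_of_nonneg (by positivity : 0 ≤ |Real.cos θ| ^ (p - 2)),
        ← Real.rpow_add_one (abs_ne_zero.mpr hx)]
      exact Real.rpow_le_one (abs_nonneg _) (Real.abs_cos_le_one θ) (by linarith [h.one_lt])
  have h3 := Real.abs_cos_le_one θ
  have h4 : 0 < β + 1 := by linarith [h.pos]
  calc _ ≤ |(p - 2) * (β + 1) * Real.cos θ| + |b * (|Real.cos θ| ^ (p - 2) * Real.cos θ)| :=
        abs_sub _ _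
    _ = |p - 2| * (β + 1) * |Real.cos θ| + |b| * |(|Real.cos θ| ^ (p - 2) * Real.cos θ)| := by
        rw [abs_mul, abs_mul, abs_mul b, abs_of_pos h4]
    _ ≤ |p - 2| * (β + 1) * 1 + |b| * 1 := by gcongr
    _ = _ := by ring

/-- At the zeros of the cosine only the term (p-1)β survives. Since `polC` is nonnegative, this
bounds the angular speed below near the zeros of the solution, uniformly in the radius. -/
theorem exists_polA_ge (h : Exponents p q β) (b : ℝ) :
    ∃ c₀ > 0, c₀ < 1 ∧ ∀ θ, |Real.cos θ| ≤ c₀ → (p - 1) * β / 2 ≤ polA p β b θ := by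
  have hp := h.one_lt
  have hpos : 0 < (p - 1) * β := mul_pos (by linarith) h.pos
  have hc : Continuous fun x : ℝ => (p - 1) * β + (p - 2) * x ^ 2 - b * |x| ^ p := by
    have : Continuous fun x : ℝ => |x| ^ p :=
      Continuous.rpow_const (by fun_prop) fun _ => Or.inr (by linarith)
    fun_prop
  have h0 : (fun x : ℝ => (p - 1) * β + (p - 2) * x ^ 2 - b * |x| ^ p) 0 = (p - 1) * β := by
    simp [Real.zero_rpow (by linarith : p ≠ 0)]
  have hev : ∀ᶠ x in 𝓝 (0 : ℝ), (p - 1) * β / 2 <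
      (fun x : ℝ => (p - 1) * β + (p - 2) * x ^ 2 - b * |x| ^ p) x := by
    apply (hc.tendsto 0).eventually_const_lt
    simp only at h0
    rw [h0]; linarith
  obtain ⟨ε, hε, hb⟩ := Metric.eventually_nhds_iff.mp hev
  refine ⟨min (ε / 2) (1 / 2), by positivity, by
    exact lt_of_le_of_lt (min_le_right _ _) (by norm_num), fun θ hθ => ?_⟩
  refine (hb (y := Real.cos θ) ?_).le
  rw [Real.dist_eq, sub_zero]
  exact lt_of_le_of_lt (hθ.trans (min_le_left _ _)) (by linarith)

theorem hasDerivAt_polA (h : Exponents p q β) (θ : ℝ) :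
    HasDerivAt (polA p β b) ((p - 2) * (2 * Real.cos θ * -Real.sin θ)
      - b * (p * |Real.cos θ| ^ (p - 2) * Real.cos θ * -Real.sin θ)) θ := by
  have h1 := (Real.hasDerivAt_cos θ).pow 2
  have h2 := (hasDerivAt_abs_rpow (Real.cos θ) h.one_lt).comp θ (Real.hasDerivAt_cos θ)
  refine (((h1.const_mul (p - 2)).const_add ((p - 1) * β)).sub (h2.const_mul b)).congr_deriv ?_
  push_cast
  ring

theorem hasDerivAt_polC (h : Exponents p q β) (θ : ℝ) :
    HasDerivAt (polC q) ((q + 1) * |Real.cos θ| ^ (q - 1) * Real.cos θ * -Real.sin θ) θ := by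
  have h2 := (hasDerivAt_abs_rpow (Real.cos θ) (by linarith [h.q_pos] : 1 < q + 1)).comp θ
    (Real.hasDerivAt_cos θ)
  rw [show q + 1 - 2 = q - 1 by ring] at h2
  exact h2

end coefficients

/-! ### Orbits as graphs over the angle: uniqueness, symmetry, ordering -/

/-- `W` describes a trajectory in polar coordinates with the angle as independent variable: the
radial variable `W` stays positive and so does the numerator of the angular speed. -/
structure IsOrbit (p q β b : ℝ) (W : ℝ → ℝ) : Prop where
  pos : ∀ θ, 0 < W θ
  speed_pos : ∀ θ, 0 < polA p β b θ + W θ * polC q θ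
  hasDerivAt : ∀ θ, HasDerivAt W ((q + 1 - p) * W θ * Real.sin θ *
    (polM p β b θ + W θ * polE q θ) / (polA p β b θ + W θ * polC q θ)) θ

/-- The logarithmic derivative of the difference of two orbits. -/
def diffRate (p q β b : ℝ) (W V : ℝ → ℝ) (θ : ℝ) : ℝ :=
  (q + 1 - p) * Real.sin θ * (polM p β b θ * polA p β b θ
    + polE q θ * polA p β b θ * (W θ + V θ) + polE q θ * polC q θ * W θ * V θ) /
  ((polA p β b θ + W θ * polC q θ) * (polA p β b θ + V θ * polC q θ))

namespace IsOrbit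
variable {p q β b : ℝ} {W V : ℝ → ℝ}

theorem continuous (hW : IsOrbit p q β b W) : Continuous W :=
  continuous_iff_continuousAt.mpr fun x => (hW.hasDerivAt x).continuousAt

theorem continuous_speed (hW : IsOrbit p q β b W) (h : Exponents p q β) :
    Continuous fun θ => polA p β b θ + W θ * polC q θ :=
  (continuous_polA h).add (hW.continuous.mul (continuous_polC h))

/-- The difference of two orbits satisfies a linear homogeneous equation with continuous
coefficient. Hence orbits that meet coincide, and distinct orbits are strictly ordered. -/
theorem hasDerivAt_sub (hW : IsOrbit p q β b W) (hV : IsOrbit p q β b V) (θ : ℝ) :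
    HasDerivAt (fun θ => W θ - V θ) (diffRate p q β b W V θ * (W θ - V θ)) θ := by
  refine ((hW.hasDerivAt θ).sub (hV.hasDerivAt θ)).congr_deriv ?_
  have h1 := (hW.speed_pos θ).ne'
  have h2 := (hV.speed_pos θ).ne'
  unfold diffRate
  rw [div_sub_div _ _ h1 h2, div_mul_eq_mul_div]
  congr 1
  ring

theorem continuous_diffRate (hW : IsOrbit p q β b W) (hV : IsOrbit p q β b V)
    (h : Exponents p q β) : Continuous (diffRate p q β b W V) := by
  have h1 := continuous_polA (b := b) h
  have h2 := continuous_polC h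
  have h3 := continuous_polM (b := b) h
  have h4 := continuous_polE h
  have h5 := hW.continuous
  have h6 := hV.continuous
  unfold diffRate
  refine Continuous.div (by fun_prop) (by fun_prop) fun θ => ?_
  exact (mul_pos (hW.speed_pos θ) (hV.speed_pos θ)).ne'

theorem eq_of_eq_at (hW : IsOrbit p q β b W) (hV : IsOrbit p q β b V) (h : Exponents p q β)
    {θ₀ : ℝ} (h0 : W θ₀ = V θ₀) : W = V := by
  funext θ
  have := eq_zero_of_abs_deriv_le (t₀ := θ₀) (hW.hasDerivAt_sub hV) (fun m => ?_)
    (by simp [h0]) θ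
  · linarith
  · obtain ⟨K, hK⟩ := isCompact_Icc.exists_bound_of_continuousOn
      (s := Icc (θ₀ - m) (θ₀ + m)) (hW.continuous_diffRate hV h).continuousOn
    refine ⟨K, fun x hx => ?_⟩
    rw [abs_mul]
    gcongr
    exact hK x hx

/-- This is the symmetry of the equation under reversal of time; the shift by π below is the
symmetry under ω ↦ -ω. -/
theorem comp_neg (hW : IsOrbit p q β b W) : IsOrbit p q β b fun θ => W (-θ) where
  pos θ := hW.pos _
  speed_pos θ := by
    have := hW.speed_pos (-θ)
    rwa [polA_neg, polC_neg] at this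
  hasDerivAt θ := by
    have := (hW.hasDerivAt (-θ)).scomp θ (hasDerivAt_neg θ)
    refine this.congr_deriv ?_
    simp only [polA_neg, polC_neg, polM_neg, polE_neg, Real.sin_neg, smul_eq_mul]
    ring

theorem comp_add_pi (hW : IsOrbit p q β b W) : IsOrbit p q β b fun θ => W (θ + Real.pi) where
  pos θ := hW.pos _
  speed_pos θ := by
    have := hW.speed_pos (θ + Real.pi)
    rwa [polA_add_pi, polC_add_pi] at this
  hasDerivAt θ := by
    have := (hW.hasDerivAt (θ + Real.pi)).comp_add_const θ Real.pi
    refine this.congr_deriv ?_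
    simp only [polA_add_pi, polC_add_pi, polM_add_pi, polE_add_pi, Real.sin_add_pi]
    ring

theorem even (hW : IsOrbit p q β b W) (h : Exponents p q β) (θ : ℝ) : W (-θ) = W θ :=
  congrFun (hW.comp_neg.eq_of_eq_at hW h (θ₀ := 0) (by simp)) θ

theorem periodic (hW : IsOrbit p q β b W) (h : Exponents p q β) (θ : ℝ) :
    W (θ + Real.pi) = W θ := by
  refine congrFun (hW.comp_add_pi.eq_of_eq_at hW h (θ₀ := -(Real.pi / 2)) ?_) θ
  rw [← hW.even h (-(Real.pi / 2))]
  -- Evenness identifies the values at -π/2 and π/2, so the orbit and its shift by π agree at -π/2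
  -- and hence everywhere.
  congr 1
  ring

theorem lt_of_lt (hW : IsOrbit p q β b W) (hV : IsOrbit p q β b V) (h : Exponents p q β)
    {θ₀ : ℝ} (h0 : W θ₀ < V θ₀) (θ : ℝ) : W θ < V θ := by
  by_contra hcon
  have hc : Continuous fun θ => W θ - V θ := hW.continuous.sub hV.continuous
  have : (0 : ℝ) ∈ range fun θ => W θ - V θ :=
    mem_range_of_exists_le_of_exists_ge hc ⟨θ₀, by linarith⟩ ⟨θ, by linarith⟩
  obtain ⟨x, hx⟩ := this
  have := hW.eq_of_eq_at hV h (θ₀ := x) (by simpa [sub_eq_zero] using hx)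
  rw [this] at h0
  exact lt_irrefl _ h0

end IsOrbit

/-! ### Existence of orbits through truncation and a barrier -/

/-- The equation for the logarithm of the radial variable, truncated so as to be bounded and
globally Lipschitz. -/
def truncField (p q β b Λ ν θ l : ℝ) : ℝ :=
  (q + 1 - p) * Real.sin θ * (polM p β b θ + Real.exp (min l Λ) * polE q θ) /
    max (polA p β b θ + Real.exp (min l Λ) * polC q θ) ν

section truncated
variable {p q β b Λ ν : ℝ}

theorem abs_exp_min_sub_le (l m Λ : ℝ) :
    |Real.exp (min l Λ) - Real.exp (min m Λ)| ≤ Real.exp Λ * |l - m| := by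
  have key : ∀ x ∈ Iic Λ, ∀ y ∈ Iic Λ, ‖Real.exp y - Real.exp x‖ ≤ Real.exp Λ * ‖y - x‖ :=
    fun x hx y hy => (convex_Iic Λ).norm_image_sub_le_of_norm_hasDerivWithin_le
      (fun z _ => (Real.hasDerivAt_exp z).hasDerivWithinAt)
      (fun z hz => by
        rw [Real.norm_eq_abs, abs_of_pos (Real.exp_pos z)]
        exact Real.exp_le_exp.mpr hz) hx hy
  have h1 := key _ (mem_Iic.mpr (min_le_right m Λ)) _ (mem_Iic.mpr (min_le_right l Λ))
  refine h1.trans ?_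
  gcongr
  refine (abs_min_sub_min_le_max _ _ _ _).trans ?_
  simp

theorem abs_num_le (h : Exponents p q β) (θ l : ℝ) :
    |polM p β b θ + Real.exp (min l Λ) * polE q θ| ≤
      |p - 2| * (β + 1) + |b| + Real.exp Λ := by
  refine (abs_add_le _ _).trans (add_le_add (abs_polM_le h θ) ?_)
  rw [abs_mul, abs_of_pos (Real.exp_pos _)]
  calc _ ≤ Real.exp Λ * 1 := by
        gcongr
        · exact min_le_right _ _
        · exact abs_polE_le h θ
    _ = _ := mul_one _

theorem abs_truncField_le (h : Exponents p q β) (hν : 0 < ν) (θ l : ℝ) :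
    |truncField p q β b Λ ν θ l| ≤
      (q + 1 - p) * (|p - 2| * (β + 1) + |b| + Real.exp Λ) / ν := by
  have hr := h.r_pos
  unfold truncField
  have hmax : ν ≤ max (polA p β b θ + Real.exp (min l Λ) * polC q θ) ν := le_max_right _ _
  rw [abs_div, abs_mul, abs_mul, abs_of_pos hr, abs_of_pos (hν.trans_le hmax)]
  have h1 := abs_num_le (b := b) (Λ := Λ) h θ l
  have h2 := Real.abs_sin_le_one θ
  have hK0 : 0 ≤ |p - 2| * (β + 1) + |b| + Real.exp Λ := (abs_nonneg _).trans h1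
  calc _ ≤ (q + 1 - p) * 1 * (|p - 2| * (β + 1) + |b| + Real.exp Λ) / ν := by gcongr
    _ = _ := by rw [mul_one]

theorem continuous_truncField (h : Exponents p q β) (hν : 0 < ν) (l : ℝ) :
    Continuous fun θ => truncField p q β b Λ ν θ l := by
  have h1 := continuous_polA (b := b) h
  have h2 := continuous_polC h
  have h3 := continuous_polM (b := b) h
  have h4 := continuous_polE h
  unfold truncField
  refine Continuous.div (by fun_prop) (by fun_prop) fun θ => ?_
  exact (hν.trans_le (le_max_right _ _)).ne'

theorem abs_truncField_sub_le (h : Exponents p q β) (hν : 0 < ν) (θ l m : ℝ) :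
    |truncField p q β b Λ ν θ l - truncField p q β b Λ ν θ m| ≤
      ((q + 1 - p) * Real.exp Λ *
        (1 / ν + (|p - 2| * (β + 1) + |b| + Real.exp Λ) / ν ^ 2)) * |l - m| := by
  have hr := h.r_pos
  set K := |p - 2| * (β + 1) + |b| + Real.exp Λ with hK
  set x := Real.exp (min l Λ) with hx
  set y := Real.exp (min m Λ) with hy
  set d := max (polA p β b θ + x * polC q θ) ν with hd
  set e := max (polA p β b θ + y * polC q θ) ν with he
  have hdν : ν ≤ d := le_max_right _ _
  have heν : ν ≤ e := le_max_right _ _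
  have hd0 : 0 < d := hν.trans_le hdν
  have he0 : 0 < e := hν.trans_le heν
  have hxy : |x - y| ≤ Real.exp Λ * |l - m| := abs_exp_min_sub_le l m Λ
  have hde : |e - d| ≤ |x - y| := by
    refine (abs_max_sub_max_le_abs _ _ _).trans ?_
    rw [show polA p β b θ + y * polC q θ - (polA p β b θ + x * polC q θ) =
      -((x - y) * polC q θ) by ring, abs_neg, abs_mul, abs_of_nonneg (polC_nonneg θ)]
    exact mul_le_of_le_one_right (abs_nonneg _) (polC_le_one h θ)
  have hn : |polM p β b θ + y * polE q θ| ≤ K := abs_num_le h θ m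
  have hK0 : 0 ≤ K := (abs_nonneg _).trans hn
  have hE := abs_polE_le h θ
  have hs := Real.abs_sin_le_one θ
  have heq : truncField p q β b Λ ν θ l - truncField p q β b Λ ν θ m =
      (q + 1 - p) * Real.sin θ * ((x - y) * polE q θ / d +
        (polM p β b θ + y * polE q θ) * (e - d) / (d * e)) := by
    unfold truncField
    rw [← hx, ← hy, ← hd, ← he]
    field_simp
    ring
  rw [heq, abs_mul, abs_mul, abs_of_pos hr]
  have h1 : |(x - y) * polE q θ / d| ≤ |x - y| * (1 / ν) := by
    rw [abs_div, abs_mul, abs_of_pos hd0]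
    calc _ ≤ |x - y| * 1 / ν := by gcongr
      _ = _ := by ring
  have h2 : |(polM p β b θ + y * polE q θ) * (e - d) / (d * e)| ≤ |x - y| * (K / ν ^ 2) := by
    rw [abs_div, abs_mul, abs_of_pos (mul_pos hd0 he0)]
    calc _ ≤ K * |x - y| / (ν * ν) := by gcongr
      _ = _ := by ring
  calc _ ≤ (q + 1 - p) * 1 * (|x - y| * (1 / ν) + |x - y| * (K / ν ^ 2)) := by
        gcongr
        exact (abs_add_le _ _).trans (add_le_add h1 h2)
    _ = (q + 1 - p) * (1 / ν + K / ν ^ 2) * |x - y| := by ring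
    _ ≤ (q + 1 - p) * (1 / ν + K / ν ^ 2) * (Real.exp Λ * |l - m|) := by gcongr
    _ = _ := by ring

/-- Solutions of the truncated equation exist globally, are even and `π`-periodic. -/
theorem exists_truncated_solution (h : Exponents p q β) (hν : 0 < ν) (b Λ l₀ : ℝ) :
    ∃ l : ℝ → ℝ, l (-(Real.pi / 2)) = l₀ ∧
      (∀ θ, HasDerivAt l (truncField p q β b Λ ν θ (l θ)) θ) ∧
      (∀ θ, l (-θ) = l θ) ∧ ∀ θ, l (θ + Real.pi) = l θ := by
  set v := fun θ l => truncField p q β b Λ ν θ l with hv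
  set Lb := (q + 1 - p) * (|p - 2| * (β + 1) + |b| + Real.exp Λ) / ν
  set Kb := (q + 1 - p) * Real.exp Λ *
        (1 / ν + (|p - 2| * (β + 1) + |b| + Real.exp Λ) / ν ^ 2)
  have hr := h.r_pos
  have hβ := h.pos
  have hLb : 0 ≤ Lb := by positivity
  have hKb : 0 ≤ Kb := by positivity
  have hLip : ∀ t, LipschitzWith Kb.toNNReal (v t) := fun t =>
    LipschitzWith.of_dist_le_mul fun x y => by
      rw [Real.dist_eq, Real.dist_eq, Real.coe_toNNReal _ hKb]
      exact abs_truncField_sub_le h hν t x y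
  obtain ⟨l, hl0, hl⟩ := exists_global_solution (v := v) (L := Lb.toNNReal) hLip
    (fun x => continuous_truncField h hν x)
    (fun t x => by
      rw [Real.coe_toNNReal _ hLb]
      exact abs_truncField_le h hν t x) (-(Real.pi / 2)) l₀
  have huniq : ∀ g : ℝ → ℝ, (∀ θ, HasDerivAt g (v θ (g θ)) θ) → ∀ t₀, g t₀ = l t₀ → g = l :=
    fun g hg t₀ h0 => ODE_solution_unique_univ (v := v) (s := fun _ => univ) (t₀ := t₀)
      (fun t => (hLip t).lipschitzOnWith) (fun t => ⟨hg t, trivial⟩) (fun t => ⟨hl t, trivial⟩) h0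
  have heven : ∀ θ, l (-θ) = l θ := by
    refine congrFun (huniq (fun θ => l (-θ)) (fun θ => ?_) 0 (by simp))
    refine ((hl (-θ)).scomp θ (hasDerivAt_neg θ)).congr_deriv ?_
    simp only [hv, truncField, polA_neg, polC_neg, polM_neg, polE_neg, Real.sin_neg, smul_eq_mul]
    ring
  refine ⟨l, hl0, hl, heven, ?_⟩
  refine congrFun (huniq (fun θ => l (θ + Real.pi)) (fun θ => ?_) (-(Real.pi / 2)) ?_)
  · refine ((hl (θ + Real.pi)).comp_add_const θ Real.pi).congr_deriv ?_
    simp only [hv, truncField, polA_add_pi, polC_add_pi, polM_add_pi, polE_add_pi, Real.sin_add_pi]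
    ring
  · rw [← heven (-(Real.pi / 2))]
    congr 1
    ring

end truncated

section bounds
variable {p q β b : ℝ}

theorem polE_eq_rpow {θ : ℝ} (hθ : 0 < Real.cos θ) : polE q θ = Real.cos θ ^ q := by
  rw [polE, abs_of_pos hθ, ← Real.rpow_add_one hθ.ne', sub_add_cancel]

theorem polE_nonneg {θ : ℝ} (hθ : 0 ≤ Real.cos θ) : 0 ≤ polE q θ := by
  unfold polE; positivity

/-- For a large radial variable, the radial variable decreases or the angle is close to that of a
zero. -/
theorem truncField_le (h : Exponents p q β) {c₀ Λ l₁ ν θ l : ℝ} (hc₀ : 0 < c₀)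
    (hA : ∀ θ, |Real.cos θ| ≤ c₀ → (p - 1) * β / 2 ≤ polA p β b θ)
    (hl₁ : |p - 2| * (β + 1) + |b| < Real.exp l₁ * c₀ ^ q) (hΛ : l₁ ≤ Λ) (hl : l₁ ≤ l)
    (hν : 0 < ν) (hcos : 0 ≤ Real.cos θ) (hsin : Real.sin θ ≤ 0) :
    truncField p q β b Λ ν θ l ≤
      (q + 1 - p) * (|p - 2| * (β + 1) + |b|) / ((p - 1) * β / 2) := by
  have hr := h.r_pos
  have hp := h.one_lt
  have hβ := h.pos
  have hpos : 0 < (p - 1) * β / 2 := by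
    have := mul_pos (sub_pos.mpr hp) hβ
    linarith
  have hden : 0 < max (polA p β b θ + Real.exp (min l Λ) * polC q θ) ν :=
    hν.trans_le (le_max_right _ _)
  have hm : Real.exp l₁ ≤ Real.exp (min l Λ) := Real.exp_le_exp.mpr (le_min hl hΛ)
  unfold truncField
  -- Since sin θ ≤ 0, a nonnegative numerator makes the field nonpositive. If it is negative, the
  -- term with `polE` does not outweigh `polM`; as `l ≥ l₁`, this forces cos θ ≤ c₀, where the
  -- denominator is bounded below.
  rcases le_or_gt 0 (polM p β b θ + Real.exp (min l Λ) * polE q θ) with h1 | h1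
  · refine le_trans ?_ (by positivity : 0 ≤
      (q + 1 - p) * (|p - 2| * (β + 1) + |b|) / ((p - 1) * β / 2))
    apply div_nonpos_of_nonpos_of_nonneg _ hden.le
    exact mul_nonpos_of_nonpos_of_nonneg (mul_nonpos_of_nonneg_of_nonpos hr.le hsin) h1
  · have hM := (abs_le.mp (abs_polM_le (b := b) h θ)).1
    have hE0 := polE_nonneg (q := q) hcos
    have hE1 := mul_nonneg (Real.exp_pos (min l Λ)).le hE0
    have hcc : Real.cos θ ≤ c₀ := by
      by_contra hcon
      push Not at hcon
      have h2 : c₀ ^ q ≤ polE q θ := by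
        rw [polE_eq_rpow (hc₀.trans hcon)]
        exact Real.rpow_le_rpow hc₀.le hcon.le h.q_pos.le
      have h3 : Real.exp l₁ * c₀ ^ q ≤ Real.exp (min l Λ) * polE q θ := by gcongr
      linarith
    have hA' := hA θ (by rwa [abs_of_nonneg hcos])
    have hdge : (p - 1) * β / 2 ≤ max (polA p β b θ + Real.exp (min l Λ) * polC q θ) ν := by
      refine le_max_of_le_left ?_
      have := mul_nonneg (Real.exp_pos (min l Λ)).le (polC_nonneg (q := q) θ)
      linarith
    have hs1 : -Real.sin θ ≤ 1 := by linarith [Real.neg_one_le_sin θ]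
    rw [show (q + 1 - p) * Real.sin θ * (polM p β b θ + Real.exp (min l Λ) * polE q θ) =
      (q + 1 - p) * (-Real.sin θ * -(polM p β b θ + Real.exp (min l Λ) * polE q θ)) by ring]
    have h5 : -Real.sin θ * -(polM p β b θ + Real.exp (min l Λ) * polE q θ) ≤
        1 * (|p - 2| * (β + 1) + |b|) := by
      apply mul_le_mul hs1 (by linarith) (by linarith) zero_le_one
    rw [one_mul] at h5
    gcongr

/-- The radius can only shrink where the radial numerator is positive, and there `cos_mul_polM`
keeps the denominator above β D. The bound does not involve ν, so ν can be chosen after it. -/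
theorem neg_truncField_le (h : Exponents p q β) {Λ ν θ l : ℝ} (hν : 0 < ν)
    (hcos : 0 ≤ Real.cos θ) (hsin : Real.sin θ ≤ 0) :
    -truncField p q β b Λ ν θ l ≤ (q + 1 - p) *
      (|p - 2| * (β + 1) + |b| + Real.exp Λ) / (β * min 1 (p - 1)) := by
  have hr := h.r_pos
  have hp := h.one_lt
  have hβ := h.pos
  have hδ : 0 < min 1 (p - 1) := lt_min one_pos (by linarith)
  have hden : 0 < max (polA p β b θ + Real.exp (min l Λ) * polC q θ) ν :=
    hν.trans_le (le_max_right _ _)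
  unfold truncField
  have hn := abs_num_le (b := b) (Λ := Λ) h θ l
  rw [← neg_div, show -((q + 1 - p) * Real.sin θ *
    (polM p β b θ + Real.exp (min l Λ) * polE q θ)) =
      (q + 1 - p) * (-Real.sin θ * (polM p β b θ + Real.exp (min l Λ) * polE q θ)) by ring]
  rcases le_or_gt (polM p β b θ + Real.exp (min l Λ) * polE q θ) 0 with h1 | h1
  · refine le_trans ?_ (by positivity : 0 ≤ (q + 1 - p) *
      (|p - 2| * (β + 1) + |b| + Real.exp Λ) / (β * min 1 (p - 1)))
    apply div_nonpos_of_nonpos_of_nonneg _ hden.le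
    exact mul_nonpos_of_nonneg_of_nonpos hr.le
      (mul_nonpos_of_nonneg_of_nonpos (by linarith) h1)
  · have hdge : β * min 1 (p - 1) ≤
        max (polA p β b θ + Real.exp (min l Λ) * polC q θ) ν := by
      refine le_max_of_le_left ?_
      have h2 := cos_mul_polM (b := b) h θ (Real.exp (min l Λ))
      have h3 := mul_nonneg hcos h1.le
      have h4 := mul_le_mul_of_nonneg_left (polD_ge p θ) hβ.le
      linarith
    have h5 : -Real.sin θ * (polM p β b θ + Real.exp (min l Λ) * polE q θ) ≤
        1 * (|p - 2| * (β + 1) + |b| + Real.exp Λ) := by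
      apply mul_le_mul (by linarith [Real.neg_one_le_sin θ]) ((le_abs_self _).trans hn) h1.le
        zero_le_one
    rw [one_mul] at h5
    have h6 : 0 < β * min 1 (p - 1) := mul_pos hβ hδ
    gcongr

/-- The derivative of the barrier function along the truncated flow. -/
theorem barrier_deriv_pos (h : Exponents p q β) {κ θ W N : ℝ} (hκ : 0 < κ) (hκ1 : κ < 1)
    (hκp : p * (p - 1) * β + (p - 2) ^ 2 < (1 - κ) * (p * min 1 (p - 1)) / κ)
    (hcos : 0 < Real.cos θ) (hsin : Real.sin θ < 0) (hW : 0 < W)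
    (hB : polA p β b θ + (1 - κ) * (W * polC q θ) = 0)
    (hN : N = polA p β b θ + W * polC q θ) :
    0 < ((p - 2) * (2 * Real.cos θ * -Real.sin θ)
      - b * (p * |Real.cos θ| ^ (p - 2) * Real.cos θ * -Real.sin θ)) +
      (1 - κ) * (W * ((q + 1 - p) * Real.sin θ * (polM p β b θ + W * polE q θ) / N) * polC q θ
        + W * ((q + 1) * |Real.cos θ| ^ (q - 1) * Real.cos θ * -Real.sin θ)) := by
  have hp := h.one_lt
  have hC : 0 < polC q θ := by unfold polC; positivity
  have hx : 0 < W * polC q θ := mul_pos hW hC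
  have hNx : N = κ * (W * polC q θ) := by rw [hN]; linarith
  have hN0 : 0 < N := by rw [hNx]; positivity
  have h1 := cos_mul_polM (b := b) h θ W
  rw [← hN] at h1
  have h2 := abs_rpow_eq_mul (Real.cos θ) (s := p - 1) (by linarith)
  rw [show p - 1 + 1 = p by ring, show p - 1 - 1 = p - 2 by ring] at h2
  have h3 := abs_rpow_eq_mul (Real.cos θ) h.q_pos
  have hD := polD_ge p θ
  have hA : polA p β b θ = -((1 - κ) * (W * polC q θ)) := by linarith
  refine pos_of_mul_pos_right (a := Real.cos θ) ?_ hcos.le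
  have key : Real.cos θ * (((p - 2) * (2 * Real.cos θ * -Real.sin θ)
      - b * (p * |Real.cos θ| ^ (p - 2) * Real.cos θ * -Real.sin θ)) +
      (1 - κ) * (W * ((q + 1 - p) * Real.sin θ * (polM p β b θ + W * polE q θ) / N) * polC q θ
        + W * ((q + 1) * |Real.cos θ| ^ (q - 1) * Real.cos θ * -Real.sin θ))) =
      -Real.sin θ * ((1 - κ) * (p * polD p θ) / κ
        - (p * (p - 1) * β + (p - 2) ^ 2 * Real.cos θ ^ 2)) := by
    have e1 : Real.cos θ * ((q + 1 - p) * Real.sin θ * (polM p β b θ + W * polE q θ) / N) =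
        (q + 1 - p) * Real.sin θ * (1 - β * polD p θ / N) := by
      rw [mul_div_assoc', show Real.cos θ * ((q + 1 - p) * Real.sin θ *
        (polM p β b θ + W * polE q θ)) = (q + 1 - p) * Real.sin θ *
        (Real.cos θ * (polM p β b θ + W * polE q θ)) by ring, h1]
      field_simp
    have e2 : Real.cos θ * (W * ((q + 1) * |Real.cos θ| ^ (q - 1) * Real.cos θ * -Real.sin θ)) =
        (q + 1) * (W * polC q θ) * -Real.sin θ := by
      unfold polC
      rw [h3]; ring
    have e3 : Real.cos θ * (b * (p * |Real.cos θ| ^ (p - 2) * Real.cos θ * -Real.sin θ)) =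
        p * (b * |Real.cos θ| ^ p) * -Real.sin θ := by
      rw [h2]; ring
    have e4 : b * |Real.cos θ| ^ p = (p - 1) * β + (p - 2) * Real.cos θ ^ 2 - polA p β b θ := by
      unfold polA; ring
    have e5 : W * polC q θ / N = 1 / κ := by
      rw [hNx]; field_simp
    have e6 : (q + 1 - p) * β = p := by rw [mul_comm]; exact h.rel
    calc _ = (p - 2) * (2 * Real.cos θ ^ 2 * -Real.sin θ)
          - Real.cos θ * (b * (p * |Real.cos θ| ^ (p - 2) * Real.cos θ * -Real.sin θ))
          + (1 - κ) * (W * polC q θ * (Real.cos θ * ((q + 1 - p) * Real.sin θ *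
            (polM p β b θ + W * polE q θ) / N)) + Real.cos θ * (W * ((q + 1) *
            |Real.cos θ| ^ (q - 1) * Real.cos θ * -Real.sin θ))) := by ring
      _ = -Real.sin θ * (p * (polA p β b θ + (1 - κ) * (W * polC q θ))
          + (1 - κ) * (((q + 1 - p) * β) * polD p θ * (W * polC q θ / N))
        - (p * (p - 1) * β + (p - 2) ^ 2 * Real.cos θ ^ 2)) := by
          rw [e1, e2, e3, e4]; ring
      _ = _ := by rw [hB, e5, e6]; ring
  rw [key]
  apply mul_pos (by linarith)
  have h6 : (1 - κ) * (p * min 1 (p - 1)) / κ ≤ (1 - κ) * (p * polD p θ) / κ := by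
    have : 0 < 1 - κ := by linarith
    gcongr
  have h7 : (p - 2) ^ 2 * Real.cos θ ^ 2 ≤ (p - 2) ^ 2 * 1 := by
    gcongr
    exact Real.cos_sq_le_one θ
  linarith

/-- Through every point of the axis of zeros there passes an orbit. -/
theorem exists_isOrbit (h : Exponents p q β) (b : ℝ) {a : ℝ} (ha : 0 < a) :
    ∃ W, IsOrbit p q β b W ∧ W (-(Real.pi / 2)) = a := by
  have hr := h.r_pos
  have hp := h.one_lt
  have hβ := h.pos
  have hπ := Real.pi_pos
  have hδ : 0 < min 1 (p - 1) := lt_min one_pos (by linarith)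
  have hpβ : 0 < (p - 1) * β := mul_pos (by linarith) hβ
  obtain ⟨c₀, hc₀, -, hA⟩ := exists_polA_ge h b
  obtain ⟨l₁, hl₁⟩ : ∃ l₁, |p - 2| * (β + 1) + |b| < Real.exp l₁ * c₀ ^ q := by
    have hcq : 0 < c₀ ^ q := Real.rpow_pos_of_pos hc₀ q
    refine ⟨(|p - 2| * (β + 1) + |b|) / c₀ ^ q, ?_⟩
    have h1 := Real.add_one_le_exp ((|p - 2| * (β + 1) + |b|) / c₀ ^ q)
    rw [← div_lt_iff₀ hcq]
    linarith
  set C₁ := (q + 1 - p) * (|p - 2| * (β + 1) + |b|) / ((p - 1) * β / 2) with hC₁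
  have hC₁0 : 0 ≤ C₁ := by positivity
  -- An upper bound for `l` after a quarter turn at growth rate at most `C₁`, so the truncation at Λ
  -- never acts.
  set Λ := max (Real.log a) l₁ + C₁ * (Real.pi / 2) with hΛ
  set C₂ := (q + 1 - p) * (|p - 2| * (β + 1) + |b| + Real.exp Λ) / (β * min 1 (p - 1)) with hC₂
  have hC₂0 : 0 ≤ C₂ := by positivity
  set W₀ := Real.exp (Real.log a - C₂ * (Real.pi / 2)) with hW₀
  set Q := p * (p - 1) * β + (p - 2) ^ 2 with hQ
  have hQ0 : 0 ≤ Q := by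
    have : 0 ≤ p * (p - 1) * β := by rw [mul_assoc]; positivity
    positivity
  -- Chosen so that (1 - κ) p min(1, p-1)/κ equals Q + 1, just above the threshold of
  -- `barrier_deriv_pos`.
  set κ := p * min 1 (p - 1) / (p * min 1 (p - 1) + Q + 1) with hκdef
  have hpδ : 0 < p * min 1 (p - 1) := mul_pos (by linarith) hδ
  have hκ : 0 < κ := by positivity
  have hκ1 : κ < 1 := by rw [hκdef, div_lt_one (by positivity)]; linarith
  have hκp : Q < (1 - κ) * (p * min 1 (p - 1)) / κ := by
    have : (1 - κ) * (p * min 1 (p - 1)) / κ = Q + 1 := by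
      rw [hκdef]; field_simp; ring
    linarith
  -- The two lower bounds of the angular numerator: near the axis of zeros from `exists_polA_ge`,
  -- elsewhere from nonnegativity of the barrier together with `W₀ ≤ W`.
  set ν := min ((p - 1) * β / 2) (κ * (W₀ * c₀ ^ (q + 1))) with hν
  have hν0 : 0 < ν := lt_min (by linarith) (by positivity)
  obtain ⟨l, hl0, hl, heven, hper⟩ := exists_truncated_solution h hν0 b Λ (Real.log a)
  have hcos : ∀ θ ∈ Icc (-(Real.pi / 2)) 0, 0 ≤ Real.cos θ := fun θ hθ =>
    Real.cos_nonneg_of_mem_Icc ⟨hθ.1, by linarith [hθ.2]⟩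
  have hsin : ∀ θ ∈ Icc (-(Real.pi / 2)) 0, Real.sin θ ≤ 0 := fun θ hθ =>
    Real.sin_nonpos_of_nonpos_of_neg_pi_le hθ.2 (by linarith [hθ.1])
  have hΛl : l₁ ≤ Λ := by
    have : 0 ≤ C₁ * (Real.pi / 2) := by positivity
    linarith [le_max_right (Real.log a) l₁]
  have hup : ∀ θ ∈ Icc (-(Real.pi / 2)) 0, l θ ≤ Λ := by
    intro θ hθ
    refine (le_max_add_of_deriv_le (a := -(Real.pi / 2)) (b := 0) (m := l₁) hC₁0
      (fun t _ => hl t) (fun t ht hm => ?_) hθ).trans ?_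
    · exact truncField_le h hc₀ hA hl₁ hΛl hm hν0 (hcos t ht) (hsin t ht)
    · rw [hl0, hΛ]
      gcongr
      linarith [hθ.2]
  have hlow : ∀ θ ∈ Icc (-(Real.pi / 2)) 0, W₀ ≤ Real.exp (l θ) := by
    intro θ hθ
    apply Real.exp_le_exp.mpr
    have := le_max_add_of_deriv_le (f := fun t => -l t) (a := -(Real.pi / 2)) (b := 0)
      (m := -l (-(Real.pi / 2))) hC₂0 (fun t _ => (hl t).neg)
      (fun t ht _ => neg_truncField_le h hν0 (hcos t ht) (hsin t ht)) hθ
    rw [max_self, hl0] at this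
    have h2 : C₂ * (θ - -(Real.pi / 2)) ≤ C₂ * (Real.pi / 2) := by
      gcongr
      linarith [hθ.2]
    linarith
  have hlc : Continuous l := continuous_iff_continuousAt.mpr fun x => (hl x).continuousAt
  set B : ℝ → ℝ := fun θ => polA p β b θ + (1 - κ) * (Real.exp (l θ) * polC q θ) with hB
  have hBc : Continuous B := by
    have h1 := continuous_polA (b := b) h
    have h2 := continuous_polC h
    fun_prop
  have hcase : ∀ θ ∈ Icc (-(Real.pi / 2)) 0, 0 ≤ B θ →
      ν ≤ polA p β b θ + Real.exp (l θ) * polC q θ := by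
    intro θ hθ hBθ
    have hx : 0 ≤ Real.exp (l θ) * polC q θ := mul_nonneg (Real.exp_pos _).le (polC_nonneg θ)
    rcases le_or_gt |Real.cos θ| c₀ with h1 | h1
    · have := hA θ h1
      exact (min_le_left _ _).trans (by linarith)
    · have h2 : c₀ ^ (q + 1) ≤ polC q θ :=
        Real.rpow_le_rpow hc₀.le h1.le (by linarith [h.q_pos])
      have h3 : W₀ * c₀ ^ (q + 1) ≤ Real.exp (l θ) * polC q θ := by
        have := hlow θ hθ
        gcongr
      have h4 := mul_le_mul_of_nonneg_left h3 hκ.le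
      refine (min_le_right _ _).trans ?_
      simp only [hB] at hBθ
      linarith
  -- The endpoint 0 is left out because the derivative of the barrier carries the factor -sin θ,
  -- which vanishes there; nonnegativity at 0 follows by continuity.
  have hBpos : ∀ θ ∈ Ico (-(Real.pi / 2)) 0, 0 < B θ := by
    intro θ₁ hθ₁
    refine pos_of_deriv_pos_at_zero (f := B) (a := -(Real.pi / 2)) (b := θ₁) (f' := fun θ =>
      ((p - 2) * (2 * Real.cos θ * -Real.sin θ)
      - b * (p * |Real.cos θ| ^ (p - 2) * Real.cos θ * -Real.sin θ)) +
      (1 - κ) * (Real.exp (l θ) * ((q + 1 - p) * Real.sin θ *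
        (polM p β b θ + Real.exp (l θ) * polE q θ) /
          (polA p β b θ + Real.exp (l θ) * polC q θ)) * polC q θ
        + Real.exp (l θ) * ((q + 1) * |Real.cos θ| ^ (q - 1) * Real.cos θ * -Real.sin θ)))
      hBc.continuousOn ?_ ?_ (right_mem_Icc.mpr hθ₁.1)
    · simp only [hB]
      have : Real.cos (-(Real.pi / 2)) = 0 := by simp
      rw [polA_of_cos_eq_zero h this, polC, this, abs_zero,
        Real.zero_rpow (by linarith [h.q_pos] : q + 1 ≠ 0)]
      linarith
    · intro θ hθ hBθ
      have hmem : θ ∈ Icc (-(Real.pi / 2)) 0 := ⟨hθ.1.le, hθ.2.trans hθ₁.2.le⟩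
      have hc : 0 < Real.cos θ := Real.cos_pos_of_mem_Ioo ⟨hθ.1, by linarith [hθ.2, hθ₁.2]⟩
      have hs : Real.sin θ < 0 :=
        Real.sin_neg_of_neg_of_neg_pi_lt (by linarith [hθ.2, hθ₁.2]) (by linarith [hθ.1])
      have hN := hcase θ hmem hBθ.ge
      refine ⟨?_, barrier_deriv_pos h hκ hκ1 hκp hc hs (Real.exp_pos _) hBθ rfl⟩
      have hder := (hl θ)
      have heq : truncField p q β b Λ ν θ (l θ) = (q + 1 - p) * Real.sin θ *
        (polM p β b θ + Real.exp (l θ) * polE q θ) /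
          (polA p β b θ + Real.exp (l θ) * polC q θ) := by
        rw [truncField, min_eq_left (hup θ hmem), max_eq_left hN]
      rw [heq] at hder
      exact (hasDerivAt_polA h θ).add (((hder.exp).mul (hasDerivAt_polC h θ)).const_mul (1 - κ))
  have hBnn : ∀ θ ∈ Icc (-(Real.pi / 2)) 0, 0 ≤ B θ := by
    intro θ hθ
    rcases hθ.2.lt_or_eq with h1 | h1
    · exact (hBpos θ ⟨hθ.1, h1⟩).le
    · rw [h1]
      have : Tendsto B (𝓝[<] 0) (𝓝 (B 0)) := (hBc.tendsto 0).mono_left nhdsWithin_le_nhds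
      apply ge_of_tendsto this
      filter_upwards [Ico_mem_nhdsLT (by linarith : -(Real.pi / 2) < 0)] with x hx
      exact (hBpos x hx).le
  have hall : ∀ θ, l θ ≤ Λ ∧ ν ≤ polA p β b θ + Real.exp (l θ) * polC q θ := by
    intro θ
    have hF : Function.Periodic (fun θ => (l θ, polA p β b θ, polC q θ)) Real.pi := by
      intro x
      simp only [hper, polA_add_pi, polC_add_pi]
    obtain ⟨y, hy, hxy⟩ := hF.exists_mem_Ico hπ θ (-(Real.pi / 2))
    simp only [Prod.mk.injEq] at hxy
    rw [hxy.1, hxy.2.1, hxy.2.2]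
    rcases le_total y 0 with h1 | h1
    · exact ⟨hup y ⟨hy.1, h1⟩, hcase y ⟨hy.1, h1⟩ (hBnn y ⟨hy.1, h1⟩)⟩
    · have hmem : -y ∈ Icc (-(Real.pi / 2)) 0 := ⟨by linarith [hy.2], by linarith⟩
      rw [← heven y, ← polA_neg, ← polC_neg]
      exact ⟨hup _ hmem, hcase _ hmem (hBnn _ hmem)⟩
  refine ⟨fun θ => Real.exp (l θ), ⟨fun θ => Real.exp_pos _, fun θ => hν0.trans_le (hall θ).2,
    fun θ => ?_⟩, ?_⟩
  · refine (hl θ).exp.congr_deriv ?_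
    rw [truncField, min_eq_left (hall θ).1, max_eq_left (hall θ).2]
    ring
  · simp only [hl0, Real.exp_log ha]

end bounds

/-! ### The quarter period as a function of the orbit -/

section quarterTime
variable {p q β b : ℝ}

open Classical in
/-- The orbit with value `a` of the radial variable at the axis of zeros. -/
def orbit (p q β b a : ℝ) : ℝ → ℝ :=
  if h : ∃ W, IsOrbit p q β b W ∧ W (-(Real.pi / 2)) = a then h.choose else 0

theorem orbit_spec (h : Exponents p q β) (b : ℝ) {a : ℝ} (ha : 0 < a) :
    IsOrbit p q β b (orbit p q β b a) ∧ orbit p q β b a (-(Real.pi / 2)) = a := by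
  have hex := exists_isOrbit h b ha
  rw [orbit, dif_pos hex]
  exact hex.choose_spec

theorem isOrbit_orbit (h : Exponents p q β) (b : ℝ) {a : ℝ} (ha : 0 < a) :
    IsOrbit p q β b (orbit p q β b a) := (orbit_spec h b ha).1

theorem orbit_at (h : Exponents p q β) (b : ℝ) {a : ℝ} (ha : 0 < a) :
    orbit p q β b a (-(Real.pi / 2)) = a := (orbit_spec h b ha).2

theorem orbit_lt_orbit (h : Exponents p q β) (b : ℝ) {a a' : ℝ} (ha : 0 < a) (haa : a < a')
    (θ : ℝ) : orbit p q β b a θ < orbit p q β b a' θ := by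
  refine (isOrbit_orbit h b ha).lt_of_lt (isOrbit_orbit h b (ha.trans haa)) h
    (θ₀ := -(Real.pi / 2)) ?_ θ
  rwa [orbit_at h b ha, orbit_at h b (ha.trans haa)]

/-- The derivative of time with respect to the angle along an orbit. -/
def slowness (p q β b : ℝ) (W : ℝ → ℝ) (θ : ℝ) : ℝ :=
  polD p θ / (polA p β b θ + W θ * polC q θ)

/-- The time an orbit needs from a zero to the following extremum. -/
def quarterTime (p q β b a : ℝ) : ℝ :=
  ∫ θ in (-(Real.pi / 2))..0, slowness p q β b (orbit p q β b a) θ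

theorem IsOrbit.continuous_slowness {W : ℝ → ℝ} (hW : IsOrbit p q β b W) (h : Exponents p q β) :
    Continuous (slowness p q β b W) :=
  continuous_polD.div (hW.continuous_speed h) fun θ => (hW.speed_pos θ).ne'

theorem IsOrbit.slowness_pos {W : ℝ → ℝ} (hW : IsOrbit p q β b W) (h : Exponents p q β) (θ : ℝ) :
    0 < slowness p q β b W θ := div_pos (polD_pos h θ) (hW.speed_pos θ)

theorem polD_le (h : Exponents p q β) (θ : ℝ) : polD p θ ≤ p := by
  have h1 := Real.sin_sq_add_cos_sq θ
  have h2 := h.one_lt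
  unfold polD
  nlinarith [sq_nonneg (Real.sin θ), sq_nonneg (Real.cos θ)]

theorem abs_polA_le (h : Exponents p q β) (θ : ℝ) :
    |polA p β b θ| ≤ (p - 1) * β + |p - 2| + |b| := by
  have hp := h.one_lt
  have h0 : 0 ≤ (p - 1) * β := mul_nonneg (by linarith) h.pos.le
  have h1 : |Real.cos θ| ^ p ≤ 1 :=
    Real.rpow_le_one (abs_nonneg _) (Real.abs_cos_le_one θ) (by linarith)
  have h2 : 0 ≤ |Real.cos θ| ^ p := by positivity
  unfold polA
  calc _ ≤ |(p - 1) * β| + |(p - 2) * Real.cos θ ^ 2| + |b * |Real.cos θ| ^ p| :=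
        (abs_sub _ _).trans (add_le_add_left (abs_add_le _ _) _)
    _ = (p - 1) * β + |p - 2| * Real.cos θ ^ 2 + |b| * |Real.cos θ| ^ p := by
        rw [abs_of_nonneg h0, abs_mul, abs_mul, abs_of_nonneg (sq_nonneg (Real.cos θ)),
          abs_of_nonneg h2]
    _ ≤ (p - 1) * β + |p - 2| * 1 + |b| * 1 := by
        gcongr
        exact Real.cos_sq_le_one θ
    _ = _ := by ring

theorem quarterTime_pos (h : Exponents p q β) (b : ℝ) {a : ℝ} (ha : 0 < a) :
    0 < quarterTime p q β b a :=
  intervalIntegral.intervalIntegral_pos_of_pos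
    (((isOrbit_orbit h b ha).continuous_slowness h).intervalIntegrable _ _)
    (fun θ => (isOrbit_orbit h b ha).slowness_pos h θ) (by linarith [Real.pi_pos])

theorem polC_pos {θ : ℝ} (hθ : Real.cos θ ≠ 0) : 0 < polC q θ :=
  Real.rpow_pos_of_pos (abs_pos.mpr hθ) _

/-- The orbit with the larger initial value lies above the other one and therefore turns faster,
strictly so where the cosine is not zero. -/
theorem quarterTime_strictAnti (h : Exponents p q β) (b : ℝ) {a a' : ℝ} (ha : 0 < a)
    (haa : a < a') : quarterTime p q β b a' < quarterTime p q β b a := by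
  have hW := isOrbit_orbit h b ha
  have hW' := isOrbit_orbit h b (ha.trans haa)
  have hπ := Real.pi_pos
  refine intervalIntegral.integral_lt_integral_of_continuousOn_of_le_of_exists_lt (by linarith)
    (hW'.continuous_slowness h).continuousOn (hW.continuous_slowness h).continuousOn
    (fun θ _ => ?_) ⟨0, ⟨by linarith, le_rfl⟩, ?_⟩
  · refine div_le_div_of_nonneg_left (polD_pos h θ).le (hW.speed_pos θ) ?_
    have := mul_le_mul_of_nonneg_right (orbit_lt_orbit h b ha haa θ).le (polC_nonneg (q := q) θ)
    linarith
  · refine div_lt_div_of_pos_left (polD_pos h 0) (hW.speed_pos 0) ?_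
    have := mul_lt_mul_of_pos_right (orbit_lt_orbit h b ha haa 0)
      (polC_pos (q := q) (θ := 0) (by simp))
    linarith

theorem quarterTime_injOn (h : Exponents p q β) (b : ℝ) :
    InjOn (quarterTime p q β b) (Ioi 0) := by
  intro a ha a' ha' heq
  rcases lt_trichotomy a a' with h1 | h1 | h1
  · exact absurd heq (quarterTime_strictAnti h b ha h1).ne'
  · exact h1
  · exact absurd heq (quarterTime_strictAnti h b ha' h1).ne

/-- For a in (a₀/2, 2a₀) the orbits lie between the two extreme ones, which gives common bounds on
the radius from above and on the speed from below. Gronwall for the difference of two orbits then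
yields |T(a) - T(a₀)| ≤ L |a - a₀|. -/
theorem quarterTime_continuousOn (h : Exponents p q β) (b : ℝ) :
    ContinuousOn (quarterTime p q β b) (Ioi 0) := by
  intro a₀ ha₀
  apply ContinuousAt.continuousWithinAt
  have ha₀' : (0 : ℝ) < a₀ := ha₀
  have hπ := Real.pi_pos
  have hr := h.r_pos
  set W₁ := orbit p q β b (a₀ / 2) with hW₁
  set W₂ := orbit p q β b (2 * a₀) with hW₂
  have hO₁ := isOrbit_orbit h b (by linarith : 0 < a₀ / 2)
  have hO₂ := isOrbit_orbit h b (by linarith : 0 < 2 * a₀)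
  set I := Icc (-(Real.pi / 2)) (0 : ℝ) with hI
  obtain ⟨x₁, -, hx₁⟩ := isCompact_Icc.exists_isMinOn (s := I)
    (nonempty_Icc.mpr (by linarith)) (hO₁.continuous_speed h).continuousOn
  obtain ⟨x₂, -, hx₂⟩ := isCompact_Icc.exists_isMaxOn (s := I)
    (nonempty_Icc.mpr (by linarith)) hO₂.continuous.continuousOn
  set ν := polA p β b x₁ + W₁ x₁ * polC q x₁ with hν
  set Y := W₂ x₂ with hY
  have hν0 : 0 < ν := hO₁.speed_pos x₁
  have hY0 : 0 < Y := hO₂.pos x₂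
  have hrange : ∀ a ∈ Ioo (a₀ / 2) (2 * a₀), ∀ θ ∈ I, orbit p q β b a θ ≤ Y ∧
      ν ≤ polA p β b θ + orbit p q β b a θ * polC q θ := by
    intro a ha θ hθ
    refine ⟨(orbit_lt_orbit h b (by linarith [ha.1]) ha.2 θ).le.trans (hx₂ hθ), ?_⟩
    have h1 := (orbit_lt_orbit h b (by linarith) ha.1 θ).le
    have h2 := mul_le_mul_of_nonneg_right h1 (polC_nonneg (q := q) θ)
    have h3 : ν ≤ polA p β b θ + orbit p q β b (a₀ / 2) θ * polC q θ := hx₁ hθ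
    linarith
  set K₀ := |p - 2| * (β + 1) + |b| with hK₀
  set K₁ := (p - 1) * β + |p - 2| + |b| with hK₁
  set K := (q + 1 - p) * (K₀ * K₁ + K₁ * (2 * Y) + Y * Y) / (ν * ν) with hK
  have hmem₀ : a₀ ∈ Ioo (a₀ / 2) (2 * a₀) := ⟨by linarith, by linarith⟩
  have hO₀ := isOrbit_orbit h b ha₀'
  have hdist : ∀ a ∈ Ioo (a₀ / 2) (2 * a₀), ∀ θ ∈ I,
      |orbit p q β b a θ - orbit p q β b a₀ θ| ≤ |a - a₀| * Real.exp (|K| * Real.pi) := by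
    intro a ha θ hθ
    have hapos : 0 < a := by linarith [ha.1]
    have hO := isOrbit_orbit h b hapos
    have := abs_le_of_abs_deriv_le_right (K := K)
      (u := fun θ => orbit p q β b a θ - orbit p q β b a₀ θ) hθ.1
      (hO.continuous.sub hO₀.continuous).continuousOn (fun x _ => hO.hasDerivAt_sub hO₀ x)
      (fun x hx => ?_)
    · simp only [orbit_at h b hapos, orbit_at h b ha₀'] at this
      have hθ0 : 0 ≤ θ - -(Real.pi / 2) := by linarith [hθ.1]
      refine this.trans (mul_le_mul_of_nonneg_left (Real.exp_le_exp.mpr ?_) (abs_nonneg _))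
      exact (mul_le_mul_of_nonneg_right (le_abs_self K) hθ0).trans
        (mul_le_mul_of_nonneg_left (by linarith [hθ.2]) (abs_nonneg K))
    · rw [abs_mul]
      refine mul_le_mul_of_nonneg_right ?_ (abs_nonneg _)
      have hxI : x ∈ I := ⟨hx.1.le, hx.2.le.trans hθ.2⟩
      obtain ⟨g1, g2⟩ := hrange a ha x hxI
      obtain ⟨g3, g4⟩ := hrange a₀ hmem₀ x hxI
      have p1 := hO.pos x
      have p2 := hO₀.pos x
      have hM := abs_polM_le (b := b) h x
      have hA := abs_polA_le (b := b) h x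
      have hE := abs_polE_le h x
      have hC := polC_le_one h x
      have hC0 := polC_nonneg (q := q) x
      have hs := Real.abs_sin_le_one x
      set W := orbit p q β b a x
      set V := orbit p q β b a₀ x
      unfold diffRate
      rw [abs_div, abs_mul, abs_mul, abs_of_pos hr, abs_of_pos (a := _ * _)
        (mul_pos (hν0.trans_le g2) (hν0.trans_le g4))]
      have hK₀0 : 0 ≤ K₀ := (abs_nonneg _).trans hM
      have hK₁0 : 0 ≤ K₁ := (abs_nonneg _).trans hA
      have hnum : |polM p β b x * polA p β b x + polE q x * polA p β b x * (W + V)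
          + polE q x * polC q x * W * V| ≤ K₀ * K₁ + K₁ * (2 * Y) + Y * Y := by
        refine (abs_add_le _ _).trans (add_le_add ((abs_add_le _ _).trans (add_le_add ?_ ?_)) ?_)
        · rw [abs_mul]; gcongr
        · rw [abs_mul, abs_mul, abs_of_pos (add_pos p1 p2)]
          calc _ ≤ 1 * K₁ * (Y + Y) := by gcongr
            _ = _ := by ring
        · rw [abs_mul, abs_mul, abs_mul, abs_of_nonneg hC0, abs_of_pos p1, abs_of_pos p2]
          calc _ ≤ 1 * 1 * Y * Y := by gcongr
            _ = _ := by ring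
      calc _ ≤ (q + 1 - p) * 1 * (K₀ * K₁ + K₁ * (2 * Y) + Y * Y) / (ν * ν) := by
            gcongr
            exact (hν0.trans_le g2).le
        _ = K := by rw [mul_one]
  have hp0 : 0 < p := by linarith [h.one_lt]
  set L := p * Real.exp (|K| * Real.pi) / (ν * ν) * (Real.pi / 2) with hL
  have hbound : ∀ a ∈ Ioo (a₀ / 2) (2 * a₀),
      ‖quarterTime p q β b a - quarterTime p q β b a₀‖ ≤ L * |a - a₀| := by
    intro a ha
    have hapos : 0 < a := by linarith [ha.1]
    have hO := isOrbit_orbit h b hapos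
    unfold quarterTime
    rw [← intervalIntegral.integral_sub ((hO.continuous_slowness h).intervalIntegrable _ _)
      ((hO₀.continuous_slowness h).intervalIntegrable _ _)]
    refine (intervalIntegral.norm_integral_le_of_norm_le_const
      (C := p * (|a - a₀| * Real.exp (|K| * Real.pi)) / (ν * ν)) ?_).trans (le_of_eq ?_)
    · intro x hx
      rw [uIoc_of_le (by linarith)] at hx
      have hxI : x ∈ I := ⟨hx.1.le, hx.2⟩
      obtain ⟨g1, g2⟩ := hrange a ha x hxI
      obtain ⟨g3, g4⟩ := hrange a₀ hmem₀ x hxI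
      have g5 := hdist a ha x hxI
      have hC := polC_le_one h x
      have hC0 := polC_nonneg (q := q) x
      have hD := polD_le h x
      have hD0 := polD_pos h x
      set W := orbit p q β b a x with hWx
      set V := orbit p q β b a₀ x with hVx
      have n1 : 0 < polA p β b x + W * polC q x := hν0.trans_le g2
      have n2 : 0 < polA p β b x + V * polC q x := hν0.trans_le g4
      have heq : slowness p q β b (orbit p q β b a) x - slowness p q β b (orbit p q β b a₀) x =
          polD p x * (-(W - V) * polC q x) /
            ((polA p β b x + W * polC q x) * (polA p β b x + V * polC q x)) := by
        unfold slowness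
        rw [← hWx, ← hVx, div_sub_div _ _ n1.ne' n2.ne']
        congr 1
        ring
      rw [heq, Real.norm_eq_abs, abs_div, abs_mul, abs_mul, abs_neg, abs_of_pos hD0,
        abs_of_nonneg hC0, abs_of_pos (mul_pos n1 n2)]
      have h7 : |W - V| * polC q x ≤ |a - a₀| * Real.exp (|K| * Real.pi) :=
        (mul_le_of_le_one_right (abs_nonneg _) hC).trans g5
      gcongr
    · rw [hL, abs_of_pos (by linarith : 0 < 0 - -(Real.pi / 2))]
      ring
  rw [ContinuousAt, tendsto_iff_norm_sub_tendsto_zero]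
  have hlim : Tendsto (fun a => L * |a - a₀|) (𝓝 a₀) (𝓝 0) := by
    have : Continuous fun a => L * |a - a₀| := by fun_prop
    simpa using this.tendsto a₀
  refine squeeze_zero' (Eventually.of_forall fun a => norm_nonneg _) ?_ hlim
  filter_upwards [Ioo_mem_nhds hmem₀.1 hmem₀.2] with a ha using hbound a ha

end quarterTime

/-! ### Limits and range of the quarter period -/

section limits
variable {p q β b : ℝ}

theorem integral_le_of_abs_le {f : ℝ → ℝ} {x y C : ℝ} (hxy : x ≤ y)
    (hf : ∀ t ∈ Ioc x y, |f t| ≤ C) : ∫ t in x..y, f t ≤ C * (y - x) := by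
  have h1 := intervalIntegral.norm_integral_le_of_norm_le_const (a := x) (b := y) (f := f) (C := C)
    (fun t ht => hf t (by rwa [uIoc_of_le hxy] at ht))
  rw [abs_of_nonneg (by linarith)] at h1
  exact (le_abs_self _).trans h1

theorem cos_nonneg_of_mem {θ : ℝ} (hθ : θ ∈ Icc (-(Real.pi / 2)) 0) : 0 ≤ Real.cos θ :=
  Real.cos_nonneg_of_mem_Icc ⟨hθ.1, by linarith [hθ.2, Real.pi_pos]⟩

theorem cos_mono {θ θ' : ℝ} (hθ : -(Real.pi / 2) ≤ θ) (hθθ : θ ≤ θ') (hθ' : θ' ≤ 0) :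
    Real.cos θ ≤ Real.cos θ' := by
  rw [← Real.cos_neg θ, ← Real.cos_neg θ']
  exact Real.cos_le_cos_of_nonneg_of_le_pi (by linarith) (by linarith [Real.pi_pos]) (by linarith)

theorem polC_eq_mul {θ : ℝ} (hθ : 0 < Real.cos θ) :
    polC q θ = Real.cos θ ^ (q + 1 - p) * Real.cos θ ^ p := by
  rw [polC, abs_of_pos hθ, ← Real.rpow_add hθ]
  congr 1; ring

/-- Along the part of an orbit between a zero and the next extremum, `W cos ^ (q + 1 - p)`, a power
of the solution, increases. -/
theorem IsOrbit.mul_rpow_mono (h : Exponents p q β) {W : ℝ → ℝ} (hW : IsOrbit p q β b W)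
    {θ₁ θ₂ : ℝ} (h1 : -(Real.pi / 2) < θ₁) (h12 : θ₁ ≤ θ₂) (h2 : θ₂ ≤ 0) :
    W θ₁ * Real.cos θ₁ ^ (q + 1 - p) ≤ W θ₂ * Real.cos θ₂ ^ (q + 1 - p) := by
  have hr := h.r_pos
  have hcos : ∀ θ ∈ Icc θ₁ θ₂, 0 < Real.cos θ := fun θ hθ =>
    Real.cos_pos_of_mem_Ioo ⟨by linarith [hθ.1], by linarith [hθ.2, Real.pi_pos]⟩
  have hd : ∀ θ ∈ Icc θ₁ θ₂, HasDerivAt (fun θ => W θ * Real.cos θ ^ (q + 1 - p))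
      ((q + 1 - p) * W θ * Real.cos θ ^ (q + 1 - p) / Real.cos θ * -Real.sin θ *
        (β * polD p θ / (polA p β b θ + W θ * polC q θ))) θ := by
    intro θ hθ
    have hc := hcos θ hθ
    have hN := (hW.speed_pos θ).ne'
    have h3 := ((Real.hasDerivAt_cos θ).rpow_const (p := q + 1 - p) (Or.inl hc.ne'))
    refine ((hW.hasDerivAt θ).mul h3).congr_deriv ?_
    have h4 := cos_mul_polM (b := b) h θ (W θ)
    have h5 : polM p β b θ + W θ * polE q θ =
        (polA p β b θ + W θ * polC q θ - β * polD p θ) / Real.cos θ := by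
      rw [← h4]; field_simp
    rw [h5, Real.rpow_sub_one hc.ne']
    generalize polA p β b θ + W θ * polC q θ = N at *
    field_simp
    ring
  refine monotoneOn_of_hasDerivWithinAt_nonneg (convex_Icc θ₁ θ₂)
    (fun θ hθ => (hd θ hθ).continuousAt.continuousWithinAt)
    (fun θ hθ => (hd θ (interior_subset hθ)).hasDerivWithinAt) (fun θ hθ => ?_)
    (left_mem_Icc.mpr h12) (right_mem_Icc.mpr h12) h12
  have hθ' := interior_subset hθ
  have hc := hcos θ hθ'
  have hN := hW.speed_pos θ
  have hs : Real.sin θ ≤ 0 :=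
    Real.sin_nonpos_of_nonpos_of_neg_pi_le (by linarith [hθ'.2])
      (by linarith [hθ'.1, Real.pi_pos])
  have hD := polD_pos h θ
  have := hW.pos θ
  have hβ := h.pos
  have : 0 ≤ -Real.sin θ := by linarith
  positivity

theorem polE_eq_mul {θ : ℝ} (hθ : 0 < Real.cos θ) :
    polE q θ = Real.cos θ ^ (q + 1 - p) * Real.cos θ ^ (p - 1) := by
  rw [polE_eq_rpow hθ, ← Real.rpow_add hθ]
  congr 1; ring

/-- Orbits starting with a large radial variable have a large maximum. -/
theorem exists_orbit_ge (h : Exponents p q β) (b : ℝ) {c₀ θ₁ Z : ℝ}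
    (hA : ∀ θ, |Real.cos θ| ≤ c₀ → (p - 1) * β / 2 ≤ polA p β b θ)
    (h1 : -(Real.pi / 2) < θ₁) (h10 : θ₁ < 0) (hcos : Real.cos θ₁ ≤ c₀) (hZ : 0 < Z) :
    ∃ a > 0, Z ≤ orbit p q β b a θ₁ * Real.cos θ₁ ^ (q + 1 - p) := by
  by_contra hcon
  push Not at hcon
  have hr := h.r_pos
  have hp := h.one_lt
  have hπ := Real.pi_pos
  have hpos : 0 < (p - 1) * β / 2 := by
    have := mul_pos (sub_pos.mpr hp) h.pos
    linarith
  set K := (q + 1 - p) * (|p - 2| * (β + 1) + |b| + Z) / ((p - 1) * β / 2) with hK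
  have hc1 : 0 < Real.cos θ₁ := Real.cos_pos_of_mem_Ioo ⟨h1, by linarith⟩
  -- If the power of the solution stays below Z at θ₁, it does so on all of (-π/2, θ₁) by
  -- monotonicity. Then the logarithmic derivative of W is bounded by K there, and going back to
  -- -π/2 bounds every a > 0, which is absurd.
  have hall : ∀ a > 0, a ≤ Z / Real.cos θ₁ ^ (q + 1 - p) *
      Real.exp (K * (θ₁ - -(Real.pi / 2))) := by
    intro a ha
    have hO := isOrbit_orbit h b ha
    have := abs_le_of_abs_deriv_le_left (K := K) (u := orbit p q β b a) h1.le
      hO.continuous.continuousOn (fun x _ => hO.hasDerivAt x) (fun x hx => ?_)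
    · rw [orbit_at h b ha, abs_of_pos ha, abs_of_pos (hO.pos _)] at this
      refine this.trans ?_
      gcongr
      rw [le_div_iff₀ (by positivity)]
      exact (hcon a ha).le
    · have hcx : 0 < Real.cos x := Real.cos_pos_of_mem_Ioo ⟨hx.1, by linarith [hx.2]⟩
      have hcx1 : Real.cos x ≤ 1 := Real.cos_le_one x
      have hw : orbit p q β b a x * Real.cos x ^ (q + 1 - p) ≤ Z :=
        (hO.mul_rpow_mono h hx.1 hx.2.le h10.le).trans (hcon a ha).le
      have hW := hO.pos x
      have hAx := hA x (by
        rw [abs_of_pos hcx]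
        exact (cos_mono hx.1.le hx.2.le h10.le).trans hcos)
      have hN : (p - 1) * β / 2 ≤ polA p β b x + orbit p q β b a x * polC q x := by
        have := mul_nonneg hW.le (polC_nonneg (q := q) x)
        linarith
      have hM := abs_polM_le (b := b) h x
      have hE : orbit p q β b a x * polE q x ≤ Z := by
        rw [polE_eq_mul (p := p) hcx, ← mul_assoc]
        calc _ ≤ Z * 1 := by
              gcongr
              exact Real.rpow_le_one hcx.le hcx1 (by linarith)
          _ = Z := mul_one Z
      have hE0 : 0 ≤ orbit p q β b a x * polE q x := mul_nonneg hW.le (polE_nonneg hcx.le)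
      have hnum : |polM p β b x + orbit p q β b a x * polE q x| ≤
          |p - 2| * (β + 1) + |b| + Z :=
        (abs_add_le _ _).trans (add_le_add hM (by rwa [abs_of_nonneg hE0]))
      rw [abs_div, abs_mul, abs_mul, abs_mul, abs_of_pos hr, abs_of_pos (hpos.trans_le hN)]
      have hs := Real.abs_sin_le_one x
      have hn0 := (abs_nonneg _).trans hnum
      calc _ ≤ (q + 1 - p) * |orbit p q β b a x| * 1 * (|p - 2| * (β + 1) + |b| + Z) /
            ((p - 1) * β / 2) := by
            gcongr
        _ = _ := by rw [hK]; ring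
  have hX0 : 0 < Z / Real.cos θ₁ ^ (q + 1 - p) * Real.exp (K * (θ₁ - -(Real.pi / 2))) := by
    positivity
  have := hall (Z / Real.cos θ₁ ^ (q + 1 - p) * Real.exp (K * (θ₁ - -(Real.pi / 2))) + 1)
    (by linarith)
  linarith

/-- Near -π/2 the angular speed is bounded below independently of the orbit, so a short angular
interval costs little time. On the remaining interval the power of the solution increases with the
angle, so an orbit that is large at the splitting angle is fast throughout. -/
theorem exists_quarterTime_lt (h : Exponents p q β) (b : ℝ) {τ : ℝ} (hτ : 0 < τ) :
    ∃ a > 0, quarterTime p q β b a < τ := by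
  have hr := h.r_pos
  have hp := h.one_lt
  have hπ := Real.pi_pos
  have hpos : 0 < (p - 1) * β / 2 := by
    have := mul_pos (sub_pos.mpr hp) h.pos
    linarith
  obtain ⟨c₀, hc₀, -, hA⟩ := exists_polA_ge h b
  obtain ⟨θ₁, h1, h10, hcos, hsmall⟩ : ∃ θ₁, -(Real.pi / 2) < θ₁ ∧ θ₁ < 0 ∧ Real.cos θ₁ ≤ c₀ ∧
      p / ((p - 1) * β / 2) * (θ₁ - -(Real.pi / 2)) < τ / 2 := by
    have e1 : ∀ᶠ θ in 𝓝[>] (-(Real.pi / 2)), Real.cos θ < c₀ := by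
      apply Tendsto.eventually_lt_const (v := Real.cos (-(Real.pi / 2))) (by simpa using hc₀)
      exact (Real.continuous_cos.tendsto _).mono_left nhdsWithin_le_nhds
    have e2 : ∀ᶠ θ in 𝓝[>] (-(Real.pi / 2)),
        p / ((p - 1) * β / 2) * (θ - -(Real.pi / 2)) < τ / 2 := by
      have hc : Continuous fun θ => p / ((p - 1) * β / 2) * (θ - -(Real.pi / 2)) := by fun_prop
      apply Tendsto.eventually_lt_const
        (v := p / ((p - 1) * β / 2) * (-(Real.pi / 2) - -(Real.pi / 2)))
        (by rw [sub_self, mul_zero]; linarith)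
      exact (hc.tendsto _).mono_left nhdsWithin_le_nhds
    have e3 : ∀ᶠ θ in 𝓝[>] (-(Real.pi / 2)), θ ∈ Ioo (-(Real.pi / 2)) 0 :=
      Ioo_mem_nhdsGT (by linarith)
    obtain ⟨θ, g1, g2, g3⟩ := (e1.and (e2.and e3)).exists
    exact ⟨θ, g3.1, g3.2, g1.le, g2⟩
  have hc1 : 0 < Real.cos θ₁ := Real.cos_pos_of_mem_Ioo ⟨h1, by linarith⟩
  set K₁ := (p - 1) * β + |p - 2| + |b| with hK₁
  have hK₁0 : 0 ≤ K₁ := (abs_nonneg _).trans (abs_polA_le (b := b) h 0)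
  set Y := p * Real.pi / τ + 1 with hY
  have hY0 : 0 < Y := by positivity
  -- Then W C is at least K₁ + Y beyond θ₁, where K₁ bounds |A|, so the angular numerator is at
  -- least Y.
  set Z := (K₁ + Y) / Real.cos θ₁ ^ p with hZ
  have hZ0 : 0 < Z := by positivity
  obtain ⟨a, ha, haZ⟩ := exists_orbit_ge h b hA h1 h10 hcos hZ0
  refine ⟨a, ha, ?_⟩
  have hO := isOrbit_orbit h b ha
  have hint := fun x y =>
    (hO.continuous_slowness h).intervalIntegrable (μ := MeasureTheory.volume) x y
  rw [quarterTime, ← intervalIntegral.integral_add_adjacent_intervals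
    (hint (-(Real.pi / 2)) θ₁) (hint θ₁ 0)]
  have b1 : ∫ θ in (-(Real.pi / 2))..θ₁, slowness p q β b (orbit p q β b a) θ ≤
      p / ((p - 1) * β / 2) * (θ₁ - -(Real.pi / 2)) := by
    refine integral_le_of_abs_le h1.le fun x hx => ?_
    have hxI : x ∈ Icc (-(Real.pi / 2)) 0 := ⟨hx.1.le, by linarith [hx.2]⟩
    have hAx := hA x (by
      rw [abs_of_nonneg (cos_nonneg_of_mem hxI)]
      exact (cos_mono hx.1.le hx.2 h10.le).trans hcos)
    have hN := mul_nonneg (hO.pos x).le (polC_nonneg (q := q) x)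
    rw [abs_of_pos (hO.slowness_pos h x)]
    have hD := polD_le h x
    have hD0 := polD_pos h x
    unfold slowness
    gcongr
    linarith
  have b2 : ∫ θ in θ₁..0, slowness p q β b (orbit p q β b a) θ ≤ p / Y * (Real.pi / 2) := by
    refine (integral_le_of_abs_le (C := p / Y) h10.le fun x hx => ?_).trans ?_
    · have hcx := cos_mono h1.le hx.1.le hx.2
      have hcx0 := hc1.trans_le hcx
      have hw := haZ.trans (hO.mul_rpow_mono h h1 hx.1.le hx.2)
      have hA' := (abs_le.mp (abs_polA_le (b := b) h x)).1
      have hcp : Real.cos θ₁ ^ p ≤ Real.cos x ^ p :=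
        Real.rpow_le_rpow hc1.le hcx (by linarith)
      have hWC : K₁ + Y ≤ orbit p q β b a x * polC q x := by
        rw [polC_eq_mul (p := p) hcx0, ← mul_assoc]
        calc K₁ + Y = Z * Real.cos θ₁ ^ p := by rw [hZ]; field_simp
          _ ≤ _ := by
            gcongr
            exact hZ0.le.trans hw
      rw [abs_of_pos (hO.slowness_pos h x)]
      have hD := polD_le h x
      have hD0 := polD_pos h x
      unfold slowness
      gcongr
      linarith
    · gcongr
      linarith
  have b3 : p / Y * (Real.pi / 2) < τ / 2 := by
    rw [div_mul_eq_mul_div, div_lt_iff₀ hY0, hY]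
    have : τ / 2 * (p * Real.pi / τ + 1) = p * (Real.pi / 2) + τ / 2 := by field_simp
    rw [this]
    linarith
  linarith

/-- Small orbits are at least as slow as the linearised motion. -/
theorem exists_lt_quarterTime (h : Exponents p q β) {θ₁ L : ℝ} (h1 : -(Real.pi / 2) < θ₁)
    (h10 : θ₁ ≤ 0) (hA : ∀ θ ∈ Icc (-(Real.pi / 2)) θ₁, 0 < polA p β b θ)
    (hL : L < ∫ θ in (-(Real.pi / 2))..θ₁, polD p θ / polA p β b θ) :
    ∃ a > 0, L < quarterTime p q β b a := by
  have hr := h.r_pos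
  have hp := h.one_lt
  have hπ := Real.pi_pos
  have hcA := continuous_polA (b := b) h
  set I := Icc (-(Real.pi / 2)) θ₁ with hI
  obtain ⟨x₁, hx₁m, hx₁⟩ := isCompact_Icc.exists_isMinOn (s := I)
    (nonempty_Icc.mpr h1.le) hcA.continuousOn
  set ν := polA p β b x₁ with hν
  have hν0 : 0 < ν := hA x₁ hx₁m
  have hV := isOrbit_orbit h b one_pos
  obtain ⟨x₂, -, hx₂⟩ := isCompact_Icc.exists_isMaxOn (s := I)
    (nonempty_Icc.mpr h1.le) hV.continuous.continuousOn
  set Y := orbit p q β b 1 x₂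
  have hY0 : 0 < Y := hV.pos x₂
  set K := (q + 1 - p) * (|p - 2| * (β + 1) + |b| + Y) / ν with hK
  have hK0 : 0 ≤ K := by have := h.pos; positivity
  -- The constant K serves all a < 1 at once, because those orbits lie below the orbit with initial
  -- value 1, whose maximum on the interval is Y.
  have hsmall : ∀ a, 0 < a → a < 1 → ∀ θ ∈ I, orbit p q β b a θ ≤ a * Real.exp (K * Real.pi) := by
    intro a ha ha1 θ hθ
    have hO := isOrbit_orbit h b ha
    have := abs_le_of_abs_deriv_le_right (K := K) (u := orbit p q β b a) hθ.1
      hO.continuous.continuousOn (fun x _ => hO.hasDerivAt x) (fun x hx => ?_)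
    · rw [orbit_at h b ha, abs_of_pos ha, abs_of_pos (hO.pos _)] at this
      refine this.trans ?_
      gcongr
      linarith [hθ.2]
    · have hxI : x ∈ I := ⟨hx.1.le, hx.2.le.trans hθ.2⟩
      have hW := hO.pos x
      have hWY : orbit p q β b a x ≤ Y := (orbit_lt_orbit h b ha ha1 x).le.trans (hx₂ hxI)
      have hN : ν ≤ polA p β b x + orbit p q β b a x * polC q x := by
        have g1 : ν ≤ polA p β b x := hx₁ hxI
        have := mul_nonneg hW.le (polC_nonneg (q := q) x)
        linarith
      have hM := abs_polM_le (b := b) h x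
      have hE : |orbit p q β b a x * polE q x| ≤ Y := by
        rw [abs_mul, abs_of_pos hW]
        calc _ ≤ Y * 1 := by
              gcongr
              exact abs_polE_le h x
          _ = Y := mul_one Y
      have hnum : |polM p β b x + orbit p q β b a x * polE q x| ≤
          |p - 2| * (β + 1) + |b| + Y :=
        (abs_add_le _ _).trans (add_le_add hM hE)
      rw [abs_div, abs_mul, abs_mul, abs_mul, abs_of_pos hr, abs_of_pos (hν0.trans_le hN)]
      have hs := Real.abs_sin_le_one x
      have hn0 := (abs_nonneg _).trans hnum
      calc _ ≤ (q + 1 - p) * |orbit p q β b a x| * 1 * (|p - 2| * (β + 1) + |b| + Y) / ν := by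
            gcongr
        _ = _ := by rw [hK]; ring
  set R := p * Real.exp (K * Real.pi) / (ν * ν) * Real.pi with hR
  have hR0 : 0 < R := by positivity
  have hlow : ∀ a, 0 < a → a < 1 →
      (∫ θ in (-(Real.pi / 2))..θ₁, polD p θ / polA p β b θ) - R * a ≤ quarterTime p q β b a := by
    intro a ha ha1
    have hO := isOrbit_orbit h b ha
    have hint := fun x y =>
      (hO.continuous_slowness h).intervalIntegrable (μ := MeasureTheory.volume) x y
    have hintA : IntervalIntegrable (fun θ => polD p θ / polA p β b θ) MeasureTheory.volume
        (-(Real.pi / 2)) θ₁ := by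
      apply ContinuousOn.intervalIntegrable_of_Icc h1.le
      exact continuous_polD.continuousOn.div hcA.continuousOn fun θ hθ => (hA θ hθ).ne'
    rw [quarterTime, ← intervalIntegral.integral_add_adjacent_intervals
      (hint (-(Real.pi / 2)) θ₁) (hint θ₁ 0)]
    have b1 : 0 ≤ ∫ θ in θ₁..0, slowness p q β b (orbit p q β b a) θ :=
      intervalIntegral.integral_nonneg h10 fun x _ => (hO.slowness_pos h x).le
    have b2 : (∫ θ in (-(Real.pi / 2))..θ₁, polD p θ / polA p β b θ) -
        (∫ θ in (-(Real.pi / 2))..θ₁, slowness p q β b (orbit p q β b a) θ) ≤ R * a := by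
      rw [← intervalIntegral.integral_sub hintA (hint _ _)]
      refine (integral_le_of_abs_le (C := p * (a * Real.exp (K * Real.pi)) / (ν * ν)) h1.le
        fun x hx => ?_).trans ?_
      · have hxI : x ∈ I := ⟨hx.1.le, hx.2⟩
        have g1 : ν ≤ polA p β b x := hx₁ hxI
        have hW := hO.pos x
        have hC0 := polC_nonneg (q := q) x
        have hC := polC_le_one h x
        have g2 : ν ≤ polA p β b x + orbit p q β b a x * polC q x := by
          have := mul_nonneg hW.le hC0
          linarith
        have n1 := hν0.trans_le g1
        have n2 := hν0.trans_le g2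
        have heq : polD p x / polA p β b x - slowness p q β b (orbit p q β b a) x =
            polD p x * (orbit p q β b a x * polC q x) /
            (polA p β b x * (polA p β b x + orbit p q β b a x * polC q x)) := by
          unfold slowness
          rw [div_sub_div _ _ n1.ne' n2.ne']
          congr 1
          ring
        have hD := polD_le h x
        have hD0 := polD_pos h x
        have h7 : orbit p q β b a x * polC q x ≤ a * Real.exp (K * Real.pi) :=
          (mul_le_of_le_one_right hW.le hC).trans (hsmall a ha ha1 x hxI)
        rw [heq, abs_of_nonneg (by positivity)]
        gcongr
      · rw [hR]
        calc _ ≤ p * (a * Real.exp (K * Real.pi)) / (ν * ν) * Real.pi := by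
              gcongr
              linarith
          _ = _ := by ring
    linarith
  set J := ∫ θ in (-(Real.pi / 2))..θ₁, polD p θ / polA p β b θ
  refine ⟨min (1 / 2) ((J - L) / (2 * R)), lt_min (by norm_num) (div_pos (by linarith)
    (by linarith)), ?_⟩
  have ha0 : 0 < min (1 / 2) ((J - L) / (2 * R)) :=
    lt_min (by norm_num) (div_pos (by linarith) (by linarith))
  refine lt_of_lt_of_le ?_ (hlow _ ha0 (lt_of_le_of_lt (min_le_left _ _) (by norm_num)))
  have h2 : R * min (1 / 2) ((J - L) / (2 * R)) ≤ R * ((J - L) / (2 * R)) := by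
    gcongr
    exact min_le_right _ _
  have h3 : R * ((J - L) / (2 * R)) = (J - L) / 2 := by field_simp
  linarith

theorem abs_polA_sub_le (h : Exponents p q β) (x y : ℝ) :
    |polA p β b x - polA p β b y| ≤ (2 * |p - 2| + |b| * p) * |x - y| := by
  have hp := h.one_lt
  refine convex_univ.norm_image_sub_le_of_norm_hasDerivWithin_le
    (fun θ _ => (hasDerivAt_polA (b := b) h θ).hasDerivWithinAt) (fun θ _ => ?_)
    (mem_univ y) (mem_univ x)
  have hc := Real.abs_cos_le_one θ
  have hs := Real.abs_sin_le_one θ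
  have h2 : |(|Real.cos θ| ^ (p - 2) * Real.cos θ)| ≤ 1 := by
    rcases eq_or_ne (Real.cos θ) 0 with hx | hx
    · simp [hx]
    · rw [abs_mul, abs_of_nonneg (by positivity : 0 ≤ |Real.cos θ| ^ (p - 2)),
        ← Real.rpow_add_one (abs_ne_zero.mpr hx)]
      exact Real.rpow_le_one (abs_nonneg _) (Real.abs_cos_le_one θ) (by linarith)
  rw [Real.norm_eq_abs]
  calc _ = |(p - 2) * (2 * Real.cos θ * -Real.sin θ)
        - b * (p * (|Real.cos θ| ^ (p - 2) * Real.cos θ) * -Real.sin θ)| := by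
        congr 1; ring
    _ ≤ |p - 2| * (2 * |Real.cos θ| * |Real.sin θ|)
        + |b| * (p * |(|Real.cos θ| ^ (p - 2) * Real.cos θ)| * |Real.sin θ|) := by
        refine (abs_sub _ _).trans (le_of_eq ?_)
        rw [abs_mul, abs_mul, abs_mul, abs_mul b, abs_mul, abs_mul p, abs_neg, abs_two,
          abs_of_pos (by linarith : 0 < p)]
    _ ≤ |p - 2| * (2 * 1 * 1) + |b| * (p * 1 * 1) := by gcongr
    _ = _ := by ring

theorem polA_zero : polA p β b 0 = (p - 1) * β + (p - 2) - b := by simp [polA]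

/-- If `polA` vanishes somewhere, arbitrarily slow orbits exist. -/
theorem exists_lt_quarterTime_of_le (h : Exponents p q β) (hb : (p - 1) * β + (p - 2) ≤ b)
    (L : ℝ) : ∃ a > 0, L < quarterTime p q β b a := by
  have hp := h.one_lt
  have hπ := Real.pi_pos
  have hcA := continuous_polA (b := b) h
  have hpβ : 0 < (p - 1) * β := mul_pos (by linarith) h.pos
  have hδ : 0 < min 1 (p - 1) := lt_min one_pos (by linarith)
  set S := {x | x ∈ Icc (-(Real.pi / 2)) 0 ∧ polA p β b x ≤ 0} with hS
  have hne : S.Nonempty := ⟨0, ⟨by linarith, le_rfl⟩, by rw [polA_zero]; linarith⟩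
  have hcl : IsClosed S := isClosed_Icc.inter (isClosed_le hcA continuous_const)
  have hbd : BddBelow S := ⟨-(Real.pi / 2), fun x hx => hx.1.1⟩
  have hmem := hcl.csInf_mem hne hbd
  set z := sInf S
  have hAl : polA p β b (-(Real.pi / 2)) = (p - 1) * β := polA_of_cos_eq_zero h (by simp)
  have hz : -(Real.pi / 2) < z := by
    rcases hmem.1.1.lt_or_eq with h1 | h1
    · exact h1
    · have := hmem.2
      rw [← h1, hAl] at this
      linarith
  have hpos : ∀ x ∈ Ico (-(Real.pi / 2)) z, 0 < polA p β b x := by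
    intro x hx
    by_contra hx'
    exact absurd (csInf_le hbd ⟨⟨hx.1, hx.2.le.trans hmem.1.2⟩, not_lt.mp hx'⟩) (not_le.mpr hx.2)
  set K := 2 * |p - 2| + |b| * p + 1 with hK
  have hK0 : 0 < K := by positivity
  have hAle : ∀ x ∈ Ico (-(Real.pi / 2)) z, polA p β b x ≤ K * (z - x) := by
    intro x hx
    have h1 := (le_abs_self _).trans (abs_polA_sub_le (b := b) h x z)
    rw [abs_of_neg (by linarith [hx.2] : x - z < 0)] at h1
    have h2 := hmem.2
    have h3 : 0 ≤ z - x := by linarith [hx.2]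
    rw [hK]
    nlinarith
  set D := z - -(Real.pi / 2) with hD
  have hD0 : 0 < D := by linarith
  -- The interval stops at the distance D E before the first zero z of `polA`. Since `polA` is at
  -- most K (z - θ), the integral is at least the logarithmic one, and this E makes the latter
  -- exactly |L| + 1.
  set E := Real.exp (-(|L| + 1) * K / min 1 (p - 1)) with hE
  have hE1 : E < 1 := by
    rw [hE, Real.exp_lt_one_iff]
    apply div_neg_of_neg_of_pos _ hδ
    have : 0 < (|L| + 1) * K := by positivity
    linarith
  have hE0 : 0 < E := Real.exp_pos _
  have hDE : D * E < D := mul_lt_of_lt_one_right hD0 hE1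
  have hDE0 : 0 < D * E := mul_pos hD0 hE0
  set θ₁ := z - D * E with hθ₁
  have h1 : -(Real.pi / 2) < θ₁ := by linarith
  have h1z : θ₁ < z := by linarith
  refine exists_lt_quarterTime h h1 (h1z.le.trans hmem.1.2)
    (fun θ hθ => hpos θ ⟨hθ.1, hθ.2.trans_lt h1z⟩) ?_
  have hcomp : ∫ θ in (-(Real.pi / 2))..θ₁, min 1 (p - 1) / K * (z - θ)⁻¹ =
      min 1 (p - 1) / K * Real.log (D / (D * E)) := by
    rw [intervalIntegral.integral_const_mul, intervalIntegral.integral_comp_sub_left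
      (fun x => x⁻¹) z, integral_inv_of_pos (by linarith) (by linarith)]
    congr 3
    linarith
  have hlog : min 1 (p - 1) / K * Real.log (D / (D * E)) = |L| + 1 := by
    rw [show D / (D * E) = E⁻¹ by field_simp, Real.log_inv, hE, Real.log_exp]
    field_simp
  have hmono : ∫ θ in (-(Real.pi / 2))..θ₁, min 1 (p - 1) / K * (z - θ)⁻¹ ≤
      ∫ θ in (-(Real.pi / 2))..θ₁, polD p θ / polA p β b θ := by
    apply intervalIntegral.integral_mono_on h1.le
    · apply ContinuousOn.intervalIntegrable_of_Icc h1.le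
      apply ContinuousOn.mul continuousOn_const
      apply ContinuousOn.inv₀ (by fun_prop)
      intro x hx
      have := hx.2
      linarith
    · apply ContinuousOn.intervalIntegrable_of_Icc h1.le
      exact continuous_polD.continuousOn.div hcA.continuousOn fun θ hθ =>
        (hpos θ ⟨hθ.1, hθ.2.trans_lt h1z⟩).ne'
    · intro x hx
      have hx' : x ∈ Ico (-(Real.pi / 2)) z := ⟨hx.1, hx.2.trans_lt h1z⟩
      have g1 := hAle x hx'
      have g2 := hpos x hx'
      have g3 := polD_ge p x
      have g4 : 0 < z - x := by linarith [hx'.2]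
      rw [← div_eq_mul_inv, div_div]
      exact div_le_div₀ (polD_pos h x).le g3 g2 g1
  rw [hcomp, hlog] at hmono
  linarith [le_abs_self L]

/-- With x = |cos θ|, the strict bound on b gives A > (p-1)β(1 - x^p) + (p-2)(x² - x^p) when x > 0.
The last product is nonnegative for p ≥ 2 and for p ≤ 2 alike, since x ≤ 1. -/
theorem polA_pos_of_lt (h : Exponents p q β) (hb : b < (p - 1) * β + (p - 2)) (θ : ℝ) :
    0 < polA p β b θ := by
  have hp := h.one_lt
  have hpβ : 0 < (p - 1) * β := mul_pos (by linarith) h.pos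
  rcases eq_or_ne (Real.cos θ) 0 with hc | hc
  · rwa [polA_of_cos_eq_zero h hc]
  · have hx0 : 0 < |Real.cos θ| := abs_pos.mpr hc
    have hx1 := Real.abs_cos_le_one θ
    unfold polA
    rw [← sq_abs (Real.cos θ)]
    generalize |Real.cos θ| = x at *
    have hxp : 0 < x ^ p := by positivity
    have hxp1 : x ^ p ≤ 1 := Real.rpow_le_one hx0.le hx1 (by linarith)
    have h1 : b * x ^ p < ((p - 1) * β + (p - 2)) * x ^ p := by gcongr
    have h2 : (p - 1) * β * x ^ p ≤ (p - 1) * β := mul_le_of_le_one_right hpβ.le hxp1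
    have h3 : (p - 2) * x ^ p ≤ (p - 2) * x ^ 2 := by
      rw [← Real.rpow_two]
      rcases le_total 2 p with h2p | h2p
      · exact mul_le_mul_of_nonneg_left (Real.rpow_le_rpow_of_exponent_ge hx0 hx1 h2p) (by linarith)
      · exact mul_le_mul_of_nonpos_left (Real.rpow_le_rpow_of_exponent_ge hx0 hx1 h2p) (by linarith)
    linarith

theorem quarterTime_lt_of_polA_pos (h : Exponents p q β) (hA : ∀ θ, 0 < polA p β b θ) {a : ℝ}
    (ha : 0 < a) :
    quarterTime p q β b a < ∫ θ in (-(Real.pi / 2))..0, polD p θ / polA p β b θ := by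
  have hπ := Real.pi_pos
  have hO := isOrbit_orbit h b ha
  refine intervalIntegral.integral_lt_integral_of_continuousOn_of_le_of_exists_lt (by linarith)
    (hO.continuous_slowness h).continuousOn
    (continuous_polD.div (continuous_polA h) fun θ => (hA θ).ne').continuousOn
    (fun θ _ => ?_) ⟨0, ⟨by linarith, le_rfl⟩, ?_⟩
  · refine div_le_div_of_nonneg_left (polD_pos h θ).le (hA θ) ?_
    have := mul_nonneg (hO.pos θ).le (polC_nonneg (q := q) θ)
    linarith
  · refine div_lt_div_of_pos_left (polD_pos h 0) (hA 0) ?_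
    have := mul_pos (hO.pos 0) (polC_pos (q := q) (θ := 0) (by simp))
    linarith

theorem exists_quarterTime_eq_of_lt (h : Exponents p q β) {τ a₁ : ℝ} (hτ : 0 < τ) (ha₁ : 0 < a₁)
    (h1 : τ < quarterTime p q β b a₁) : ∃ a > 0, quarterTime p q β b a = τ := by
  obtain ⟨a₂, ha₂, h2⟩ := exists_quarterTime_lt h b hτ
  obtain ⟨a, ha, hval⟩ := isPreconnected_Ioi.intermediate_value (s := Ioi (0 : ℝ)) ha₂ ha₁
    (quarterTime_continuousOn h b) ⟨h2.le, h1.le⟩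
  exact ⟨a, ha, hval⟩

/-- The range of the quarter period in the subcritical case. -/
theorem exists_quarterTime_eq_iff (h : Exponents p q β) (hb : b < (p - 1) * β + (p - 2)) {τ : ℝ}
    (hτ : 0 < τ) : (∃ a > 0, quarterTime p q β b a = τ) ↔
      τ < ∫ θ in (-(Real.pi / 2))..0, polD p θ / polA p β b θ := by
  have hA := polA_pos_of_lt h hb
  constructor
  · rintro ⟨a, ha, rfl⟩
    exact quarterTime_lt_of_polA_pos h hA ha
  · intro hlt
    obtain ⟨a, ha, h1⟩ := exists_lt_quarterTime h (by linarith [Real.pi_pos]) le_rfl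
      (fun θ _ => hA θ) hlt
    exact exists_quarterTime_eq_of_lt h hτ ha h1

/-- In the critical and supercritical cases every positive quarter period occurs. -/
theorem exists_quarterTime_eq (h : Exponents p q β) (hb : (p - 1) * β + (p - 2) ≤ b) {τ : ℝ}
    (hτ : 0 < τ) : ∃ a > 0, quarterTime p q β b a = τ := by
  obtain ⟨a, ha, h1⟩ := exists_lt_quarterTime_of_le h hb τ
  exact exists_quarterTime_eq_of_lt h hτ ha h1

end limits

/-! ### From the polar equations back to the original equation -/

theorem lambdaq_eq {p q : ℝ} (h : Exponents p q (betaq p q)) :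
    lambdaq p q = betaq p q * ((p - 1) * betaq p q + (p - 2)) := by
  have := h.rel
  unfold lambdaq
  congr 1
  linarith

theorem abs_mul_rpow_mul {x y s : ℝ} (hx : 0 < x) :
    |x * y| ^ (s - 1) * (x * y) = x ^ s * (|y| ^ (s - 1) * y) := by
  rw [abs_mul, abs_of_pos hx, Real.mul_rpow hx.le (abs_nonneg y)]
  have : x ^ s = x ^ (s - 1) * x := by rw [← Real.rpow_add_one hx.ne', sub_add_cancel]
  rw [this]
  ring

/-- A curve given in polar coordinates by the polar equations is a solution. -/
theorem isPeriodicSolution_of_polar {p q b : ℝ} (h : Exponents p q (betaq p q))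
    {θ ρ W ω : ℝ → ℝ} (hρ : ∀ t, 0 < ρ t)
    (hW : ∀ t, W t = betaq p q ^ (-q) * ρ t ^ (q + 1 - p))
    (hθ : ∀ t, HasDerivAt θ
      ((polA p (betaq p q) b (θ t) + W t * polC q (θ t)) / polD p (θ t)) t)
    (hρ' : ∀ t, HasDerivAt ρ (ρ t * Real.sin (θ t) *
      (polM p (betaq p q) b (θ t) + W t * polE q (θ t)) / polD p (θ t)) t)
    (hω : ∀ t, ω t = ρ t * Real.cos (θ t) / betaq p q)
    (hper : Function.Periodic ω (2 * Real.pi)) :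
    IsPeriodicSolution p q (b * betaq p q ^ (p - 1)) ω := by
  set β := betaq p q with hβdef
  have hβ := h.pos
  have hp := h.one_lt
  have hωeq : ω = fun t => ρ t * Real.cos (θ t) / β := funext hω
  have hd : ∀ t, HasDerivAt ω (-(ρ t * Real.sin (θ t))) t := by
    intro t
    rw [hωeq]
    refine (((hρ' t).mul (hθ t).cos).div_const β).congr_deriv ?_
    have h1 := cos_mul_polM (b := b) h (θ t) (W t)
    have hD := (polD_pos h (θ t)).ne'
    generalize polM p β b (θ t) + W t * polE q (θ t) = M at *
    generalize polA p β b (θ t) + W t * polC q (θ t) = N at *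
    -- Replacing the angular numerator through `cos_mul_polM` is what makes the derivative of ρ cos
    -- θ/β collapse to -ρ sin θ.
    have hN : N = Real.cos (θ t) * M + β * polD p (θ t) := by linarith
    rw [hN]
    field_simp
    ring
  have hderiv : deriv ω = fun t => -(ρ t * Real.sin (θ t)) := funext fun t => (hd t).deriv
  have hcρ : Continuous ρ := continuous_iff_continuousAt.mpr fun t => (hρ' t).continuousAt
  have hcθ : Continuous θ := continuous_iff_continuousAt.mpr fun t => (hθ t).continuousAt
  have hweight : ∀ t, weight p q ω t = ρ t ^ (p - 2) := by
    intro t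
    have h1 : β ^ 2 * ω t ^ 2 + deriv ω t ^ 2 = ρ t ^ 2 := by
      rw [hω, hderiv]
      have := Real.sin_sq_add_cos_sq (θ t)
      field_simp
      linear_combination ρ t ^ 2 * this
    rw [weight, ← hβdef, h1, ← Real.rpow_two, ← Real.rpow_mul (hρ t).le]
    congr 1; ring
  have hflux : (fun s => weight p q ω s * deriv ω s) =
      fun t => -(ρ t ^ (p - 1) * Real.sin (θ t)) := by
    funext t
    rw [hweight, hderiv]
    have : ρ t ^ (p - 1) = ρ t ^ (p - 2) * ρ t := by
      rw [← Real.rpow_add_one (hρ t).ne']; congr 1; ring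
    simp only [this]
    ring
  have hfd : ∀ t, HasDerivAt (fun s => weight p q ω s * deriv ω s)
      (-(((p - 1) * (ρ t ^ (p - 1) * Real.sin (θ t) *
      (polM p β b (θ t) + W t * polE q (θ t)) / polD p (θ t))) * Real.sin (θ t)
      + ρ t ^ (p - 1) * (Real.cos (θ t) *
        ((polA p β b (θ t) + W t * polC q (θ t)) / polD p (θ t))))) t := by
    intro t
    rw [hflux]
    have h1 := (hρ' t).rpow_const (p := p - 1) (Or.inl (hρ t).ne')
    refine ((h1.mul (hθ t).sin).neg).congr_deriv ?_
    rw [Real.rpow_sub_one (hρ t).ne' (p - 1)]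
    have := (hρ t).ne'
    field_simp
  refine ⟨hper, ?_, fun t => (hfd t).differentiableAt, fun t => ?_⟩
  · rw [contDiff_one_iff_deriv]
    refine ⟨fun t => (hd t).differentiableAt, ?_⟩
    rw [hderiv]
    fun_prop
  · rw [(hfd t).deriv, hweight, lambdaq_eq h, ← hβdef]
    have hρt := hρ t
    have hx : ω t = ρ t / β * Real.cos (θ t) := by rw [hω]; ring
    have hρβ : 0 < ρ t / β := div_pos hρt hβ
    have e1 : |ω t| ^ (q - 1) * ω t = ρ t ^ (p - 1) * (W t * polE q (θ t)) := by
      rw [hx, abs_mul_rpow_mul hρβ, hW, polE, Real.div_rpow hρt.le hβ.le,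
        Real.rpow_neg hβ.le, show q = p - 1 + (q + 1 - p) by ring, Real.rpow_add hρt]
      rw [show p - 1 + (q + 1 - p) = q by ring]
      ring
    have e2 : b * β ^ (p - 1) * |ω t| ^ (p - 2) * ω t =
        ρ t ^ (p - 1) * ((p - 2) * (β + 1) * Real.cos (θ t) - polM p β b (θ t)) := by
      have : |ω t| ^ (p - 2) * ω t = (ρ t / β) ^ (p - 1) *
          (|Real.cos (θ t)| ^ (p - 2) * Real.cos (θ t)) := by
        rw [hx, show p - 2 = p - 1 - 1 by ring, abs_mul_rpow_mul hρβ]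
      rw [mul_assoc, this, polM, Real.div_rpow hρt.le hβ.le]
      have hβp : β ^ (p - 1) ≠ 0 := (Real.rpow_pos_of_pos hβ _).ne'
      field_simp
      ring
    have e3 : ρ t ^ (p - 2) * ω t = ρ t ^ (p - 1) * Real.cos (θ t) / β := by
      have : ρ t ^ (p - 1) = ρ t ^ (p - 2) * ρ t := by
        rw [← Real.rpow_add_one hρt.ne']; congr 1; ring
      rw [hω, this]; ring
    rw [e1, e2, mul_assoc (β * ((p - 1) * β + (p - 2))), e3]
    have h1 := cos_mul_polM (b := b) h (θ t) (W t)
    have hD := (polD_pos h (θ t)).ne'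
    have hDdef : polD p (θ t) = Real.cos (θ t) ^ 2 + (p - 1) * Real.sin (θ t) ^ 2 := rfl
    generalize hM0 : polM p β b (θ t) = M₀ at *
    generalize hE0 : W t * polE q (θ t) = E₀ at *
    generalize hN0 : polA p β b (θ t) + W t * polC q (θ t) = N at *
    have hN : N = Real.cos (θ t) * (M₀ + E₀) + β * polD p (θ t) := by linarith
    rw [hN]
    generalize ρ t ^ (p - 1) = P
    field_simp
    rw [hDdef]
    ring

/-! ### Time along an orbit and the resulting periodic solutions -/

/-- Inverse of an increasing diffeomorphism of the line. -/
theorem hasDerivAt_invFun {f f' : ℝ → ℝ} (hf : ∀ x, HasDerivAt f (f' x) x) (hpos : ∀ x, 0 < f' x)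
    (hsurj : Function.Surjective f) :
    (∀ x, Function.invFun f (f x) = x) ∧ (∀ y, f (Function.invFun f y) = y) ∧
      ∀ y, HasDerivAt (Function.invFun f) (f' (Function.invFun f y))⁻¹ y := by
  have hmono : StrictMono f := strictMono_of_hasDerivAt_pos hf hpos
  have hl := Function.leftInverse_invFun hmono.injective
  have hr := Function.rightInverse_invFun hsurj
  refine ⟨hl, hr, fun y => ?_⟩
  have hc : Continuous (Function.invFun f) := by
    have := (hmono.orderIsoOfSurjective f hsurj).symm.continuous
    convert this using 1
    funext y
    apply hmono.injective
    rw [hr y]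
    exact ((hmono.orderIsoOfSurjective f hsurj).apply_symm_apply y).symm
  exact HasDerivAt.of_local_left_inverse hc.continuousAt (hf _) (hpos _).ne'
    (Eventually.of_forall hr)

section timeMap
variable {p q β b a : ℝ}

/-- The time at which an orbit reaches the angle `θ`, starting from the angle `0`. -/
def orbitTime (p q β b a θ : ℝ) : ℝ := ∫ x in (0 : ℝ)..θ, slowness p q β b (orbit p q β b a) x

theorem hasDerivAt_orbitTime (h : Exponents p q β) (b : ℝ) (ha : 0 < a) (θ : ℝ) :
    HasDerivAt (orbitTime p q β b a) (slowness p q β b (orbit p q β b a) θ) θ := by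
  have hc := (isOrbit_orbit h b ha).continuous_slowness h
  exact intervalIntegral.integral_hasDerivAt_right (hc.intervalIntegrable _ _)
    (hc.stronglyMeasurableAtFilter _ _) hc.continuousAt

theorem slowness_neg (h : Exponents p q β) (b : ℝ) (ha : 0 < a) (θ : ℝ) :
    slowness p q β b (orbit p q β b a) (-θ) = slowness p q β b (orbit p q β b a) θ := by
  simp only [slowness, polD_neg, polA_neg, polC_neg, (isOrbit_orbit h b ha).even h]

theorem slowness_add_pi (h : Exponents p q β) (b : ℝ) (ha : 0 < a) (θ : ℝ) :
    slowness p q β b (orbit p q β b a) (θ + Real.pi) =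
      slowness p q β b (orbit p q β b a) θ := by
  simp only [slowness, polD_add_pi, polA_add_pi, polC_add_pi, (isOrbit_orbit h b ha).periodic h]

theorem orbitTime_zero : orbitTime p q β b a 0 = 0 := by simp [orbitTime]

theorem orbitTime_pi_div_two (h : Exponents p q β) (b : ℝ) (ha : 0 < a) :
    orbitTime p q β b a (Real.pi / 2) = quarterTime p q β b a := by
  unfold orbitTime quarterTime
  have := intervalIntegral.integral_comp_neg (a := 0) (b := Real.pi / 2)
    (slowness p q β b (orbit p q β b a))
  rw [neg_zero] at this
  rw [← this]
  simp only [slowness_neg h b ha]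

theorem orbitTime_add_pi (h : Exponents p q β) (b : ℝ) (ha : 0 < a) (θ : ℝ) :
    orbitTime p q β b a (θ + Real.pi) = orbitTime p q β b a θ + 2 * quarterTime p q β b a := by
  have hc := (isOrbit_orbit h b ha).continuous_slowness h
  have hint := fun x y => hc.intervalIntegrable (μ := MeasureTheory.volume) x y
  have hper : Function.Periodic (slowness p q β b (orbit p q β b a)) Real.pi :=
    slowness_add_pi h b ha
  have h1 := hper.intervalIntegral_add_eq θ (-(Real.pi / 2))
  have h2 := intervalIntegral.integral_add_adjacent_intervals (hint 0 θ) (hint θ (θ + Real.pi))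
  have h3 := intervalIntegral.integral_add_adjacent_intervals (hint (-(Real.pi / 2)) 0)
    (hint 0 (Real.pi / 2))
  have h4 := orbitTime_pi_div_two h b ha
  rw [show -(Real.pi / 2) + Real.pi = Real.pi / 2 by ring] at h1
  unfold orbitTime at h4 ⊢
  rw [← h2, h1, ← h3, h4]
  unfold quarterTime
  ring

theorem orbitTime_add_int_mul_pi (h : Exponents p q β) (b : ℝ) (ha : 0 < a) (n : ℤ) (θ : ℝ) :
    orbitTime p q β b a (θ + n * Real.pi) =
      orbitTime p q β b a θ + n * (2 * quarterTime p q β b a) := by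
  -- Subtracting the linear drift turns the quasi-periodicity of the time into genuine periodicity,
  -- so that integer multiples are immediate.
  have hper : Function.Periodic
      (fun θ => orbitTime p q β b a θ - 2 * quarterTime p q β b a / Real.pi * θ) Real.pi := by
    intro θ
    simp only [orbitTime_add_pi h b ha]
    have := Real.pi_ne_zero
    field_simp
    ring
  have h1 := hper.int_mul n θ
  have := Real.pi_ne_zero
  have e : 2 * quarterTime p q β b a / Real.pi * (θ + n * Real.pi) =
      2 * quarterTime p q β b a / Real.pi * θ + n * (2 * quarterTime p q β b a) := by
    field_simp
  rw [e] at h1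
  linarith

theorem orbitTime_surjective (h : Exponents p q β) (b : ℝ) (ha : 0 < a) :
    Function.Surjective (orbitTime p q β b a) := by
  intro y
  have hc : Continuous (orbitTime p q β b a) :=
    continuous_iff_continuousAt.mpr fun θ => (hasDerivAt_orbitTime h b ha θ).continuousAt
  have hT := quarterTime_pos h b ha
  obtain ⟨n, hn⟩ := exists_nat_gt (|y| / (2 * quarterTime p q β b a))
  rw [div_lt_iff₀ (by linarith)] at hn
  have hy := abs_lt.mp hn
  refine mem_range_of_exists_le_of_exists_ge hc ⟨0 + ((-n : ℤ) : ℝ) * Real.pi, ?_⟩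
    ⟨0 + ((n : ℤ) : ℝ) * Real.pi, ?_⟩
  · rw [orbitTime_add_int_mul_pi h b ha, orbitTime_zero]
    push_cast
    linarith [hy.1]
  · rw [orbitTime_add_int_mul_pi h b ha, orbitTime_zero]
    push_cast
    linarith [hy.2]

/-- The polar angle along an orbit as a function of time. -/
def orbitAngle (p q β b a : ℝ) : ℝ → ℝ := Function.invFun (orbitTime p q β b a)

theorem orbitAngle_orbitTime (h : Exponents p q β) (b : ℝ) (ha : 0 < a) (θ : ℝ) :
    orbitAngle p q β b a (orbitTime p q β b a θ) = θ :=
  (hasDerivAt_invFun (hasDerivAt_orbitTime h b ha) ((isOrbit_orbit h b ha).slowness_pos h)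
    (orbitTime_surjective h b ha)).1 θ

theorem orbitTime_orbitAngle (h : Exponents p q β) (b : ℝ) (ha : 0 < a) (t : ℝ) :
    orbitTime p q β b a (orbitAngle p q β b a t) = t :=
  (hasDerivAt_invFun (hasDerivAt_orbitTime h b ha) ((isOrbit_orbit h b ha).slowness_pos h)
    (orbitTime_surjective h b ha)).2.1 t

theorem hasDerivAt_orbitAngle (h : Exponents p q β) (b : ℝ) (ha : 0 < a) (t : ℝ) :
    HasDerivAt (orbitAngle p q β b a) ((polA p β b (orbitAngle p q β b a t) +
      orbit p q β b a (orbitAngle p q β b a t) * polC q (orbitAngle p q β b a t)) /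
        polD p (orbitAngle p q β b a t)) t := by
  have := (hasDerivAt_invFun (hasDerivAt_orbitTime h b ha) ((isOrbit_orbit h b ha).slowness_pos h)
    (orbitTime_surjective h b ha)).2.2 t
  rwa [slowness, inv_div] at this

theorem orbitAngle_add (h : Exponents p q β) (b : ℝ) (ha : 0 < a) (t : ℝ) :
    orbitAngle p q β b a (t + 2 * quarterTime p q β b a) =
      orbitAngle p q β b a t + Real.pi := by
  have h1 := orbitTime_add_pi h b ha (orbitAngle p q β b a t)
  rw [orbitTime_orbitAngle h b ha] at h1
  rw [← h1, orbitAngle_orbitTime h b ha]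

/-- The polar radius as a function of the radial variable. -/
def polRadius (p q β W : ℝ) : ℝ := (W * β ^ q) ^ (1 / (q + 1 - p))

/-- The sign changing solution that follows a given orbit. -/
def polSolution (p q β b a t : ℝ) : ℝ :=
  polRadius p q β (orbit p q β b a (orbitAngle p q β b a t)) *
    Real.cos (orbitAngle p q β b a t) / β

theorem polRadius_pos (h : Exponents p q β) {W : ℝ} (hW : 0 < W) : 0 < polRadius p q β W := by
  have := h.pos
  unfold polRadius
  positivity

theorem polRadius_rpow (h : Exponents p q β) {W : ℝ} (hW : 0 < W) :
    β ^ (-q) * polRadius p q β W ^ (q + 1 - p) = W := by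
  have hβ := h.pos
  have hr := h.r_pos
  have hβq : 0 < β ^ q := by positivity
  rw [polRadius, ← Real.rpow_mul (by positivity), one_div_mul_cancel hr.ne', Real.rpow_one,
    Real.rpow_neg hβ.le]
  field_simp

theorem polRadius_of_rpow (h : Exponents p q β) {ρ : ℝ} (hρ : 0 < ρ) :
    polRadius p q β (β ^ (-q) * ρ ^ (q + 1 - p)) = ρ := by
  have hβ := h.pos
  have hr := h.r_pos
  have hβq : 0 < β ^ q := by positivity
  rw [polRadius, Real.rpow_neg hβ.le,
    show (β ^ q)⁻¹ * ρ ^ (q + 1 - p) * β ^ q = ρ ^ (q + 1 - p) by field_simp,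
    ← Real.rpow_mul hρ.le, mul_one_div_cancel hr.ne', Real.rpow_one]

theorem polSolution_add (h : Exponents p q β) (b : ℝ) (ha : 0 < a) (t : ℝ) :
    polSolution p q β b a (t + 2 * quarterTime p q β b a) = -polSolution p q β b a t := by
  unfold polSolution
  rw [orbitAngle_add h b ha, (isOrbit_orbit h b ha).periodic h, Real.cos_add_pi]
  ring

theorem polSolution_zero_pos (h : Exponents p q β) (b : ℝ) (ha : 0 < a) :
    0 < polSolution p q β b a 0 := by
  have h0 : orbitAngle p q β b a 0 = 0 := by
    have := orbitAngle_orbitTime h b ha 0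
    rwa [orbitTime_zero] at this
  unfold polSolution
  rw [h0, Real.cos_zero, mul_one]
  exact div_pos (polRadius_pos h ((isOrbit_orbit h b ha).pos _)) h.pos

theorem polSolution_periodic (h : Exponents p q β) (b : ℝ) (ha : 0 < a) :
    Function.Periodic (polSolution p q β b a) (4 * quarterTime p q β b a) := by
  intro t
  rw [show t + 4 * quarterTime p q β b a =
    t + 2 * quarterTime p q β b a + 2 * quarterTime p q β b a by ring,
    polSolution_add h b ha, polSolution_add h b ha, neg_neg]

theorem polSolution_eq_zero (h : Exponents p q β) (b : ℝ) (ha : 0 < a) {t : ℝ}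
    (ht : polSolution p q β b a t = 0) :
    ∃ n : ℤ, t = quarterTime p q β b a + n * (2 * quarterTime p q β b a) := by
  have hR := polRadius_pos h ((isOrbit_orbit h b ha).pos (orbitAngle p q β b a t))
  have hcos : Real.cos (orbitAngle p q β b a t) = 0 := by
    rw [polSolution, div_eq_zero_iff, mul_eq_zero] at ht
    rcases ht with (h1 | h1) | h1
    · exact absurd h1 hR.ne'
    · exact h1
    · exact absurd h1 h.pos.ne'
  obtain ⟨n, hn⟩ := Real.cos_eq_zero_iff.mp hcos
  refine ⟨n, ?_⟩
  rw [← orbitTime_orbitAngle h b ha t, hn,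
    show (2 * (n : ℝ) + 1) * Real.pi / 2 = Real.pi / 2 + n * Real.pi by ring,
    orbitTime_add_int_mul_pi h b ha, orbitTime_pi_div_two h b ha]

theorem polSolution_neg_quarterTime (h : Exponents p q β) (b : ℝ) (ha : 0 < a) :
    polSolution p q β b a (-quarterTime p q β b a) = 0 := by
  have h1 := orbitTime_add_int_mul_pi h b ha (-1) (Real.pi / 2)
  rw [orbitTime_pi_div_two h b ha] at h1
  push_cast at h1
  have h2 : orbitTime p q β b a (-(Real.pi / 2)) = -quarterTime p q β b a := by
    rw [show -(Real.pi / 2) = Real.pi / 2 + -1 * Real.pi by ring, h1]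
    ring
  rw [← h2, polSolution, orbitAngle_orbitTime h b ha]
  simp

/-- Zeros occur exactly at the odd multiples of the quarter period T, and a period carries the zero
at -T to another zero. So it is a multiple of 2T, and 2T itself is excluded because it reverses the
sign. -/
theorem hasLeastPeriod_polSolution (h : Exponents p q β) (b : ℝ) (ha : 0 < a) :
    HasLeastPeriod (polSolution p q β b a) (4 * quarterTime p q β b a) := by
  have hT := quarterTime_pos h b ha
  refine ⟨⟨by linarith, polSolution_periodic h b ha⟩, fun S hS => ?_⟩
  have h0 := hS.2 (-quarterTime p q β b a)
  rw [polSolution_neg_quarterTime h b ha] at h0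
  obtain ⟨n, hn⟩ := polSolution_eq_zero h b ha h0
  have hSn : S = (n + 1) * (2 * quarterTime p q β b a) := by linarith
  have hn1 : -1 < n := by
    by_contra hcon
    have : (n : ℝ) ≤ -1 := by exact_mod_cast not_lt.mp hcon
    have := hS.1
    nlinarith
  have hn0 : n ≠ 0 := by
    rintro rfl
    have h1 := hS.2 0
    have h2 := polSolution_add h b ha 0
    have h3 := polSolution_zero_pos h b ha
    rw [hSn] at h1
    push_cast at h1
    rw [show (0 : ℝ) + (0 + 1) * (2 * quarterTime p q β b a) =
      0 + 2 * quarterTime p q β b a by ring,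
      h2] at h1
    linarith
  have hn2 : (1 : ℝ) ≤ n := by
    have : 1 ≤ n := by omega
    exact_mod_cast this
  rw [hSn]
  nlinarith

end timeMap

/-- Composing the graph W(θ) with the angle as a function of time multiplies its derivative by the
angular speed. The denominator A + W C cancels, and the radial polar equation in time remains. -/
theorem isPeriodicSolution_polSolution {p q b a : ℝ} (h : Exponents p q (betaq p q)) (ha : 0 < a)
    (hper : Function.Periodic (polSolution p q (betaq p q) b a) (2 * Real.pi)) :
    IsPeriodicSolution p q (b * betaq p q ^ (p - 1)) (polSolution p q (betaq p q) b a) := by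
  set β := betaq p q with hβdef
  have hβ := h.pos
  have hr := h.r_pos
  have hO := isOrbit_orbit h b ha
  set Θ := orbitAngle p q β b a with hΘ
  set W := fun t => orbit p q β b a (Θ t) with hWdef
  have hWpos : ∀ t, 0 < W t := fun t => hO.pos _
  have hWd : ∀ t, HasDerivAt W ((q + 1 - p) * W t * Real.sin (Θ t) *
      (polM p β b (Θ t) + W t * polE q (Θ t)) / polD p (Θ t)) t := by
    intro t
    refine ((hO.hasDerivAt (Θ t)).comp t (hasDerivAt_orbitAngle h b ha t)).congr_deriv ?_
    have h1 := (hO.speed_pos (Θ t)).ne'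
    have h2 := (polD_pos h (Θ t)).ne'
    simp only [hWdef]
    rw [← hΘ]
    generalize polA p β b (Θ t) + orbit p q β b a (Θ t) * polC q (Θ t) = N at *
    field_simp
  refine isPeriodicSolution_of_polar h (θ := Θ) (ρ := fun t => polRadius p q β (W t)) (W := W)
    (fun t => polRadius_pos h (hWpos t)) (fun t => (polRadius_rpow h (hWpos t)).symm)
    (hasDerivAt_orbitAngle h b ha) (fun t => ?_) (fun t => rfl) hper
  have hβq : 0 < β ^ q := by positivity
  have hWβ : 0 < W t * β ^ q := mul_pos (hWpos t) hβq
  have := ((hWd t).mul_const (β ^ q)).rpow_const (p := 1 / (q + 1 - p)) (Or.inl hWβ.ne')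
  refine this.congr_deriv ?_
  rw [Real.rpow_sub_one hWβ.ne']
  unfold polRadius
  have h1 := (hWpos t).ne'
  have h2 := (polD_pos h (Θ t)).ne'
  have h3 := hr.ne'
  have h4 := hβq.ne'
  generalize (W t * β ^ q) ^ (1 / (q + 1 - p)) = R
  generalize polM p β b (Θ t) + W t * polE q (Θ t) = M
  generalize β ^ q = B at *
  generalize q + 1 - p = r at *
  field_simp

/-! ### Second derivative of a solution away from the phase origin -/

/-- Differentiability of the second component of a curve in the plane, from that of the first one
and that of a function along the curve. -/
theorem hasDerivAt_snd_of_comp {F : ℝ × ℝ → ℝ} {L : ℝ × ℝ →L[ℝ] ℝ} {x y : ℝ → ℝ} {x' g' t : ℝ}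
    (hF : HasFDerivAt F L (x t, y t)) (hL : L (0, 1) ≠ 0) (hx : HasDerivAt x x' t)
    (hy : ContinuousAt y t) (hg : HasDerivAt (fun s => F (x s, y s)) g' t) :
    HasDerivAt y ((g' - L (1, 0) * x') / L (0, 1)) t := by
  have hLsplit : ∀ u v : ℝ, L (u, v) = L (1, 0) * u + L (0, 1) * v := by
    intro u v
    have : ((u, v) : ℝ × ℝ) = u • ((1 : ℝ), (0 : ℝ)) + v • ((0 : ℝ), (1 : ℝ)) := by simp
    rw [this, map_add, map_smul, map_smul]
    simp only [smul_eq_mul]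
    ring
  have hcurve : Tendsto (fun s => (x s, y s)) (𝓝 t) (𝓝 (x t, y t)) :=
    hx.continuousAt.prodMk hy
  have hR := (hasFDerivAt_iff_isLittleO.mp hF).comp_tendsto hcurve
  set V : ℝ → ℝ × ℝ := fun s => (x s - x t, y s - y t) with hV
  set R : ℝ → ℝ := fun s => F (x s, y s) - F (x t, y t) - L (V s) with hRdef
  have hRV : R =o[𝓝 t] V := by
    refine hR.congr (fun s => ?_) (fun s => ?_)
    · simp [hRdef, hV, Function.comp]
    · simp [hV, Function.comp]
  have hxO : (fun s => x s - x t) =O[𝓝 t] fun s => s - t := hx.isBigO_sub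
  have hgO : (fun s => F (x s, y s) - F (x t, y t)) =O[𝓝 t] fun s => s - t := hg.isBigO_sub
  have hVO : V =O[𝓝 t] fun s => s - t := by
    -- Adding this vector to V leaves increments of x and F only, which are O(s - t). As it is
    -- itself o(V), absorbing it shows that V is O(s - t), although y is so far only continuous.
    have h1 : (fun s => ((0 : ℝ), R s / L (0, 1))) =o[𝓝 t] V := by
      refine Asymptotics.IsLittleO.prod_left (Asymptotics.isLittleO_zero _ _) ?_
      simpa only [div_eq_inv_mul] using hRV.const_mul_left (L (0, 1))⁻¹
    refine h1.right_isBigO_add.trans ?_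
    have h2 : (fun s => ((x s - x t),
        (F (x s, y s) - F (x t, y t) - L (1, 0) * (x s - x t)) / L (0, 1))) =O[𝓝 t]
        fun s => s - t := by
      refine hxO.prod_left ?_
      simpa only [div_eq_inv_mul] using
        (hgO.sub (hxO.const_mul_left (L (1, 0)))).const_mul_left (L (0, 1))⁻¹
    refine h2.congr_left fun s => ?_
    ext
    · simp [hV]
    · simp only [hV, hRdef, Prod.snd_add, hLsplit (x s - x t)]
      field_simp
      ring
  rw [hasDerivAt_iff_isLittleO] at hx hg ⊢
  have h3 := ((hg.sub (hx.const_mul_left (L (1, 0)))).sub (hRV.trans_isBigO hVO)).const_mul_left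
    (L (0, 1))⁻¹
  refine h3.congr_left fun s => ?_
  simp only [hRdef, hV, hLsplit (x s - x t), smul_eq_mul]
  field_simp
  ring

/-- The second derivative of a solution in terms of the solution and its derivative. -/
def accel (p q c x y : ℝ) : ℝ :=
  (-((p - 2) * betaq p q ^ 2 * x * y ^ 2) - (betaq p q ^ 2 * x ^ 2 + y ^ 2) * (lambdaq p q * x +
    (betaq p q ^ 2 * x ^ 2 + y ^ 2) ^ ((2 - p) / 2) *
      (|x| ^ (q - 1) * x - c * (|x| ^ (p - 2) * x)))) /
    (betaq p q ^ 2 * x ^ 2 + (p - 1) * y ^ 2)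

section solution
variable {p q c : ℝ} {ω : ℝ → ℝ}

theorem IsPeriodicSolution.hasDerivAt (hω : IsPeriodicSolution p q c ω) (t : ℝ) :
    HasDerivAt ω (deriv ω t) t :=
  (hω.contDiff.differentiable one_ne_zero t).hasDerivAt

theorem IsPeriodicSolution.continuous (hω : IsPeriodicSolution p q c ω) : Continuous ω :=
  hω.contDiff.continuous

theorem IsPeriodicSolution.continuous_deriv (hω : IsPeriodicSolution p q c ω) :
    Continuous (deriv ω) :=
  hω.contDiff.continuous_deriv le_rfl

theorem sq_weight_pos (hp : 1 < p) {B x y : ℝ} (hg : 0 < B * x ^ 2 + y ^ 2) (hB : 0 ≤ B) :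
    0 < B * x ^ 2 + (p - 1) * y ^ 2 := by
  have h1 : 0 ≤ B * x ^ 2 := by positivity
  rcases (sq_nonneg y).eq_or_lt with h2 | h2
  · rw [← h2] at hg ⊢
    linarith
  · have : 0 < (p - 1) * y ^ 2 := mul_pos (by linarith) h2
    linarith

/-- A solution is only assumed to have a differentiable flux. Away from the origin the flux is a
differentiable function of (ω, ω') with positive derivative in the second variable, so
differentiability passes from the flux to ω'. -/
theorem IsPeriodicSolution.hasDerivAt_deriv (h : Exponents p q (betaq p q))
    (hω : IsPeriodicSolution p q c ω) {t : ℝ}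
    (hg : 0 < betaq p q ^ 2 * ω t ^ 2 + deriv ω t ^ 2) :
    HasDerivAt (deriv ω) (accel p q c (ω t) (deriv ω t)) t := by
  have hp := h.one_lt
  set β := betaq p q with hβ
  set x := ω t with hx
  set y := deriv ω t with hy
  set e := (p - 2) / 2 with he
  have hin : HasFDerivAt (fun z : ℝ × ℝ => β ^ 2 * z.1 ^ 2 + z.2 ^ 2)
      ((β ^ 2 * (2 * x)) • ContinuousLinearMap.fst ℝ ℝ ℝ +
        (2 * y) • ContinuousLinearMap.snd ℝ ℝ ℝ) (x, y) := by
    refine HasFDerivAt.congr_fderiv (((hasFDerivAt_fst (p := (x, y))).pow 2).const_mul (β ^ 2)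
      |>.add ((hasFDerivAt_snd (p := (x, y))).pow 2)) ?_
    ext <;> simp
  have hF := (hin.rpow_const (p := e) (Or.inl hg.ne')).mul (hasFDerivAt_snd (p := (x, y)))
  have hflux := (hω.differentiable_flux t).hasDerivAt
  set G := β ^ 2 * x ^ 2 + y ^ 2 with hGdef
  have hd := hω.equation t
  set g' := deriv (fun s => weight p q ω s * deriv ω s) t with hg'
  have hw : weight p q ω t = G ^ e := rfl
  rw [hw, ← hx] at hd
  have hGe : 0 < G ^ e := Real.rpow_pos_of_pos hg _
  have hs := sq_weight_pos hp hg (sq_nonneg β)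
  have hGe1 : G ^ (e - 1) = G ^ e / G := Real.rpow_sub_one hg.ne' _
  have hinv : G ^ ((2 - p) / 2) = (G ^ e)⁻¹ := by
    rw [← Real.rpow_neg hg.le]; congr 1; rw [he]; ring
  have e1 : G ^ e + y * (e * (G ^ e / G) * (2 * y)) =
      G ^ e / G * (β ^ 2 * x ^ 2 + (p - 1) * y ^ 2) := by
    rw [show β ^ 2 * x ^ 2 + (p - 1) * y ^ 2 = G + 2 * e * y ^ 2 by rw [he, hGdef]; ring]
    have := hg.ne'
    field_simp
  have key := hasDerivAt_snd_of_comp (x := ω) (y := deriv ω) (t := t) hF (by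
    simp only [hGe1]
    simp
    rw [e1]
    exact (mul_pos (div_pos hGe hg) hs).ne') (hω.hasDerivAt t) hω.continuous_deriv.continuousAt
      hflux
  refine key.congr_deriv ?_
  simp only [hGe1]
  simp
  have e2 : g' = -(lambdaq p q * G ^ e * x + (|x| ^ (q - 1) * x - c * |x| ^ (p - 2) * x)) := by
    linarith
  rw [e1, e2, accel, hinv, ← hβ, ← hGdef, ← hy]
  have h1 := hGe.ne'
  have h2 := hg.ne'
  have h3 := hs.ne'
  rw [div_eq_div_iff (mul_pos (div_pos hGe hg) hs).ne' h3, he]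
  generalize G ^ ((p - 2) / 2) = E at *
  generalize β ^ 2 * x ^ 2 + (p - 1) * y ^ 2 = D at *
  field_simp
  ring

theorem continuous_accel (h : Exponents p q (betaq p q)) (c : ℝ) {x y : ℝ → ℝ} (hx : Continuous x)
    (hy : Continuous y) (hg : ∀ t, 0 < betaq p q ^ 2 * x t ^ 2 + y t ^ 2) :
    Continuous fun t => accel p q c (x t) (y t) := by
  have hp := h.one_lt
  have h1 : Continuous fun t => |x t| ^ (q - 1) * x t := (continuous_abs_rpow_mul h.q_pos).comp hx
  have h2 : Continuous fun t => |x t| ^ (p - 2) * x t := by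
    have := (continuous_abs_rpow_mul (s := p - 1) (by linarith)).comp hx
    rwa [show p - 1 - 1 = p - 2 by ring] at this
  have h3 : Continuous fun t => (betaq p q ^ 2 * x t ^ 2 + y t ^ 2) ^ ((2 - p) / 2) :=
    Continuous.rpow_const (by fun_prop) fun t => Or.inl (hg t).ne'
  unfold accel
  exact Continuous.div (by fun_prop) (by fun_prop)
    fun t => (sq_weight_pos hp (hg t) (sq_nonneg _)).ne'

/-- The second derivative in polar coordinates. -/
theorem accel_polar {b : ℝ} (h : Exponents p q (betaq p q)) {ρ : ℝ} (hρ : 0 < ρ) (θ : ℝ) :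
    accel p q (b * betaq p q ^ (p - 1)) (ρ * Real.cos θ / betaq p q) (-(ρ * Real.sin θ)) =
      -(ρ * (betaq p q * Real.cos θ + (polM p (betaq p q) b θ +
        betaq p q ^ (-q) * ρ ^ (q + 1 - p) * polE q θ) / polD p θ)) := by
  set β := betaq p q with hβdef
  have hβ := h.pos
  have hsc := Real.sin_sq_add_cos_sq θ
  have hg : β ^ 2 * (ρ * Real.cos θ / β) ^ 2 + (-(ρ * Real.sin θ)) ^ 2 = ρ ^ 2 := by
    field_simp
    linear_combination hsc
  have hD : β ^ 2 * (ρ * Real.cos θ / β) ^ 2 + (p - 1) * (-(ρ * Real.sin θ)) ^ 2 =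
      ρ ^ 2 * polD p θ := by
    unfold polD
    field_simp
  have hpow : (ρ ^ 2) ^ ((2 - p) / 2) = ρ ^ (2 - p) := by
    rw [← Real.rpow_two, ← Real.rpow_mul hρ.le]; congr 1; ring
  have hx : ρ * Real.cos θ / β = ρ / β * Real.cos θ := by ring
  have hρβ : 0 < ρ / β := div_pos hρ hβ
  have e1 : ρ ^ (2 - p) * (|ρ / β * Real.cos θ| ^ (q - 1) * (ρ / β * Real.cos θ)) =
      ρ * (β ^ (-q) * ρ ^ (q + 1 - p) * polE q θ) := by
    rw [abs_mul_rpow_mul hρβ, polE, Real.div_rpow hρ.le hβ.le, Real.rpow_neg hβ.le]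
    have : ρ ^ (2 - p) * ρ ^ q = ρ * ρ ^ (q + 1 - p) := by
      rw [← Real.rpow_add hρ, ← Real.rpow_one_add' hρ.le (by linarith [h.r_pos])]
      congr 1; ring
    linear_combination (β ^ q)⁻¹ * (|Real.cos θ| ^ (q - 1) * Real.cos θ) * this
  have e2 : ρ ^ (2 - p) * (b * β ^ (p - 1) * (|ρ / β * Real.cos θ| ^ (p - 2) *
      (ρ / β * Real.cos θ))) =
      ρ * ((p - 2) * (β + 1) * Real.cos θ - polM p β b θ) := by
    have h2 := abs_mul_rpow_mul (y := Real.cos θ) (s := p - 1) hρβ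
    rw [show p - 1 - 1 = p - 2 by ring] at h2
    rw [h2, polM, Real.div_rpow hρ.le hβ.le]
    have hβp : β ^ (p - 1) ≠ 0 := (Real.rpow_pos_of_pos hβ _).ne'
    have : ρ ^ (2 - p) * ρ ^ (p - 1) = ρ := by
      rw [← Real.rpow_add hρ, show 2 - p + (p - 1) = 1 by ring, Real.rpow_one]
    field_simp
    linear_combination b * |Real.cos θ| ^ (p - 2) * Real.cos θ * this
  rw [accel, ← hβdef, hg, hD, hpow, lambdaq_eq h, ← hβdef, hx, mul_sub, e1, e2]
  have h1 := (polD_pos h θ).ne'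
  have hDdef : polD p θ = Real.cos θ ^ 2 + (p - 1) * Real.sin θ ^ 2 := rfl
  field_simp
  rw [hDdef]
  linear_combination β * Real.cos θ * hsc

end solution

/-! ### Every solution with a zero follows an orbit -/

theorem exists_polar_angle {u v ρ : ℝ} (hρ : 0 < ρ) (h : u ^ 2 + v ^ 2 = ρ ^ 2) :
    ∃ θ, u = ρ * Real.cos θ ∧ v = ρ * Real.sin θ := by
  have hn : ‖(⟨u, v⟩ : ℂ)‖ = ρ := by
    rw [Complex.norm_eq_sqrt_sq_add_sq, h, Real.sqrt_sq hρ.le]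
  refine ⟨Complex.arg ⟨u, v⟩, ?_, ?_⟩
  · rw [← hn, Complex.norm_mul_cos_arg]
  · rw [← hn, Complex.norm_mul_sin_arg]

theorem exists_bound_of_periodic {f : ℝ → ℝ} {T : ℝ} (hT : 0 < T) (hf : Function.Periodic f T)
    (hc : Continuous f) : ∃ B, ∀ t, |f t| ≤ B := by
  obtain ⟨B, hB⟩ := (isCompact_Icc (a := (0 : ℝ)) (b := T)).exists_bound_of_continuousOn
    hc.continuousOn
  refine ⟨B, fun t => ?_⟩
  obtain ⟨s, hs, hst⟩ := hf.exists_mem_Ico₀ hT t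
  rw [hst]
  exact hB s ⟨hs.1, hs.2.le⟩

theorem periodic_deriv {f : ℝ → ℝ} {T : ℝ} (hf : Function.Periodic f T) :
    Function.Periodic (deriv f) T := by
  intro t
  rw [← deriv_comp_add_const]
  congr 1
  exact funext hf

/-- The phase curve of a nontrivial solution avoids the origin. -/
theorem IsPeriodicSolution.sq_pos {p q c : ℝ} {ω : ℝ → ℝ} (h : Exponents p q (betaq p q))
    (hω : IsPeriodicSolution p q c ω) (hne : ∃ t, ω t ≠ 0) (t : ℝ) :
    0 < betaq p q ^ 2 * ω t ^ 2 + deriv ω t ^ 2 := by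
  obtain ⟨t₀, ht₀⟩ := hne
  obtain ⟨b, rfl⟩ : ∃ b, c = b * betaq p q ^ (p - 1) :=
    ⟨c / betaq p q ^ (p - 1), (div_mul_cancel₀ _ (Real.rpow_pos_of_pos h.pos _).ne').symm⟩
  set β := betaq p q with hβdef
  have hβ := h.pos
  set g : ℝ → ℝ := fun t => β ^ 2 * ω t ^ 2 + deriv ω t ^ 2 with hgdef
  have hcω := hω.continuous
  have hcd := hω.continuous_deriv
  have hcg : Continuous g := by fun_prop
  obtain ⟨B, hB⟩ := exists_bound_of_periodic (f := g) (by positivity : (0 : ℝ) < 2 * Real.pi)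
    (fun s => by simp only [hgdef, hω.periodic s, periodic_deriv hω.periodic s]) hcg
  have hB0 : 0 ≤ B := (abs_nonneg _).trans (hB 0)
  have hg0 : ∀ s, 0 ≤ g s := fun s => by positivity
  set m := min 1 (p - 1) with hm
  have hmpos : 0 < m := lt_min one_pos (by linarith [h.one_lt])
  set S := |p - 2| * (β + 1) + |b| + β ^ (-q) * (Real.sqrt B) ^ (q + 1 - p) with hS
  have hS0 : 0 ≤ S := by positivity
  -- In polar coordinates the derivative of g = ρ² is 2ρ² sin θ times the radial numerator over D.
  -- The numerator is bounded by S, because the periodic function g is bounded by B.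
  refine pos_of_abs_deriv_le (f' := fun s => 2 * deriv ω s * (β ^ 2 * ω s +
    accel p q (b * β ^ (p - 1)) (ω s) (deriv ω s))) (K := 2 * (S / m)) (t₀ := t₀) hcg hg0
    (fun s hs => ?_) (fun s hs => ?_) ?_ t
  · refine ((((hω.hasDerivAt s).pow 2).const_mul (β ^ 2)).add
      ((hω.hasDerivAt_deriv h hs).pow 2)).congr_deriv ?_
    push_cast
    ring
  · set ρ := Real.sqrt (g s) with hρdef
    have hρ : 0 < ρ := Real.sqrt_pos.mpr hs
    have hρ2 : ρ ^ 2 = g s := Real.sq_sqrt hs.le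
    obtain ⟨θ, h1, h2⟩ := exists_polar_angle (u := β * ω s) (v := -deriv ω s) hρ (by
      rw [hρ2, hgdef]; ring)
    have hx : ω s = ρ * Real.cos θ / β := by field_simp; linarith
    have hy : deriv ω s = -(ρ * Real.sin θ) := by linarith
    have hacc := accel_polar (b := b) h hρ θ
    rw [← hβdef, ← hx, ← hy] at hacc
    rw [hacc, ← hρ2, hy, hx]
    set M := polM p β b θ + β ^ (-q) * ρ ^ (q + 1 - p) * polE q θ with hM
    have hDm : m ≤ polD p θ := polD_ge p θ
    have hDpos := polD_pos h θ
    have e1 : 2 * -(ρ * Real.sin θ) * (β ^ 2 * (ρ * Real.cos θ / β) +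
        -(ρ * (β * Real.cos θ + M / polD p θ))) =
        2 * ρ ^ 2 * (Real.sin θ * (M / polD p θ)) := by
      field_simp
      ring
    rw [e1, abs_mul, abs_of_nonneg (by positivity : 0 ≤ 2 * ρ ^ 2), abs_mul, abs_div,
      abs_of_pos hDpos]
    have hMS : |M| ≤ S := by
      refine (abs_add_le _ _).trans (add_le_add (abs_polM_le h θ) ?_)
      rw [abs_mul, abs_of_nonneg (by positivity)]
      have h3 : ρ ≤ Real.sqrt B := Real.sqrt_le_sqrt ((le_abs_self _).trans (hB s))
      have h4 : ρ ^ (q + 1 - p) ≤ Real.sqrt B ^ (q + 1 - p) :=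
        Real.rpow_le_rpow hρ.le h3 h.r_pos.le
      have h5 := abs_polE_le h θ
      have h6 : 0 ≤ β ^ (-q) := by positivity
      calc _ ≤ β ^ (-q) * Real.sqrt B ^ (q + 1 - p) * 1 := by gcongr
        _ = _ := mul_one _
    have h7 : |M| / polD p θ ≤ S / m := by gcongr
    have h8 := Real.abs_sin_le_one θ
    calc 2 * ρ ^ 2 * (|Real.sin θ| * (|M| / polD p θ)) ≤ 2 * ρ ^ 2 * (1 * (S / m)) := by gcongr
      _ = _ := by ring
  · have : 0 < ω t₀ ^ 2 := by positivity
    positivity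

/-- Lift of a plane curve that avoids the origin to polar coordinates. -/
theorem exists_angle_lift {β : ℝ} {x y z : ℝ → ℝ} (hx : ∀ t, HasDerivAt x (y t) t)
    (hy : ∀ t, HasDerivAt y (z t) t) (hz : Continuous z)
    (hg : ∀ t, 0 < β ^ 2 * x t ^ 2 + y t ^ 2) {t₀ θ₀ : ℝ}
    (h1 : β * x t₀ = Real.sqrt (β ^ 2 * x t₀ ^ 2 + y t₀ ^ 2) * Real.cos θ₀)
    (h2 : y t₀ = -(Real.sqrt (β ^ 2 * x t₀ ^ 2 + y t₀ ^ 2) * Real.sin θ₀)) :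
    ∃ θ : ℝ → ℝ, θ t₀ = θ₀ ∧ (∀ t, HasDerivAt θ
      (β * (y t ^ 2 - x t * z t) / (β ^ 2 * x t ^ 2 + y t ^ 2)) t) ∧
      ∀ t, β * x t = Real.sqrt (β ^ 2 * x t ^ 2 + y t ^ 2) * Real.cos (θ t) ∧
        y t = -(Real.sqrt (β ^ 2 * x t ^ 2 + y t ^ 2) * Real.sin (θ t)) := by
  have hcx : Continuous x := continuous_iff_continuousAt.mpr fun t => (hx t).continuousAt
  have hcy : Continuous y := continuous_iff_continuousAt.mpr fun t => (hy t).continuousAt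
  set g : ℝ → ℝ := fun t => β ^ 2 * x t ^ 2 + y t ^ 2 with hgdef
  set v : ℝ → ℝ := fun t => β * (y t ^ 2 - x t * z t) / g t with hv
  have hcv : Continuous v := Continuous.div (by fun_prop) (by fun_prop) fun t => (hg t).ne'
  set ρ : ℝ → ℝ := fun t => Real.sqrt (g t) with hρ
  have hρpos : ∀ t, 0 < ρ t := fun t => Real.sqrt_pos.mpr (hg t)
  have hρ2 : ∀ t, ρ t ^ 2 = β ^ 2 * x t ^ 2 + y t ^ 2 := fun t => Real.sq_sqrt (hg t).le
  set θ : ℝ → ℝ := fun t => θ₀ + ∫ s in t₀..t, v s with hθ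
  have hdθ : ∀ t, HasDerivAt θ (v t) t := fun t =>
    (intervalIntegral.integral_hasDerivAt_right (hcv.intervalIntegrable _ _)
      (hcv.stronglyMeasurableAtFilter _ _) hcv.continuousAt).const_add θ₀
  have hθ0 : θ t₀ = θ₀ := by simp [hθ]
  have hdρ : ∀ t, HasDerivAt ρ ((β ^ 2 * x t * y t + y t * z t) / ρ t) t := by
    intro t
    have := ((((hx t).pow 2).const_mul (β ^ 2)).add ((hy t).pow 2)).sqrt (hg t).ne'
    refine this.congr_deriv ?_
    have h3 := (hρpos t).ne'
    have e : ((fun y => β ^ 2 * (x ^ 2) y) + y ^ 2) t = g t := rfl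
    rw [e]
    change _ = _ / Real.sqrt (g t)
    have h4 : Real.sqrt (g t) ≠ 0 := h3
    field_simp
    push_cast
    ring
  -- This is the cosine of the difference between the true angle and θ. It is constant and equals 1
  -- at t₀, which forces the two angles to agree modulo 2π.
  set Q : ℝ → ℝ := fun t => β * x t / ρ t * Real.cos (θ t) - y t / ρ t * Real.sin (θ t) with hQ
  have hdQ : ∀ t, HasDerivAt Q 0 t := by
    intro t
    have h3 := (hρpos t).ne'
    have hD := ((((hx t).const_mul β).div (hdρ t) h3).mul (hdθ t).cos).sub
      (((hy t).div (hdρ t) h3).mul (hdθ t).sin)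
    refine hD.congr_deriv ?_
    have hgt : g t = ρ t ^ 2 := (hρ2 t).symm
    simp only [hv, Pi.div_apply]
    rw [hgt]
    have h4 := hρ2 t
    generalize ρ t = R at *
    field_simp
    linear_combination (β * y t * Real.cos (θ t) - z t * Real.sin (θ t)) * h4
  have hQ1 : ∀ t, Q t = 1 := by
    intro t
    have hconst := is_const_of_deriv_eq_zero (fun t => (hdQ t).differentiableAt)
      (fun t => (hdQ t).deriv) t t₀
    rw [hconst, hQ]
    simp only [hθ0]
    have h3 := (hρpos t₀).ne'
    have e1 : β * x t₀ = ρ t₀ * Real.cos θ₀ := h1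
    have e2 : y t₀ = -(ρ t₀ * Real.sin θ₀) := h2
    rw [e1, e2]
    have := Real.sin_sq_add_cos_sq θ₀
    field_simp
    linarith
  refine ⟨θ, hθ0, hdθ, fun t => ?_⟩
  have h3 := hρpos t
  have h4 := hρ2 t
  have h5 : β * x t * Real.cos (θ t) - y t * Real.sin (θ t) = ρ t := by
    have := hQ1 t
    simp only [hQ] at this
    field_simp at this
    exact this
  have h6 := Real.sin_sq_add_cos_sq (θ t)
  have h7 : (β * x t - ρ t * Real.cos (θ t)) ^ 2 + (y t + ρ t * Real.sin (θ t)) ^ 2 = 0 := by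
    linear_combination -h4 - 2 * ρ t * h5 + ρ t ^ 2 * h6
  constructor
  · have : (β * x t - ρ t * Real.cos (θ t)) ^ 2 = 0 := by
      linarith [sq_nonneg (β * x t - ρ t * Real.cos (θ t)), sq_nonneg (y t + ρ t * Real.sin (θ t))]
    exact sub_eq_zero.mp (pow_eq_zero_iff two_ne_zero |>.mp this)
  · have : (y t + ρ t * Real.sin (θ t)) ^ 2 = 0 := by
      linarith [sq_nonneg (β * x t - ρ t * Real.cos (θ t)), sq_nonneg (y t + ρ t * Real.sin (θ t))]
    exact eq_neg_of_add_eq_zero_left (pow_eq_zero_iff two_ne_zero |>.mp this)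

/-- A trajectory of the polar equations stays on the orbit on which it starts. -/
theorem eq_orbit_of_polar {p q β b a : ℝ} (h : Exponents p q β) (ha : 0 < a) {θ W : ℝ → ℝ}
    {t₀ : ℝ} (hθ : ∀ t, HasDerivAt θ ((polA p β b (θ t) + W t * polC q (θ t)) / polD p (θ t)) t)
    (hW : ∀ t, HasDerivAt W ((q + 1 - p) * W t * Real.sin (θ t) *
      (polM p β b (θ t) + W t * polE q (θ t)) / polD p (θ t)) t)
    (h0 : W t₀ = orbit p q β b a (θ t₀)) (t : ℝ) : W t = orbit p q β b a (θ t) := by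
  have hO := isOrbit_orbit h b ha
  generalize orbit p q β b a = V at *
  have hcθ : Continuous θ := continuous_iff_continuousAt.mpr fun t => (hθ t).continuousAt
  have hcW : Continuous W := continuous_iff_continuousAt.mpr fun t => (hW t).continuousAt
  -- The rate of the difference W - V(θ) in time. Only the angular speed of the orbit V stands in
  -- the denominator, so nothing need be known in advance about the sign of θ'.
  set k : ℝ → ℝ := fun t => (q + 1 - p) * Real.sin (θ t) *
    (polM p β b (θ t) * polA p β b (θ t) + polE q (θ t) * polA p β b (θ t) * (W t + V (θ t))
      + polE q (θ t) * polC q (θ t) * W t * V (θ t)) /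
    (polD p (θ t) * (polA p β b (θ t) + V (θ t) * polC q (θ t))) with hk
  have hck : Continuous k := by
    have h1 := (continuous_polA (b := b) h).comp hcθ
    have h2 := (continuous_polC h).comp hcθ
    have h3 := (continuous_polM (b := b) h).comp hcθ
    have h4 := (continuous_polE h).comp hcθ
    have h5 := hO.continuous
    have h6 := (continuous_polD (p := p)).comp hcθ
    simp only [Function.comp_def] at h1 h2 h3 h4 h6
    exact Continuous.div (by fun_prop) (by fun_prop)
      fun t => (mul_pos (polD_pos h (θ t)) (hO.speed_pos (θ t))).ne'
  have hd : ∀ t, HasDerivAt (fun t => W t - V (θ t)) (k t * (W t - V (θ t))) t := by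
    intro t
    refine ((hW t).sub ((hO.hasDerivAt (θ t)).comp t (hθ t))).congr_deriv ?_
    have h1 := (hO.speed_pos (θ t)).ne'
    have h2 := (polD_pos h (θ t)).ne'
    simp only [hk]
    field_simp
    ring
  have := eq_zero_of_abs_deriv_le (t₀ := t₀) hd (fun m => ?_) (by simp [h0]) t
  · linarith
  · obtain ⟨K, hK⟩ := isCompact_Icc.exists_bound_of_continuousOn
      (hck.continuousOn (s := Icc (t₀ - m) (t₀ + m)))
    refine ⟨K, fun x hx => ?_⟩
    rw [abs_mul]
    exact mul_le_mul_of_nonneg_right (hK x hx) (abs_nonneg _)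

/-- Every solution with a zero is a translate of one of the explicit solutions. -/
theorem IsPeriodicSolution.exists_eq_polSolution {p q b : ℝ} {ω : ℝ → ℝ}
    (h : Exponents p q (betaq p q)) (hω : IsPeriodicSolution p q (b * betaq p q ^ (p - 1)) ω)
    (hne : ∃ t, ω t ≠ 0) (hz : ∃ t, ω t = 0) :
    ∃ a > 0, ∃ ψ, ∀ t, ω t = polSolution p q (betaq p q) b a (t + ψ) := by
  have hg := hω.sq_pos h hne
  obtain ⟨t₀, ht₀⟩ := hz
  have hacc := fun t => hω.hasDerivAt_deriv h (hg t)
  have hcz := continuous_accel h (b * betaq p q ^ (p - 1)) hω.continuous hω.continuous_deriv hg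
  set β := betaq p q with hβdef
  have hβ := h.pos
  set y := deriv ω with hy
  set z : ℝ → ℝ := fun t => accel p q (b * β ^ (p - 1)) (ω t) (y t) with hz
  set ρ : ℝ → ℝ := fun t => Real.sqrt (β ^ 2 * ω t ^ 2 + y t ^ 2) with hρ
  have hρpos : ∀ t, 0 < ρ t := fun t => Real.sqrt_pos.mpr (hg t)
  have hρ2 : ∀ t, ρ t ^ 2 = β ^ 2 * ω t ^ 2 + y t ^ 2 := fun t => Real.sq_sqrt (hg t).le
  -- At a zero the phase point lies on the vertical axis, and the sign of ω' decides between -π/2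
  -- and π/2. Evenness of orbits lets both cases start from the same initial value.
  obtain ⟨θ₀, hc0, hs0, hθ₀⟩ : ∃ θ₀, β * ω t₀ = ρ t₀ * Real.cos θ₀ ∧
      y t₀ = -(ρ t₀ * Real.sin θ₀) ∧ (θ₀ = -(Real.pi / 2) ∨ θ₀ = Real.pi / 2) := by
    have h1 : ρ t₀ = |y t₀| := by
      simp only [hρ, ht₀]
      rw [← Real.sqrt_sq_eq_abs]
      congr 1
      ring
    rw [h1, ht₀]
    rcases le_total 0 (y t₀) with h2 | h2
    · exact ⟨-(Real.pi / 2), by simp, by simp [abs_of_nonneg h2], Or.inl rfl⟩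
    · exact ⟨Real.pi / 2, by simp, by simp [abs_of_nonpos h2], Or.inr rfl⟩
  obtain ⟨θ, hθ0, hdθ, hpol⟩ := exists_angle_lift hω.hasDerivAt hacc hcz hg hc0 hs0
  have hx : ∀ t, ω t = ρ t * Real.cos (θ t) / β := fun t => by
    rw [eq_div_iff hβ.ne', mul_comm]; exact (hpol t).1
  have hyy : ∀ t, y t = -(ρ t * Real.sin (θ t)) := fun t => (hpol t).2
  set W : ℝ → ℝ := fun t => β ^ (-q) * ρ t ^ (q + 1 - p) with hW
  have hWpos : ∀ t, 0 < W t := fun t => by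
    have := hρpos t
    positivity
  have hzz : ∀ t, z t = -(ρ t * (β * Real.cos (θ t) + (polM p β b (θ t) +
      W t * polE q (θ t)) / polD p (θ t))) := fun t => by
    have := accel_polar (b := b) h (hρpos t) (θ t)
    rw [← hβdef, ← hx, ← hyy] at this
    exact this
  have hdθ' : ∀ t, HasDerivAt θ
      ((polA p β b (θ t) + W t * polC q (θ t)) / polD p (θ t)) t := by
    intro t
    refine (hdθ t).congr_deriv ?_
    change _ / (β ^ 2 * ω t ^ 2 + y t ^ 2) = _
    rw [← hρ2, hx t, hyy t]
    have h1 := cos_mul_polM (b := b) h (θ t) (W t)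
    have h2 := (polD_pos h (θ t)).ne'
    have h3 := (hρpos t).ne'
    have h4 := Real.sin_sq_add_cos_sq (θ t)
    rw [← hx t, ← hyy t]
    change β * (y t ^ 2 - ω t * z t) / _ = _
    rw [hzz, hx t, hyy t]
    generalize polM p β b (θ t) + W t * polE q (θ t) = M at *
    rw [show polA p β b (θ t) + W t * polC q (θ t) = Real.cos (θ t) * M + β * polD p (θ t) by
      linarith]
    field_simp
    linear_combination β * polD p (θ t) * h4
  have hdρ : ∀ t, HasDerivAt ρ (ρ t * Real.sin (θ t) *
      (polM p β b (θ t) + W t * polE q (θ t)) / polD p (θ t)) t := by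
    intro t
    have := ((((hω.hasDerivAt t).pow 2).const_mul (β ^ 2)).add ((hacc t).pow 2)).sqrt (hg t).ne'
    refine this.congr_deriv ?_
    have e : Real.sqrt (((fun y => β ^ 2 * (ω ^ 2) y) + y ^ 2) t) = ρ t := rfl
    rw [e]
    change (β ^ 2 * (_ * _ * y t) + _ * _ * z t) / _ = _
    have h2 := (polD_pos h (θ t)).ne'
    have h3 := (hρpos t).ne'
    rw [hzz, hyy t]
    generalize polM p β b (θ t) + W t * polE q (θ t) = M at *
    have h4 : β * ω t = ρ t * Real.cos (θ t) := (hpol t).1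
    field_simp
    push_cast
    linear_combination (-2 * β * polD p (θ t) * Real.sin (θ t)) * h4
  have hdW : ∀ t, HasDerivAt W ((q + 1 - p) * W t * Real.sin (θ t) *
      (polM p β b (θ t) + W t * polE q (θ t)) / polD p (θ t)) t := by
    intro t
    refine (((hdρ t).rpow_const (p := q + 1 - p) (Or.inl (hρpos t).ne')).const_mul
      (β ^ (-q))).congr_deriv ?_
    rw [Real.rpow_sub_one (hρpos t).ne']
    have h3 := (hρpos t).ne'
    have h2 := (polD_pos h (θ t)).ne'
    simp only [hW]
    field_simp
  have ha := hWpos t₀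
  have h0 : W t₀ = orbit p q β b (W t₀) (θ t₀) := by
    rw [hθ0]
    rcases hθ₀ with h1 | h1
    · rw [h1, orbit_at h b ha]
    · rw [h1, ← (isOrbit_orbit h b ha).even h, orbit_at h b ha]
  have hWO := eq_orbit_of_polar h ha hdθ' hdW h0
  set a := W t₀ with hadef
  -- The angle moves at the speed prescribed by the orbit, so the orbit time of θ(t) differs from t
  -- by a constant, which is the required shift.
  have htime : ∀ t, HasDerivAt (fun t => orbitTime p q β b a (θ t) - t) 0 t := by
    intro t
    refine (((hasDerivAt_orbitTime h b ha (θ t)).comp t (hdθ' t)).sub (hasDerivAt_id t)).congr_deriv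
      ?_
    have h1 := ((isOrbit_orbit h b ha).speed_pos (θ t)).ne'
    have h2 := (polD_pos h (θ t)).ne'
    rw [slowness, hWO t]
    field_simp
    ring
  refine ⟨a, ha, orbitTime p q β b a (θ 0), fun t => ?_⟩
  have hconst := is_const_of_deriv_eq_zero (fun t => (htime t).differentiableAt)
    (fun t => (htime t).deriv) t 0
  have h1 : θ t = orbitAngle p q β b a (t + orbitTime p q β b a (θ 0)) := by
    rw [← orbitAngle_orbitTime h b ha (θ t)]
    congr 1
    linarith
  rw [polSolution, ← h1, ← hWO t, hx t]
  simp only [hW]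
  rw [polRadius_of_rpow h (hρpos t)]

theorem exists_quarterTime_of_periodic {p q β b a : ℝ} (h : Exponents p q β) (ha : 0 < a)
    {T : ℝ} (hT : 0 < T) (hper : Function.Periodic (polSolution p q β b a) T) :
    ∃ m : ℕ, 1 ≤ m ∧ T = m * (4 * quarterTime p q β b a) := by
  have hq := quarterTime_pos h b ha
  have hleast := hasLeastPeriod_polSolution h b ha
  set S := 4 * quarterTime p q β b a with hS
  have hS0 : 0 < S := hleast.1.1
  -- The remainder of T modulo the least period S is again a period; being smaller than S, it must
  -- vanish.
  have hf : Function.Periodic (polSolution p q β b a) (T - ⌊T / S⌋ * S) :=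
    hper.sub_period (hleast.1.2.int_mul ⌊T / S⌋)
  have h1 : T - ⌊T / S⌋ * S = Int.fract (T / S) * S := by
    rw [Int.fract]
    field_simp
  rw [h1] at hf
  have h2 : Int.fract (T / S) = 0 := by
    by_contra hne
    have hpos : 0 < Int.fract (T / S) := lt_of_le_of_ne (Int.fract_nonneg _) (Ne.symm hne)
    have := hleast.2 ⟨mul_pos hpos hS0, hf⟩
    have := Int.fract_lt_one (T / S)
    nlinarith
  have h3 : T = ⌊T / S⌋ * S := by
    rw [h2] at h1
    linarith
  have h4 : 0 < ⌊T / S⌋ := by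
    by_contra hcon
    have : (⌊T / S⌋ : ℝ) ≤ 0 := by exact_mod_cast not_lt.mp hcon
    nlinarith
  refine ⟨⌊T / S⌋.toNat, by omega, ?_⟩
  have : ((⌊T / S⌋.toNat : ℕ) : ℝ) = (⌊T / S⌋ : ℝ) := by
    exact_mod_cast congrArg (Int.cast (R := ℝ)) (Int.toNat_of_nonneg h4.le)
  rw [this]
  exact h3

/-! ### The integral in M_q and the admissible mode numbers -/

section integralMq
variable {p q b : ℝ}

theorem cq_eq (h : Exponents p q (betaq p q)) :
    cq p q = betaq p q ^ (p - 1) * ((p - 1) * betaq p q + (p - 2)) := by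
  have hβ := h.pos
  rw [cq, lambdaq_eq h, show p - 1 = p - 2 + 1 by ring, Real.rpow_add_one hβ.ne']
  ring

theorem mul_rpow_lt_cq_iff (h : Exponents p q (betaq p q)) :
    b * betaq p q ^ (p - 1) < cq p q ↔ b < (p - 1) * betaq p q + (p - 2) := by
  have : 0 < betaq p q ^ (p - 1) := Real.rpow_pos_of_pos h.pos _
  rw [cq_eq h, mul_comm]
  exact mul_lt_mul_iff_right₀ this

/-- Multiply numerator and denominator by cos² θ. The formula needs cos θ > 0; the endpoint π/2,
where the tangent takes a conventional value, is a null set for the integral. -/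
theorem integrandMq_eq (h : Exponents p q (betaq p q)) {θ : ℝ} (hθ : 0 < Real.cos θ) :
    integrandMq p q (b * betaq p q ^ (p - 1)) θ =
      betaq p q ^ (1 - p) * (polD p θ / polA p (betaq p q) b θ) := by
  have hsc := Real.sin_sq_add_cos_sq θ
  rw [integrandMq, cq_eq h]
  set β := betaq p q
  have hβ := h.pos
  have h1 : β ^ p = β ^ (p - 1) * β := by
    rw [← Real.rpow_add_one hβ.ne', sub_add_cancel]
  have h2 : β ^ (1 - p) = (β ^ (p - 1))⁻¹ := by
    rw [← Real.rpow_neg hβ.le, neg_sub]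
  have h3 : Real.cos θ ^ p = Real.cos θ ^ (p - 2) * Real.cos θ ^ 2 := by
    rw [← Real.rpow_natCast, ← Real.rpow_add hθ]
    norm_num
  have hB : 0 < β ^ (p - 1) := Real.rpow_pos_of_pos hβ _
  rw [polD, polA, abs_of_pos hθ, h1, h2, h3, Real.tan_eq_sin_div_cos]
  have e1 : 1 + (p - 1) * (Real.sin θ / Real.cos θ) ^ 2 =
      (Real.cos θ ^ 2 + (p - 1) * Real.sin θ ^ 2) / Real.cos θ ^ 2 := by
    field_simp
  have e2 : β ^ (p - 1) * β * (p - 1) * (Real.sin θ / Real.cos θ) ^ 2 +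
      β ^ (p - 1) * ((p - 1) * β + (p - 2)) - b * β ^ (p - 1) * Real.cos θ ^ (p - 2) =
      β ^ (p - 1) * ((p - 1) * β + (p - 2) * Real.cos θ ^ 2 -
        b * (Real.cos θ ^ (p - 2) * Real.cos θ ^ 2)) / Real.cos θ ^ 2 := by
    field_simp
    linear_combination β * (p - 1) * hsc
  rw [e1, e2, div_div_div_cancel_right₀ (by positivity), div_mul_eq_div_div_swap, inv_mul_eq_div]

theorem continuous_polD_div_polA (h : Exponents p q (betaq p q))
    (hb : b < (p - 1) * betaq p q + (p - 2)) :
    Continuous fun θ => polD p θ / polA p (betaq p q) b θ :=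
  continuous_polD.div (continuous_polA h) fun θ => (polA_pos_of_lt h hb θ).ne'

theorem integral_polD_div_polA_pos (h : Exponents p q (betaq p q))
    (hb : b < (p - 1) * betaq p q + (p - 2)) :
    0 < ∫ θ in (-(Real.pi / 2))..0, polD p θ / polA p (betaq p q) b θ :=
  intervalIntegral.intervalIntegral_pos_of_pos
    ((continuous_polD_div_polA h hb).intervalIntegrable _ _)
    (fun θ => div_pos (polD_pos h θ) (polA_pos_of_lt h hb θ)) (by linarith [Real.pi_pos])

theorem intervalIntegrable_integrandMq (h : Exponents p q (betaq p q))
    (hb : b < (p - 1) * betaq p q + (p - 2)) :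
    IntervalIntegrable (integrandMq p q (b * betaq p q ^ (p - 1))) MeasureTheory.volume
      0 (Real.pi / 2) := by
  refine (((continuous_polD_div_polA h hb).const_smul (betaq p q ^ (1 - p))).intervalIntegrable
    0 (Real.pi / 2)).congr_uIoo fun θ hθ => ?_
  rw [uIoo_of_le (by linarith [Real.pi_pos])] at hθ
  exact (integrandMq_eq h (Real.cos_pos_of_mem_Ioo ⟨by linarith [hθ.1, Real.pi_pos], hθ.2⟩)).symm

theorem integral_integrandMq (h : Exponents p q (betaq p q)) :
    ∫ θ in (0 : ℝ)..(Real.pi / 2), integrandMq p q (b * betaq p q ^ (p - 1)) θ =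
      betaq p q ^ (1 - p) * ∫ θ in (-(Real.pi / 2))..0, polD p θ / polA p (betaq p q) b θ := by
  have h1 := intervalIntegral.integral_comp_neg (a := 0) (b := Real.pi / 2)
    fun θ => polD p θ / polA p (betaq p q) b θ
  rw [neg_zero] at h1
  rw [← h1, ← intervalIntegral.integral_const_mul]
  refine intervalIntegral.integral_congr_ae ?_
  have : ∀ᵐ θ : ℝ, θ ≠ Real.pi / 2 := by
    simp [MeasureTheory.ae_iff]
  filter_upwards [this] with θ hθ hmem
  rw [uIoc_of_le (by linarith [Real.pi_pos])] at hmem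
  rw [integrandMq_eq h (Real.cos_pos_of_mem_Ioo
    ⟨by linarith [hmem.1, Real.pi_pos], lt_of_le_of_ne hmem.2 hθ⟩), polD_neg, polA_neg]

theorem Mq_lt_iff (h : Exponents p q (betaq p q)) (hb : b < (p - 1) * betaq p q + (p - 2))
    {k : ℝ} (hk : 0 < k) : Mq p q (b * betaq p q ^ (p - 1)) < k ↔
      Real.pi / (2 * k) < ∫ θ in (-(Real.pi / 2))..0, polD p θ / polA p (betaq p q) b θ := by
  have hJ := integral_polD_div_polA_pos h hb
  have hB : 0 < betaq p q ^ (1 - p) := Real.rpow_pos_of_pos h.pos _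
  rw [Mq, integral_integrandMq h]
  generalize (∫ θ in (-(Real.pi / 2))..0, polD p θ / polA p (betaq p q) b θ) = J at *
  rw [div_lt_iff₀ (by positivity), div_lt_iff₀ (by positivity)]
  constructor
  · intro hlt
    refine lt_of_mul_lt_mul_right ?_ hB.le
    linarith
  · intro hlt
    have := mul_lt_mul_of_pos_right hlt hB
    linarith

/-- In the subcritical case the admissible numbers are upward closed, so lying above their least
element is the same as belonging to them. Expressed through quarter periods, the two cases of the
definition merge. -/
theorem kq_le_iff (h : Exponents p q (betaq p q)) (k : ℕ) :
    kq p q (b * betaq p q ^ (p - 1)) ≤ k ↔ 0 < k ∧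
      ∃ a > 0, quarterTime p q (betaq p q) b a = Real.pi / (2 * k) := by
  have hπ := Real.pi_pos
  by_cases hc : cq p q ≤ b * betaq p q ^ (p - 1)
  · rw [kq, if_pos hc]
    have hb : (p - 1) * betaq p q + (p - 2) ≤ b := by
      rwa [← not_lt, ← mul_rpow_lt_cq_iff h, not_lt]
    refine ⟨fun hk => ⟨hk, exists_quarterTime_eq h hb ?_⟩, fun hk => hk.1⟩
    have : (0 : ℝ) < k := by exact_mod_cast hk
    positivity
  · rw [kq, if_neg hc]
    have hb := (mul_rpow_lt_cq_iff h).mp (not_le.mp hc)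
    set S := {k : ℕ | 0 < k ∧ Mq p q (b * betaq p q ^ (p - 1)) < (k : ℝ)} with hS
    have hne : S.Nonempty := by
      obtain ⟨n, hn⟩ := exists_nat_gt (max (Mq p q (b * betaq p q ^ (p - 1))) 0)
      exact ⟨n, by exact_mod_cast (le_max_right _ _).trans_lt hn, (le_max_left _ _).trans_lt hn⟩
    have hmem := Nat.sInf_mem hne
    have h1 : sInf S ≤ k ↔ k ∈ S := by
      refine ⟨fun hk => ⟨hmem.1.trans_le hk, hmem.2.trans_le ?_⟩, fun hk => Nat.sInf_le hk⟩
      exact_mod_cast hk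
    rw [h1]
    refine and_congr_right fun hk => ?_
    have hk' : (0 : ℝ) < k := by exact_mod_cast hk
    rw [Mq_lt_iff h hb hk', exists_quarterTime_eq_iff h hb (by positivity)]

end integralMq

theorem IsPeriodicSolution.comp_add_const {p q c : ℝ} {ω : ℝ → ℝ}
    (hω : IsPeriodicSolution p q c ω) (ψ : ℝ) :
    IsPeriodicSolution p q c fun σ => ω (σ + ψ) := by
  have hd : deriv (fun σ => ω (σ + ψ)) = fun σ => deriv ω (σ + ψ) :=
    funext fun σ => deriv_comp_add_const ..
  have hw : weight p q (fun σ => ω (σ + ψ)) = fun σ => weight p q ω (σ + ψ) := by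
    funext σ
    simp only [weight, hd]
  have hf : (fun s => weight p q (fun σ => ω (σ + ψ)) s * deriv (fun σ => ω (σ + ψ)) s) =
      fun s => (fun s => weight p q ω s * deriv ω s) (s + ψ) := by
    rw [hd, hw]
  refine ⟨fun σ => ?_, hω.contDiff.comp (by fun_prop), ?_, fun σ => ?_⟩
  · simp only [add_right_comm σ _ ψ, hω.periodic (σ + ψ)]
  · rw [hf]
    exact hω.differentiable_flux.comp (by fun_prop)
  · rw [hf, deriv_comp_add_const (fun s => weight p q ω s * deriv ω s), hw]
    exact hω.equation (σ + ψ)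

/-! ### Classification of sign-changing solutions -/

open Classical in
/-- The initial value of the orbit whose solution has least period `2π/k`. -/
def modeValue (p q b : ℝ) (k : ℕ) : ℝ :=
  -- The default 1 keeps the value positive for every k without a condition on k.
  if h : ∃ a > 0, quarterTime p q (betaq p q) b a = Real.pi / (2 * k) then h.choose else 1

section modes
variable {p q b : ℝ} {k : ℕ}

theorem modeValue_pos : 0 < modeValue p q b k := by
  unfold modeValue
  split_ifs with h
  · exact h.choose_spec.1
  · exact one_pos

theorem quarterTime_modeValue (h : Exponents p q (betaq p q))
    (hk : kq p q (b * betaq p q ^ (p - 1)) ≤ k) :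
    quarterTime p q (betaq p q) b (modeValue p q b k) = Real.pi / (2 * k) := by
  have hex := ((kq_le_iff h k).mp hk).2
  rw [modeValue, dif_pos hex]
  exact hex.choose_spec.2

theorem hasLeastPeriod_mode (h : Exponents p q (betaq p q))
    (hk : kq p q (b * betaq p q ^ (p - 1)) ≤ k) :
    HasLeastPeriod (polSolution p q (betaq p q) b (modeValue p q b k)) (2 * Real.pi / k) := by
  have h1 := hasLeastPeriod_polSolution (b := b) h (modeValue_pos (p := p) (q := q) (b := b)
    (k := k))
  rw [quarterTime_modeValue h hk] at h1
  have : (0 : ℝ) < k := by exact_mod_cast ((kq_le_iff h k).mp hk).1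
  convert h1 using 1
  field_simp
  norm_num

/-- A sign-changing solution has a zero, hence is a translate of the solution of some orbit. Since
2π is a multiple m of its least period, its quarter period is π/(2m), and injectivity of the quarter
period identifies the orbit. -/
theorem signChangingSolutions_eq (h : Exponents p q (betaq p q)) :
    signChangingSolutions p q (b * betaq p q ^ (p - 1)) =
      ⋃ (k : ℕ) (_ : kq p q (b * betaq p q ^ (p - 1)) ≤ k), {f : ℝ → ℝ | ∃ ψ : ℝ,
        f = fun σ => polSolution p q (betaq p q) b (modeValue p q b k) (σ + ψ)} := by
  have hπ := Real.pi_pos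
  ext f
  simp only [mem_iUnion, mem_ofPred_eq, exists_prop]
  constructor
  · rintro ⟨hf, ⟨s, hs⟩, t, ht⟩
    obtain ⟨z, hz⟩ : (0 : ℝ) ∈ range f :=
      mem_range_of_exists_le_of_exists_ge hf.continuous ⟨t, ht.le⟩ ⟨s, hs.le⟩
    obtain ⟨a, ha, ψ, hψ⟩ := hf.exists_eq_polSolution h ⟨s, hs.ne'⟩ ⟨z, hz⟩
    have hper : Function.Periodic (polSolution p q (betaq p q) b a) (2 * Real.pi) := by
      intro σ
      have h1 := hψ (σ - ψ + 2 * Real.pi)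
      have h2 := hψ (σ - ψ)
      rw [hf.periodic, h2, show σ - ψ + ψ = σ by ring,
        show σ - ψ + 2 * Real.pi + ψ = σ + 2 * Real.pi by ring] at h1
      exact h1.symm
    obtain ⟨m, hm, hmT⟩ := exists_quarterTime_of_periodic h ha (by positivity) hper
    have hm0 : (0 : ℝ) < m := by exact_mod_cast hm
    have hq : quarterTime p q (betaq p q) b a = Real.pi / (2 * m) := by
      field_simp
      linarith
    have hkm := (kq_le_iff h m).mpr ⟨hm, a, ha, hq⟩
    have haa : a = modeValue p q b m :=
      quarterTime_injOn h b ha modeValue_pos (by rw [hq, quarterTime_modeValue h hkm])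
    exact ⟨m, hkm, ψ, funext fun σ => by rw [← haa, hψ]⟩
  · rintro ⟨k, hk, ψ, rfl⟩
    have hleast := hasLeastPeriod_mode h hk
    have hk0 : (0 : ℝ) < k := by exact_mod_cast ((kq_le_iff h k).mp hk).1
    have ha : 0 < modeValue p q b k := modeValue_pos
    generalize modeValue p q b k = a at *
    have hper : Function.Periodic (polSolution p q (betaq p q) b a) (2 * Real.pi) := by
      have := hleast.1.2.nat_mul k
      rwa [show (k : ℝ) * (2 * Real.pi / k) = 2 * Real.pi by field_simp] at this
    have hpos := polSolution_zero_pos h b ha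
    refine ⟨(isPeriodicSolution_polSolution h ha hper).comp_add_const ψ, ⟨-ψ, ?_⟩,
      0 + 2 * quarterTime p q (betaq p q) b a - ψ, ?_⟩
    · simpa using hpos
    · simp only [sub_add_cancel, polSolution_add h b ha]
      linarith

end modes

/-! ### The logarithmic slope of a positive solution -/

/-- The flux of a solution with logarithmic slope `y`, relative to its size. -/
def slopeFlux (p y : ℝ) : ℝ := y * (1 + y ^ 2) ^ ((p - 2) / 2)

/-- The derivative of `slopeFlux`. -/
def slopeRate (p y : ℝ) : ℝ := (1 + y ^ 2) ^ ((p - 4) / 2) * (1 + (p - 1) * y ^ 2)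

/-- The autonomous part of the equation for the logarithmic slope. -/
def slopeDrift (p β y : ℝ) : ℝ :=
  (p - 1) * β * ((1 + y ^ 2) ^ (p / 2) - 1) + (p - 2) * ((1 + y ^ 2) ^ ((p - 2) / 2) - 1)

section slope
variable {p β : ℝ}

theorem one_add_sq_pos (y : ℝ) : 0 < 1 + y ^ 2 := by positivity

theorem hasDerivAt_one_add_sq_rpow (m y : ℝ) :
    HasDerivAt (fun y : ℝ => (1 + y ^ 2) ^ m) (2 * m * y * (1 + y ^ 2) ^ (m - 1)) y := by
  refine ((((hasDerivAt_id y).pow 2).const_add 1).rpow_const (p := m)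
    (Or.inl (one_add_sq_pos y).ne')).congr_deriv ?_
  simp only [id, Pi.pow_apply]
  push_cast
  ring

theorem hasDerivAt_slopeFlux (y : ℝ) : HasDerivAt (slopeFlux p) (slopeRate p y) y := by
  refine ((hasDerivAt_id y).mul (hasDerivAt_one_add_sq_rpow ((p - 2) / 2) y)).congr_deriv ?_
  have : (1 + y ^ 2) ^ ((p - 2) / 2) = (1 + y ^ 2) ^ ((p - 4) / 2) * (1 + y ^ 2) := by
    rw [← Real.rpow_add_one (one_add_sq_pos y).ne']; congr 1; ring
  rw [slopeRate, show (p - 2) / 2 - 1 = (p - 4) / 2 by ring, this]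
  simp only [id]
  ring

theorem hasDerivAt_slopeDrift (y : ℝ) : HasDerivAt (slopeDrift p β)
    ((p - 1) * β * p * y * (1 + y ^ 2) ^ ((p - 2) / 2) +
      (p - 2) ^ 2 * y * (1 + y ^ 2) ^ ((p - 4) / 2)) y := by
  refine ((((hasDerivAt_one_add_sq_rpow (p / 2) y).sub_const 1).const_mul ((p - 1) * β)).add
    (((hasDerivAt_one_add_sq_rpow ((p - 2) / 2) y).sub_const 1).const_mul (p - 2))).congr_deriv ?_
  rw [show p / 2 - 1 = (p - 2) / 2 by ring, show (p - 2) / 2 - 1 = (p - 4) / 2 by ring]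
  ring

theorem slopeRate_pos (hp : 1 < p) (y : ℝ) : 0 < slopeRate p y := by
  have h1 := one_add_sq_pos y
  have h2 : 0 ≤ (p - 1) * y ^ 2 := mul_nonneg (by linarith) (sq_nonneg y)
  unfold slopeRate
  positivity

theorem slopeRate_neg (y : ℝ) : slopeRate p (-y) = slopeRate p y := by simp [slopeRate]

theorem slopeDrift_neg (y : ℝ) : slopeDrift p β (-y) = slopeDrift p β y := by simp [slopeDrift]

theorem slopeFlux_zero : slopeFlux p 0 = 0 := by simp [slopeFlux]

theorem slopeRate_zero : slopeRate p 0 = 1 := by simp [slopeRate]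

theorem slopeDrift_zero : slopeDrift p β 0 = 0 := by simp [slopeDrift]

/-- The two factors have the same sign, because 1 + y² ≥ 1 is raised to half of the first factor. -/
theorem mul_one_add_sq_rpow_sub_one_nonneg (p y : ℝ) :
    0 ≤ (p - 2) * ((1 + y ^ 2) ^ ((p - 2) / 2) - 1) := by
  have hs : 1 ≤ 1 + y ^ 2 := by linarith [sq_nonneg y]
  rcases le_total 2 p with h | h
  · exact mul_nonneg (by linarith)
      (by linarith [Real.one_le_rpow hs (by linarith : 0 ≤ (p - 2) / 2)])
  · exact mul_nonneg_of_nonpos_of_nonpos (by linarith)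
      (by linarith [Real.rpow_le_one_of_one_le_of_nonpos hs (by linarith : (p - 2) / 2 ≤ 0)])

theorem slopeDrift_nonneg (hp : 1 < p) (hβ : 0 < β) (y : ℝ) : 0 ≤ slopeDrift p β y := by
  have hs : 1 ≤ 1 + y ^ 2 := by linarith [sq_nonneg y]
  have h1 : 1 ≤ (1 + y ^ 2) ^ (p / 2) := Real.one_le_rpow hs (by linarith)
  have h2 : 0 ≤ (p - 1) * β * ((1 + y ^ 2) ^ (p / 2) - 1) :=
    mul_nonneg (mul_nonneg (by linarith) hβ.le) (by linarith)
  have h3 := mul_one_add_sq_rpow_sub_one_nonneg p y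
  unfold slopeDrift
  linarith

end slope

/-! ### Positive solutions as a planar system; nonexistence and constants -/

section positive
variable {p q b : ℝ} {ω y : ℝ → ℝ}

theorem weight_eq_of_slope (h : Exponents p q (betaq p q)) {t : ℝ} (hpos : 0 < ω t)
    (hd : HasDerivAt ω (betaq p q * ω t * y t) t) :
    weight p q ω t = (betaq p q * ω t) ^ (p - 2) * (1 + y t ^ 2) ^ ((p - 2) / 2) := by
  have hβω : 0 < betaq p q * ω t := mul_pos h.pos hpos
  rw [weight, hd.deriv, show betaq p q ^ 2 * ω t ^ 2 + (betaq p q * ω t * y t) ^ 2 =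
    (betaq p q * ω t) ^ 2 * (1 + y t ^ 2) by ring,
    Real.mul_rpow (by positivity) (by positivity), ← Real.rpow_two, ← Real.rpow_mul hβω.le]
  congr 2
  ring

/-- The flux of a positive function in terms of its logarithmic slope. -/
theorem flux_eq_of_slope (h : Exponents p q (betaq p q)) (hpos : ∀ t, 0 < ω t)
    (hd : ∀ t, HasDerivAt ω (betaq p q * ω t * y t) t) :
    (fun t => weight p q ω t * deriv ω t) =
      fun t => (betaq p q * ω t) ^ (p - 1) * slopeFlux p (y t) := by
  funext t
  have hβω : 0 < betaq p q * ω t := mul_pos h.pos (hpos t)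
  rw [weight_eq_of_slope h (hpos t) (hd t), (hd t).deriv, slopeFlux,
    show p - 1 = p - 2 + 1 by ring, Real.rpow_add_one hβω.ne']
  ring

theorem hasDerivAt_flux_of_slope (h : Exponents p q (betaq p q)) (hpos : ∀ t, 0 < ω t)
    (hd : ∀ t, HasDerivAt ω (betaq p q * ω t * y t) t) {t y' : ℝ} (hy : HasDerivAt y y' t) :
    HasDerivAt (fun t => weight p q ω t * deriv ω t)
      ((betaq p q * ω t) ^ (p - 1) * ((p - 1) * betaq p q * y t * slopeFlux p (y t) +
        slopeRate p (y t) * y')) t := by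
  have hβω : 0 < betaq p q * ω t := mul_pos h.pos (hpos t)
  rw [flux_eq_of_slope h hpos hd]
  refine ((((hd t).const_mul (betaq p q)).rpow_const (p := p - 1) (Or.inl hβω.ne')).mul
    ((hasDerivAt_slopeFlux (y t)).comp t hy)).congr_deriv ?_
  have h1 := (hpos t).ne'
  have h2 := h.pos.ne'
  rw [Real.rpow_sub_one hβω.ne' (p - 1)]
  simp only [Function.comp]
  field_simp

/-- The left side of the equation in terms of the logarithmic slope. -/
theorem equation_of_slope (h : Exponents p q (betaq p q)) (hpos : ∀ t, 0 < ω t)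
    (hd : ∀ t, HasDerivAt ω (betaq p q * ω t * y t) t) {t y' : ℝ} (hy : HasDerivAt y y' t) :
    deriv (fun s => weight p q ω s * deriv ω s) t + lambdaq p q * weight p q ω t * ω t
      + |ω t| ^ (q - 1) * ω t - (b * betaq p q ^ (p - 1)) * |ω t| ^ (p - 2) * ω t =
    (betaq p q * ω t) ^ (p - 1) * (slopeRate p (y t) * y' -
      (b - ((p - 1) * betaq p q + (p - 2)) - betaq p q ^ (1 - p) * ω t ^ (q + 1 - p)
        - slopeDrift p (betaq p q) (y t))) := by
  rw [(hasDerivAt_flux_of_slope h hpos hd hy).deriv, weight_eq_of_slope h (hpos t) (hd t),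
    lambdaq_eq h, abs_of_pos (hpos t)]
  set β := betaq p q
  have hβ := h.pos
  have hω := hpos t
  have hβω : 0 < β * ω t := mul_pos hβ hω
  have hs := one_add_sq_pos (y t)
  have e1 : (β * ω t) ^ (p - 1) = (β * ω t) ^ (p - 2) * (β * ω t) := by
    rw [← Real.rpow_add_one hβω.ne']; congr 1; ring
  have e2 : ω t ^ (q - 1) * ω t = (β * ω t) ^ (p - 1) * (β ^ (1 - p) * ω t ^ (q + 1 - p)) := by
    rw [Real.mul_rpow hβ.le hω.le, ← Real.rpow_add_one hω.ne',
      show q - 1 + 1 = (p - 1) + (q + 1 - p) by ring,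
      Real.rpow_add hω, show 1 - p = -(p - 1) by ring, Real.rpow_neg hβ.le]
    have : β ^ (p - 1) ≠ 0 := (Real.rpow_pos_of_pos hβ _).ne'
    field_simp
  have e3 : b * β ^ (p - 1) * ω t ^ (p - 2) * ω t = (β * ω t) ^ (p - 1) * b := by
    rw [Real.mul_rpow hβ.le hω.le, show ω t ^ (p - 1) = ω t ^ (p - 2) * ω t by
      rw [← Real.rpow_add_one hω.ne']; congr 1; ring]
    ring
  have e4 : (1 + y t ^ 2) ^ (p / 2) = (1 + y t ^ 2) ^ ((p - 2) / 2) * (1 + y t ^ 2) := by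
    rw [← Real.rpow_add_one hs.ne']; congr 1; ring
  rw [e2, e3, slopeDrift, e4, slopeFlux]
  generalize β ^ (1 - p) * ω t ^ (q + 1 - p) = v
  rw [e1]
  ring

theorem isPeriodicSolution_of_slope (h : Exponents p q (betaq p q)) (hpos : ∀ t, 0 < ω t)
    (hd : ∀ t, HasDerivAt ω (betaq p q * ω t * y t) t) {y' : ℝ → ℝ}
    (hy : ∀ t, HasDerivAt y (y' t) t)
    (hode : ∀ t, slopeRate p (y t) * y' t = b - ((p - 1) * betaq p q + (p - 2)) -
      betaq p q ^ (1 - p) * ω t ^ (q + 1 - p) - slopeDrift p (betaq p q) (y t))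
    (hper : Function.Periodic ω (2 * Real.pi)) :
    IsPeriodicSolution p q (b * betaq p q ^ (p - 1)) ω := by
  refine ⟨hper, ?_, fun t => (hasDerivAt_flux_of_slope h hpos hd (hy t)).differentiableAt,
    fun t => ?_⟩
  · have hcω : Continuous ω := continuous_iff_continuousAt.mpr fun t => (hd t).continuousAt
    have hcy : Continuous y := continuous_iff_continuousAt.mpr fun t => (hy t).continuousAt
    rw [contDiff_one_iff_deriv]
    refine ⟨fun t => (hd t).differentiableAt, ?_⟩
    rw [show deriv ω = fun t => betaq p q * ω t * y t from funext fun t => (hd t).deriv]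
    fun_prop
  · rw [equation_of_slope h hpos hd (hy t), hode t]
    ring

/-- The equation for the logarithmic slope of a positive solution. -/
theorem IsPeriodicSolution.exists_slope (h : Exponents p q (betaq p q))
    (hω : IsPeriodicSolution p q (b * betaq p q ^ (p - 1)) ω) (hpos : ∀ t, 0 < ω t) :
    ∃ y y' : ℝ → ℝ, (∀ t, HasDerivAt ω (betaq p q * ω t * y t) t) ∧
      (∀ t, HasDerivAt y (y' t) t) ∧
      ∀ t, slopeRate p (y t) * y' t = b - ((p - 1) * betaq p q + (p - 2)) -
        betaq p q ^ (1 - p) * ω t ^ (q + 1 - p) - slopeDrift p (betaq p q) (y t) := by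
  have hβω : ∀ t, 0 < betaq p q * ω t := fun t => mul_pos h.pos (hpos t)
  have hd : ∀ t, HasDerivAt ω (betaq p q * ω t * (deriv ω t / (betaq p q * ω t))) t := fun t => by
    rw [mul_div_cancel₀ _ (hβω t).ne']
    exact hω.hasDerivAt t
  have hy : ∀ t, DifferentiableAt ℝ (fun t => deriv ω t / (betaq p q * ω t)) t := fun t =>
    (hω.hasDerivAt_deriv h (hω.sq_pos h ⟨0, (hpos 0).ne'⟩ t)).differentiableAt.div
      ((hω.hasDerivAt t).differentiableAt.const_mul _) (hβω t).ne'
  refine ⟨_, _, hd, fun t => (hy t).hasDerivAt, fun t => ?_⟩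
  have h1 := hω.equation t
  rw [equation_of_slope h hpos hd (hy t).hasDerivAt, mul_eq_zero] at h1
  rcases h1 with h1 | h1
  · exact absurd h1 (Real.rpow_pos_of_pos (hβω t) _).ne'
  · linarith

/-- There are no positive solutions at or below the critical value. -/
theorem positiveSolutions_eq_empty (h : Exponents p q (betaq p q))
    (hb : b ≤ (p - 1) * betaq p q + (p - 2)) :
    positiveSolutions p q (b * betaq p q ^ (p - 1)) = ∅ := by
  rw [eq_empty_iff_forall_notMem]
  rintro ω ⟨hω, hpos⟩
  obtain ⟨y, y', hd, hy, hode⟩ := hω.exists_slope h hpos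
  have hπ := Real.pi_pos
  obtain ⟨t₀, -, hmin⟩ := (isCompact_Icc (a := (0 : ℝ)) (b := 2 * Real.pi)).exists_isMinOn
    (nonempty_Icc.mpr (by positivity)) hω.continuous.continuousOn
  have hmin' : ∀ t, ω t₀ ≤ ω t := fun t => by
    obtain ⟨s, hs, hst⟩ := hω.periodic.exists_mem_Ico₀ (by positivity) t
    rw [hst]
    exact hmin ⟨hs.1, hs.2.le⟩
  have hy0 : y t₀ = 0 := by
    have h1 : HasDerivAt ω (betaq p q * ω t₀ * y t₀) t₀ := hd t₀
    have h2 := (isMinOn_univ_iff.mpr hmin').isLocalMin univ_mem |>.hasDerivAt_eq_zero h1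
    exact (mul_eq_zero.mp h2).resolve_left (mul_pos h.pos (hpos t₀)).ne'
  have hy' : y' t₀ < 0 := by
    have h1 := hode t₀
    rw [hy0, slopeRate_zero, slopeDrift_zero] at h1
    have h2 : 0 < betaq p q ^ (1 - p) * ω t₀ ^ (q + 1 - p) :=
      mul_pos (Real.rpow_pos_of_pos h.pos _) (Real.rpow_pos_of_pos (hpos t₀) _)
    linarith
  -- At the minimum y vanishes with negative derivative, so just afterwards y < 0 and ω falls below
  -- its minimum.
  have hev : ∀ᶠ t in 𝓝[>] t₀, y t < 0 := by
    have h1 := (hasDerivAt_iff_tendsto_slope.mp (hy t₀)).eventually_lt_const hy'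
    have h2 := nhdsWithin_mono t₀ (fun t (ht : t₀ < t) => ht.ne') h1
    filter_upwards [h2, self_mem_nhdsWithin] with t ht1 ht2
    rw [slope_def_field, hy0, sub_zero] at ht1
    by_contra hcon
    exact absurd ht1 (not_lt.mpr (div_nonneg (not_lt.mp hcon) (sub_pos.mpr ht2).le))
  obtain ⟨u, hu, hneg⟩ := (mem_nhdsGT_iff_exists_Ioo_subset).mp hev
  have hu : t₀ < u := hu
  have hanti : StrictAntiOn ω (Icc t₀ ((t₀ + u) / 2)) := by
    refine strictAntiOn_of_deriv_neg (convex_Icc _ _) hω.continuous.continuousOn fun t ht => ?_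
    rw [interior_Icc] at ht
    rw [(hd t).deriv]
    exact mul_neg_of_pos_of_neg (mul_pos h.pos (hpos t))
      (hneg ⟨ht.1, by linarith [ht.2]⟩)
  have := hanti ⟨le_rfl, by linarith⟩ ⟨by linarith, le_rfl⟩ (by linarith : t₀ < (t₀ + u) / 2)
  exact absurd this (not_lt.mpr (hmin' _))

theorem const_mem_positiveSolutions (h : Exponents p q (betaq p q))
    (hb : (p - 1) * betaq p q + (p - 2) < b) :
    (fun _ : ℝ => (b * betaq p q ^ (p - 1) - cq p q) ^ (1 / (q + 1 - p))) ∈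
      positiveSolutions p q (b * betaq p q ^ (p - 1)) := by
  have hr := h.r_pos
  have hB : 0 < betaq p q ^ (p - 1) := Real.rpow_pos_of_pos h.pos _
  have e : b * betaq p q ^ (p - 1) - cq p q =
      (b - ((p - 1) * betaq p q + (p - 2))) * betaq p q ^ (p - 1) := by
    rw [cq_eq h]
    ring
  have hpos : 0 < b * betaq p q ^ (p - 1) - cq p q := by
    rw [e]
    exact mul_pos (by linarith) hB
  have hκ : 0 < (b * betaq p q ^ (p - 1) - cq p q) ^ (1 / (q + 1 - p)) :=
    Real.rpow_pos_of_pos hpos _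
  refine ⟨isPeriodicSolution_of_slope h (fun _ => hκ) (y := fun _ => 0) (y' := fun _ => 0)
    (fun t => ?_) (fun t => hasDerivAt_const _ _) (fun t => ?_) fun t => rfl, fun _ => hκ⟩
  · rw [mul_zero]
    exact hasDerivAt_const _ _
  · rw [← Real.rpow_mul hpos.le, one_div_mul_cancel hr.ne', Real.rpow_one, slopeDrift_zero, e,
      show 1 - p = -(p - 1) by ring, Real.rpow_neg h.pos.le]
    have := hB.ne'
    field_simp
    ring

theorem eq_const_of_slope_eq_zero (h : Exponents p q (betaq p q)) (hpos : ∀ t, 0 < ω t)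
    {y' : ℝ → ℝ}
    (hy : ∀ t, HasDerivAt y (y' t) t)
    (hode : ∀ t, slopeRate p (y t) * y' t = b - ((p - 1) * betaq p q + (p - 2)) -
      betaq p q ^ (1 - p) * ω t ^ (q + 1 - p) - slopeDrift p (betaq p q) (y t))
    (hy0 : ∀ t, y t = 0) :
    ω = fun _ => (b * betaq p q ^ (p - 1) - cq p q) ^ (1 / (q + 1 - p)) := by
  funext t
  have hr := h.r_pos
  have hB : 0 < betaq p q ^ (p - 1) := Real.rpow_pos_of_pos h.pos _
  have hy't : y' t = 0 := by
    have := hy t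
    rw [show y = fun _ => 0 from funext hy0] at this
    exact this.unique (hasDerivAt_const t 0)
  have h1 := hode t
  rw [hy't, hy0, slopeDrift_zero, mul_zero, sub_zero, show 1 - p = -(p - 1) by ring,
    Real.rpow_neg h.pos.le] at h1
  have h2 : b * betaq p q ^ (p - 1) - cq p q = ω t ^ (q + 1 - p) := by
    rw [cq_eq h]
    have := hB.ne'
    field_simp at h1
    linarith
  rw [h2, ← Real.rpow_mul (hpos t).le, mul_one_div_cancel hr.ne', Real.rpow_one]

end positive

/-! ### Rigidity of positive solutions when p e ≤ 1 -/

section rigidity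
variable {p β e Γ : ℝ}

/-- The integrand of `slopeKernel`. -/
def slopeKernelRate (p β y : ℝ) : ℝ :=
  slopeFlux p y * ((p - 1) * β * p * y * (1 + y ^ 2) ^ ((p - 2) / 2) +
    (p - 2) ^ 2 * y * (1 + y ^ 2) ^ ((p - 4) / 2)) - p * y * slopeFlux p y * slopeRate p y

/-- The auxiliary function that makes the comparison function of the rigidity argument monotone. -/
def slopeKernel (p β y : ℝ) : ℝ := ∫ u in (0 : ℝ)..y, slopeKernelRate p β u

/-- The quantity whose positivity excludes positive arcs of the slope of length at most `π`. -/
def slopeDefect (p β e Γ y : ℝ) : ℝ :=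
  slopeFlux p y * ((1 + y ^ 2) ^ ((p - 2) / 2) - p * e + p * slopeDrift p β y)
    - Γ * slopeKernel p β y - Γ ^ 2 / 4 * (y * slopeFlux p y ^ 2)

theorem continuous_one_add_sq_rpow (m : ℝ) : Continuous fun y : ℝ => (1 + y ^ 2) ^ m :=
  Continuous.rpow_const (by fun_prop) fun y => Or.inl (one_add_sq_pos y).ne'

theorem hasDerivAt_slopeKernel (y : ℝ) :
    HasDerivAt (slopeKernel p β) (slopeKernelRate p β y) y := by
  have h1 := continuous_one_add_sq_rpow ((p - 2) / 2)
  have h2 := continuous_one_add_sq_rpow ((p - 4) / 2)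
  have hc : Continuous (slopeKernelRate p β) := by
    unfold slopeKernelRate slopeFlux slopeRate
    fun_prop
  exact intervalIntegral.integral_hasDerivAt_right (hc.intervalIntegrable _ _)
    (hc.stronglyMeasurableAtFilter _ _) hc.continuousAt

theorem slopeKernel_zero : slopeKernel p β 0 = 0 := by simp [slopeKernel]

theorem slopeDefect_zero : slopeDefect p β e Γ 0 = 0 := by
  simp [slopeDefect, slopeFlux_zero, slopeKernel_zero]

theorem slopeDrift_pos (hp : 1 < p) (hβ : 0 < β) {y : ℝ} (hy : y ≠ 0) :
    0 < slopeDrift p β y := by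
  have hs : 1 < 1 + y ^ 2 := by
    have : 0 < y ^ 2 := by positivity
    linarith
  have h1 : 1 < (1 + y ^ 2) ^ (p / 2) := Real.one_lt_rpow hs (by linarith)
  have h2 : 0 < (p - 1) * β * ((1 + y ^ 2) ^ (p / 2) - 1) :=
    mul_pos (mul_pos (by linarith) hβ) (by linarith)
  have h3 := mul_one_add_sq_rpow_sub_one_nonneg p y
  unfold slopeDrift
  linarith

theorem slopeFlux_pos {y : ℝ} (hy : 0 < y) : 0 < slopeFlux p y :=
  mul_pos hy (Real.rpow_pos_of_pos (one_add_sq_pos y) _)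

/-- For p ≥ 2 the factor (1 + y²)^((p-2)/2) is at least 1 ≥ p e and the drift is positive, so no
weight is needed. -/
theorem slopeDefect_pos_of_two_le (hp : 2 ≤ p) (hβ : 0 < β) (he : p * e ≤ 1) {y : ℝ} (hy : 0 < y) :
    0 < slopeDefect p β e 0 y := by
  have h1 : 1 ≤ (1 + y ^ 2) ^ ((p - 2) / 2) :=
    Real.one_le_rpow (by linarith [sq_nonneg y]) (by linarith)
  have h2 := slopeDrift_pos (p := p) (by linarith) hβ hy.ne'
  have h3 := mul_pos (slopeFlux_pos (p := p) hy)
    (by nlinarith : 0 < (1 + y ^ 2) ^ ((p - 2) / 2) - p * e + p * slopeDrift p β y)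
  unfold slopeDefect
  linarith

/-- For p < 2 the factor (1 + y²)^((p-2)/2) drops below 1, and the terms with Γ compensate. With Γ =
2(p-1) the defect, zero at y = 0, has positive derivative for y > 0. -/
theorem slopeDefect_pos_of_lt_two (hp : 1 < p) (hp2 : p < 2) (hβ : 0 < β) (he : p * e ≤ 1) {y : ℝ}
    (hy : 0 < y) : 0 < slopeDefect p β e (2 * (p - 1)) y := by
  -- Work at the extreme value e = 1/p; for smaller e the defect only increases, since the flux is
  -- positive.
  have hd : ∀ y, HasDerivAt (slopeDefect p β (1 / p) (2 * (p - 1)))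
      (slopeRate p y * ((1 + y ^ 2) ^ ((p - 2) / 2) - p * (1 / p) + p * slopeDrift p β y) +
        slopeFlux p y * ((p - 2) * y * (1 + y ^ 2) ^ ((p - 4) / 2) +
          p * ((p - 1) * β * p * y * (1 + y ^ 2) ^ ((p - 2) / 2) +
            (p - 2) ^ 2 * y * (1 + y ^ 2) ^ ((p - 4) / 2))) -
        2 * (p - 1) * slopeKernelRate p β y - (2 * (p - 1)) ^ 2 / 4 *
          (slopeFlux p y ^ 2 + 2 * y * slopeFlux p y * slopeRate p y)) y := by
    intro y
    have hS := hasDerivAt_one_add_sq_rpow ((p - 2) / 2) y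
    have hF := hasDerivAt_slopeFlux (p := p) y
    refine (((hF.mul ((hS.sub_const (p * (1 / p))).add
      ((hasDerivAt_slopeDrift (p := p) (β := β) y).const_mul p))).sub
      ((hasDerivAt_slopeKernel y).const_mul (2 * (p - 1)))).sub
      (((hasDerivAt_id y).mul (hF.pow 2)).const_mul ((2 * (p - 1)) ^ 2 / 4))).congr_deriv ?_
    rw [show (p - 2) / 2 - 1 = (p - 4) / 2 by ring]
    simp only [id, Pi.pow_apply, Pi.add_apply]
    push_cast
    ring
  have hpos : ∀ y, 0 < y → 0 < deriv (slopeDefect p β (1 / p) (2 * (p - 1))) y := by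
    intro y hy
    rw [(hd y).deriv]
    have hs := one_add_sq_pos y
    have hS : (1 + y ^ 2) ^ ((p - 2) / 2) = (1 + y ^ 2) ^ ((p - 4) / 2) * (1 + y ^ 2) := by
      rw [← Real.rpow_add_one hs.ne']; congr 1; ring
    have hx : 0 < y ^ 2 := by positivity
    have hB : 1 ≤ (1 + y ^ 2) ^ (p / 2) := Real.one_le_rpow (by linarith) (by linarith)
    have hT : 0 < (1 + y ^ 2) ^ ((p - 4) / 2) := Real.rpow_pos_of_pos hs _
    -- Bernoulli's inequality for the exponent (2-p)/2, which lies between 0 and 1; it measures how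
    -- far S can fall below 1.
    have hbern : 1 ≤ (1 + y ^ 2) ^ ((p - 2) / 2) * (1 + (2 - p) / 2 * y ^ 2) := by
      have h1 := rpow_one_add_le_one_add_mul_self (s := y ^ 2) (by linarith)
        (by linarith : 0 ≤ (2 - p) / 2) (by linarith)
      rw [show (p - 2) / 2 = -((2 - p) / 2) by ring, Real.rpow_neg hs.le, ← div_eq_inv_mul,
        le_div_iff₀ (Real.rpow_pos_of_pos hs _), one_mul]
      exact h1
    have hp1 : p * (1 / p) = 1 := mul_one_div_cancel (by linarith)
    rw [slopeKernelRate, slopeFlux, slopeRate, slopeDrift, hp1]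
    generalize hTdef : (1 + y ^ 2) ^ ((p - 4) / 2) = T at *
    generalize (1 + y ^ 2) ^ (p / 2) = B at *
    generalize hSdef : (1 + y ^ 2) ^ ((p - 2) / 2) = S at *
    have hSpos : 0 < S := by rw [hS]; positivity
    have hδ : 0 < p - 1 := by linarith
    have h2p : 0 < 2 - p := by linarith
    have k1 : 0 ≤ T * (1 + (p - 1) * y ^ 2) * (p * ((p - 1) * β * (B - 1))) := by
      have : 0 ≤ B - 1 := by linarith
      positivity
    have k2 : 0 < (2 - p) * ((p - 1) * β * p * y ^ 2 * S ^ 2) := by positivity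
    have k3 : 0 ≤ (p - 1) ^ 2 * (T * (1 + (p - 1) * y ^ 2)) *
        (S * (1 + (2 - p) / 2 * y ^ 2) - 1) := by
      have : 0 ≤ S * (1 + (2 - p) / 2 * y ^ 2) - 1 := by linarith
      positivity
    have k4 : 0 ≤ (p - 1) ^ 2 * (y ^ 2 * S * T) *
        ((2 - (p - 1) + y ^ 2) - (1 + (p - 1) * y ^ 2) * ((2 - p) / 2)) := by
      have : 0 ≤ (2 - (p - 1) + y ^ 2) - (1 + (p - 1) * y ^ 2) * ((2 - p) / 2) := by
        have h3 : (p - 1) * ((2 - p) / 2) ≤ 1 := by nlinarith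
        nlinarith
      positivity
    -- The derivative is exactly the sum of the four products above; the second one, carrying the
    -- factor β, supplies strictness.
    refine lt_of_lt_of_eq (add_pos_of_nonneg_of_pos (add_nonneg (add_nonneg k1 k3) k4) k2) ?_
    rw [hS]
    ring
  have hmono : StrictMonoOn (slopeDefect p β (1 / p) (2 * (p - 1))) (Ici 0) := by
    refine strictMonoOn_of_deriv_pos (convex_Ici 0)
      (fun y _ => (hd y).continuousAt.continuousWithinAt) fun y hy => ?_
    rw [interior_Ici] at hy
    exact hpos y hy
  have h1 := hmono (mem_Ici.mpr le_rfl) (mem_Ici.mpr hy.le) hy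
  rw [slopeDefect_zero] at h1
  have h2 := mul_nonneg (slopeFlux_pos (p := p) hy).le (by linarith : 0 ≤ 1 - p * e)
  have hp1 : p * (1 / p) = 1 := mul_one_div_cancel (by linarith)
  unfold slopeDefect at h1 ⊢
  rw [hp1] at h1
  linarith

theorem exists_slopeDefect_pos (hp : 1 < p) (hβ : 0 < β) (he : p * e ≤ 1) :
    ∃ Γ, ∀ y, 0 < y → 0 < slopeDefect p β e Γ y := by
  rcases le_or_gt 2 p with h | h
  · exact ⟨0, fun y hy => slopeDefect_pos_of_two_le h hβ he hy⟩
  · exact ⟨_, fun y hy => slopeDefect_pos_of_lt_two hp h hβ he hy⟩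

/-- The slope has no positive arcs of length at most `π`. -/
theorem not_positive_arc (hp : 1 < p)
    (hR : ∀ y, 0 < y → 0 < slopeDefect p β e Γ y) {y y' v : ℝ → ℝ} (hv : ∀ t, 0 < v t)
    (hdv : ∀ t, HasDerivAt v (p * y t * v t) t) (hdy : ∀ t, HasDerivAt y (y' t) t)
    (hode : ∀ t, slopeRate p (y t) * y' t = e - v t - slopeDrift p β (y t)) {a b : ℝ} (hab : a < b)
    (hbπ : b ≤ a + Real.pi) (ha : y a = 0) (hb : y b = 0) : ¬ ∀ t ∈ Ioo a b, 0 < y t := by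
  intro hpos
  -- The exponent is chosen so that V' = -(Γ/2) y V, which puts the free parameter Γ at disposal.
  set V : ℝ → ℝ := fun t => v t ^ (-Γ / (2 * p)) with hV
  have hVpos : ∀ t, 0 < V t := fun t => Real.rpow_pos_of_pos (hv t) _
  have hdV : ∀ t, HasDerivAt V (-(Γ / 2) * y t * V t) t := by
    intro t
    refine ((hdv t).rpow_const (p := -Γ / (2 * p)) (Or.inl (hv t).ne')).congr_deriv ?_
    rw [Real.rpow_sub_one (hv t).ne']
    have h1 := (hv t).ne'
    have h2 : p ≠ 0 := by linarith
    change _ = -(Γ / 2) * y t * v t ^ (-Γ / (2 * p))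
    generalize v t ^ (-Γ / (2 * p)) = P
    field_simp
  have hdF : ∀ t, HasDerivAt (fun t => slopeFlux p (y t)) (slopeRate p (y t) * y' t) t :=
    fun t => (hasDerivAt_slopeFlux (y t)).comp t (hdy t)
  have hdη := fun t => (hasDerivAt_slopeDrift (p := p) (β := β) (y t)).comp t (hdy t)
  have hdK := fun t => (hasDerivAt_slopeKernel (p := p) (β := β) (y t)).comp t (hdy t)
  set X : ℝ → ℝ := fun t => V t * slopeFlux p (y t) with hX
  have hdX : ∀ t, HasDerivAt X (-(Γ / 2) * y t * V t * slopeFlux p (y t) +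
      V t * (slopeRate p (y t) * y' t)) t := fun t => (hdV t).mul (hdF t)
  have hds : ∀ t, HasDerivAt (fun t => Real.sin (t - a)) (Real.cos (t - a)) t := fun t => by
    simpa using ((hasDerivAt_id t).sub_const a).sin
  have hdc : ∀ t, HasDerivAt (fun t => Real.cos (t - a)) (-Real.sin (t - a)) t := fun t => by
    simpa using ((hasDerivAt_id t).sub_const a).cos
  set Z : ℝ → ℝ := fun t => e - v t - slopeDrift p β (y t) with hZ
  have hdZ := fun t => ((hdv t).const_sub e).sub (hdη t)
  -- A Picone-type function: the flux F is compared with sin(t - a), whose first positive half wave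
  -- has length π. As Z = F(y)', the part F Z differentiates to Z² plus terms linear in y', and
  -- `slopeKernel` is the primitive that removes the latter.
  set Φ : ℝ → ℝ := fun t => V t ^ 2 * (slopeFlux p (y t) * Z t + slopeKernel p β (y t)) -
    X t ^ 2 / Real.sin (t - a) * Real.cos (t - a) with hΦ
  have hd1 := fun t => ((hdV t).pow 2).mul (((hdF t).mul (hdZ t)).add (hdK t))
  have hXzero : ∀ t, y t = 0 → X t = 0 := fun t ht => by simp [hX, ht, slopeFlux_zero]
  have hzero : ∀ t, y t = 0 → Φ t = 0 := fun t ht => by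
    simp [hΦ, hXzero t ht, ht, slopeFlux_zero, slopeKernel_zero]
  have hsin : ∀ t ∈ Ioo a b, 0 < Real.sin (t - a) := fun t ht =>
    Real.sin_pos_of_pos_of_lt_pi (by linarith [ht.1]) (by linarith [ht.2])
  have hcont : ContinuousOn Φ (Icc a b) := by
    intro t ht
    refine ContinuousAt.continuousWithinAt ((hd1 t).continuousAt.sub
      (ContinuousAt.mul ?_ (hdc t).continuousAt))
    -- The sine can vanish only at an end of the arc, at a and, for length π, at b. There X vanishes
    -- too and the quotient extends continuously.
    by_cases hst : Real.sin (t - a) = 0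
    · refine continuousAt_sq_div_of_zero (hdX t) (hds t) (hXzero t ?_) hst ?_
      · rcases ht.1.eq_or_lt with h1 | h1
        · rw [← h1, ha]
        · rcases ht.2.eq_or_lt with h2 | h2
          · rw [h2, hb]
          · exact absurd hst (hsin t ⟨h1, h2⟩).ne'
      · intro hcos
        have := Real.sin_sq_add_cos_sq (t - a)
        rw [hst, hcos] at this
        norm_num at this
    · exact ((hdX t).continuousAt.pow 2).div (hds t).continuousAt hst
  have hderiv : ∀ t ∈ Ioo a b, 0 < deriv Φ t := by
    intro t ht
    have hst := (hsin t ht).ne'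
    have hD := (hd1 t).sub ((((hdX t).pow 2).div (hds t) hst).mul (hdc t))
    -- The derivative is a completed square plus V² y times the defect, hence positive along the
    -- arc.
    have hΦd : HasDerivAt Φ ((-(Γ / 2) * y t * V t * slopeFlux p (y t) +
      V t * (slopeRate p (y t) * y' t) - X t * Real.cos (t - a) / Real.sin (t - a)) ^ 2 +
      V t ^ 2 * (y t * slopeDefect p β e Γ (y t))) t := by
      refine hD.congr_deriv ?_
      have hvt : v t = e - slopeDrift p β (y t) - slopeRate p (y t) * y' t := by linarith [hode t]
      simp only [hX, Function.comp, Pi.pow_apply, Pi.mul_apply, Pi.add_apply, Pi.sub_apply,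
        Pi.div_apply]
      rw [hvt, slopeDefect, slopeKernelRate]
      have hF : slopeFlux p (y t) = y t * (1 + y t ^ 2) ^ ((p - 2) / 2) := rfl
      generalize slopeDrift p β (y t) = η
      generalize slopeRate p (y t) = d
      generalize slopeKernel p β (y t) = K
      generalize slopeFlux p (y t) = F at *
      generalize (1 + y t ^ 2) ^ ((p - 2) / 2) = S at *
      generalize (1 + y t ^ 2) ^ ((p - 4) / 2) = T at *
      subst hF
      push_cast
      field_simp
      ring
    rw [hΦd.deriv]
    have h1 := hR (y t) (hpos t ht)
    have h2 := hpos t ht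
    have h3 := hVpos t
    positivity
  have hmono := strictMonoOn_of_deriv_pos (convex_Icc a b) hcont fun t ht => by
    rw [interior_Icc] at ht
    exact hderiv t ht
  have := hmono ⟨le_rfl, hab.le⟩ ⟨hab.le, le_rfl⟩ hab
  rw [hzero a ha, hzero b hb] at this
  exact lt_irrefl 0 this

end rigidity

/-- A continuous function that vanishes at both ends of an interval and not at a given interior
point has a nonzero arc around that point. -/
theorem exists_arc {y : ℝ → ℝ} (hc : Continuous y) {a₀ b₀ t₁ : ℝ} (ht₁ : t₁ ∈ Ioo a₀ b₀)
    (ha : y a₀ = 0) (hb : y b₀ = 0) (hy : y t₁ ≠ 0) :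
    ∃ a b, a₀ ≤ a ∧ a < b ∧ b ≤ b₀ ∧ y a = 0 ∧ y b = 0 ∧
      ((∀ t ∈ Ioo a b, 0 < y t) ∨ ∀ t ∈ Ioo a b, y t < 0) := by
  have hclosed : IsClosed {t | y t = 0} := isClosed_eq hc continuous_const
  obtain ⟨a, ⟨⟨ha1, ha2⟩, ha3⟩, hamax⟩ := ((isCompact_Icc (a := a₀) (b := t₁)).inter_right
    hclosed).exists_isGreatest ⟨a₀, ⟨le_rfl, ht₁.1.le⟩, ha⟩
  obtain ⟨b, ⟨⟨hb1, hb2⟩, hb3⟩, hbmin⟩ := ((isCompact_Icc (a := t₁) (b := b₀)).inter_right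
    hclosed).exists_isLeast ⟨b₀, ⟨ht₁.2.le, le_rfl⟩, hb⟩
  have ha3 : y a = 0 := ha3
  have hb3 : y b = 0 := hb3
  have hat : a < t₁ := lt_of_le_of_ne ha2 (by rintro rfl; exact hy ha3)
  have htb : t₁ < b := lt_of_le_of_ne hb1 (by rintro rfl; exact hy hb3)
  have hne : ∀ t ∈ Ioo a b, y t ≠ 0 := by
    intro t ht h0
    rcases le_total t t₁ with h1 | h1
    · exact absurd (hamax ⟨⟨ha1.trans ht.1.le, h1⟩, h0⟩) (not_le.mpr ht.1)
    · exact absurd (hbmin ⟨⟨h1, ht.2.le.trans hb2⟩, h0⟩) (not_le.mpr ht.2)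
  refine ⟨a, b, ha1, hat.trans htb, hb2, ha3, hb3, ?_⟩
  have hnz : ∀ t ∈ Ioo a b, (0 : ℝ) ∉ y '' uIcc t₁ t := by
    rintro t ht ⟨s, hs, hs0⟩
    exact hne s (ordConnected_Ioo.uIcc_subset ⟨hat, htb⟩ ht hs) hs0
  rcases lt_or_gt_of_ne hy with h1 | h1
  · right
    intro t ht
    by_contra hcon
    exact hnz t ht (intermediate_value_uIcc hc.continuousOn
      (mem_uIcc.mpr (Or.inl ⟨h1.le, not_lt.mp hcon⟩)))
  · left
    intro t ht
    by_contra hcon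
    exact hnz t ht (intermediate_value_uIcc hc.continuousOn
      (mem_uIcc.mpr (Or.inr ⟨not_lt.mp hcon, h1.le⟩)))

/-- If `p e ≤ 1`, then the slope of a periodic trajectory vanishes. -/
theorem slope_eq_zero_of_periodic {p β e : ℝ} (hp : 1 < p) (hβ : 0 < β) (he : p * e ≤ 1)
    {y y' v : ℝ → ℝ} (hv : ∀ t, 0 < v t) (hdv : ∀ t, HasDerivAt v (p * y t * v t) t)
    (hdy : ∀ t, HasDerivAt y (y' t) t)
    (hode : ∀ t, slopeRate p (y t) * y' t = e - v t - slopeDrift p β (y t))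
    (hper : Function.Periodic v (2 * Real.pi)) (t : ℝ) : y t = 0 := by
  have hπ := Real.pi_pos
  have hp0 : p ≠ 0 := by linarith
  obtain ⟨Γ, hR⟩ := exists_slopeDefect_pos hp hβ he
  have hcv : Continuous v := continuous_iff_continuousAt.mpr fun t => (hdv t).continuousAt
  have hcy : Continuous y := continuous_iff_continuousAt.mpr fun t => (hdy t).continuousAt
  -- If v differed at two nearby zeros of y, then y would be nonzero between them by the mean value
  -- theorem, and an arc of constant sign of length at most π would exist.
  have hfinite : ∀ a₀ b₀, a₀ < b₀ → b₀ ≤ a₀ + Real.pi → y a₀ = 0 → y b₀ = 0 → v a₀ = v b₀ := by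
    intro a₀ b₀ hab hle ha hb
    by_contra hne
    obtain ⟨t₁, ht₁, hslope⟩ := exists_hasDerivAt_eq_slope v (fun t => p * y t * v t) hab
      hcv.continuousOn fun t _ => hdv t
    have hy1 : y t₁ ≠ 0 := by
      intro h0
      rw [h0, mul_zero, zero_mul, eq_comm, div_eq_zero_iff] at hslope
      rcases hslope with h1 | h1
      · exact hne (sub_eq_zero.mp h1).symm
      · linarith
    obtain ⟨a, b, h1, h2, h3, h4, h5, h6 | h6⟩ := exists_arc hcy ht₁ ha hb hy1
    · exact not_positive_arc hp hR hv hdv hdy hode h2 (by linarith) h4 h5 h6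
    -- A negative arc becomes a positive one under the symmetry (y, v)(t) ↦ (-y, v)(-t).
    · refine not_positive_arc (y := fun t => -y (-t)) (y' := fun t => y' (-t))
        (v := fun t => v (-t)) (a := -b) (b := -a) hp hR (fun t => hv (-t)) (fun t => ?_)
        (fun t => ?_) (fun t => ?_) (by linarith) (by linarith) (by simp [h5]) (by simp [h4])
        fun t ht => ?_
      · refine ((hdv (-t)).scomp t (hasDerivAt_neg t)).congr_deriv ?_
        simp only [smul_eq_mul]
        ring
      · refine ((hdy (-t)).scomp t (hasDerivAt_neg t)).neg.congr_deriv ?_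
        simp only [smul_eq_mul]
        ring
      · rw [slopeRate_neg, slopeDrift_neg]
        exact hode (-t)
      · have := h6 (-t) ⟨by linarith [ht.2], by linarith [ht.1]⟩
        linarith
  have hcrit : ∀ s, (∀ u, v u ≤ v s) ∨ (∀ u, v s ≤ v u) → y s = 0 := by
    intro s hs
    have h0 : p * y s * v s = 0 := by
      rcases hs with hs | hs
      · exact ((isMaxOn_univ_iff.mpr hs).isLocalMax univ_mem).hasDerivAt_eq_zero (hdv s)
      · exact ((isMinOn_univ_iff.mpr hs).isLocalMin univ_mem).hasDerivAt_eq_zero (hdv s)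
    have := (mul_eq_zero.mp h0).resolve_right (hv s).ne'
    exact (mul_eq_zero.mp this).resolve_left hp0
  obtain ⟨M, -, hM⟩ := (isCompact_Icc (a := (0 : ℝ)) (b := 2 * Real.pi)).exists_isMaxOn
    (nonempty_Icc.mpr (by positivity)) hcv.continuousOn
  have hM' : ∀ u, v u ≤ v M := fun u => by
    obtain ⟨s, hs, hst⟩ := hper.exists_mem_Ico₀ (by positivity) u
    rw [hst]
    exact hM ⟨hs.1, hs.2.le⟩
  obtain ⟨m, hm, hmin⟩ := (isCompact_Icc (a := M) (b := M + 2 * Real.pi)).exists_isMinOn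
    (nonempty_Icc.mpr (by linarith)) hcv.continuousOn
  have hm' : ∀ u, v m ≤ v u := fun u => by
    obtain ⟨s, hs, hst⟩ := hper.exists_mem_Ico (by positivity) u M
    rw [hst]
    exact hmin ⟨hs.1, hs.2.le⟩
  have hyM := hcrit M (Or.inl hM')
  have hym := hcrit m (Or.inr hm')
  have hyM2 : y (M + 2 * Real.pi) = 0 := hcrit _ (Or.inl fun u => by rw [hper]; exact hM' u)
  -- The minimum m lies within π of the maximum at M or of its translate at M + 2π, so one of the
  -- two intervals is short enough.
  have heq : v m = v M := by
    rcases le_total m (M + Real.pi) with h1 | h1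
    · rcases hm.1.eq_or_lt with h2 | h2
      · rw [← h2]
      · exact (hfinite M m h2 h1 hyM hym).symm
    · rcases hm.2.eq_or_lt with h2 | h2
      · rw [h2, hper]
      · rw [hfinite m _ h2 (by linarith) hym hyM2, hper]
  exact hcrit t (Or.inl fun u => by linarith [hM' u, hm' t])

theorem positiveSolutions_eq_singleton {p q b : ℝ} (h : Exponents p q (betaq p q))
    (hb : (p - 1) * betaq p q + (p - 2) < b)
    (hb' : p * (b - ((p - 1) * betaq p q + (p - 2))) ≤ 1) :
    positiveSolutions p q (b * betaq p q ^ (p - 1)) =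
      {fun _ : ℝ => (b * betaq p q ^ (p - 1) - cq p q) ^ (1 / (q + 1 - p))} := by
  refine Subset.antisymm ?_ (singleton_subset_iff.mpr (const_mem_positiveSolutions h hb))
  rintro ω ⟨hω, hpos⟩
  obtain ⟨y, y', hd, hy, hode⟩ := hω.exists_slope h hpos
  have hB : 0 < betaq p q ^ (1 - p) := Real.rpow_pos_of_pos h.pos _
  refine eq_const_of_slope_eq_zero h hpos hy hode fun t =>
    slope_eq_zero_of_periodic h.one_lt h.pos hb'
      (v := fun t => betaq p q ^ (1 - p) * ω t ^ (q + 1 - p))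
      (fun t => mul_pos hB (Real.rpow_pos_of_pos (hpos t) _)) (fun t => ?_) hy hode
      (fun t => by simp only [hω.periodic t]) t
  refine (((hd t).rpow_const (p := q + 1 - p) (Or.inl (hpos t).ne')).const_mul _).congr_deriv ?_
  rw [Real.rpow_sub_one (hpos t).ne']
  have h1 := (hpos t).ne'
  have h2 := h.rel
  generalize betaq p q ^ (1 - p) = B
  generalize ω t ^ (q + 1 - p) = w
  field_simp
  linear_combination B * w * y t * h2

/-! ### The truncated slope system -/

/-- The field of the autonomous system for the logarithmic slope and the rescaled power of a
positive solution. -/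
def slopeField (p β e : ℝ) (z : ℝ × ℝ) : ℝ × ℝ :=
  ((e * (1 - z.2) - slopeDrift p β z.1) / slopeRate p z.1, p * z.1 * z.2)

/-- Projection of the plane to a rectangle. -/
def clampPair (Y N : ℝ) (z : ℝ × ℝ) : ℝ × ℝ := (max (-Y) (min z.1 Y), max 0 (min z.2 N))

/-- Trajectories of the field composed with the projection to a rectangle. -/
def IsSlopeTrajectory (p β e Y N : ℝ) (z : ℝ → ℝ × ℝ) : Prop :=
  ∀ t, HasDerivAt z (slopeField p β e (clampPair Y N (z t))) t

section flow
variable {p β e Y N : ℝ}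

theorem contDiff_one_add_sq_rpow (m : ℝ) : ContDiff ℝ 1 fun y : ℝ => (1 + y ^ 2) ^ m :=
  ContDiff.rpow_const_of_ne (by fun_prop) fun y => (one_add_sq_pos y).ne'

theorem contDiff_slopeField (hp : 1 < p) : ContDiff ℝ 1 (slopeField p β e) := by
  have h1 : ContDiff ℝ 1 (slopeDrift p β) := by
    have h1 := contDiff_one_add_sq_rpow (p / 2)
    have h2 := contDiff_one_add_sq_rpow ((p - 2) / 2)
    unfold slopeDrift
    fun_prop
  have h2 : ContDiff ℝ 1 (slopeRate p) := by
    have h1 := contDiff_one_add_sq_rpow ((p - 4) / 2)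
    unfold slopeRate
    fun_prop
  have h3 : ContDiff ℝ 1 fun z : ℝ × ℝ => slopeDrift p β z.1 := h1.comp contDiff_fst
  have h4 : ContDiff ℝ 1 fun z : ℝ × ℝ => slopeRate p z.1 := h2.comp contDiff_fst
  exact ((by fun_prop : ContDiff ℝ 1 fun z : ℝ × ℝ => e * (1 - z.2) - slopeDrift p β z.1).div h4
    fun z => (slopeRate_pos hp z.1).ne').prodMk (by fun_prop)

theorem clampPair_mem (hY : 0 ≤ Y) (hN : 0 ≤ N) (z : ℝ × ℝ) :
    clampPair Y N z ∈ Icc (-Y) Y ×ˢ Icc 0 N :=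
  ⟨⟨le_max_left _ _, max_le (by linarith) (min_le_right _ _)⟩,
    ⟨le_max_left _ _, max_le hN (min_le_right _ _)⟩⟩

theorem clampPair_of_mem {z : ℝ × ℝ} (h1 : z.1 ∈ Icc (-Y) Y) (h2 : z.2 ∈ Icc 0 N) :
    clampPair Y N z = z := by
  rw [clampPair, min_eq_left h1.2, max_eq_right h1.1, min_eq_left h2.2, max_eq_right h2.1]

theorem clampPair_neg (hY : 0 ≤ Y) (z : ℝ × ℝ) :
    clampPair Y N (-z.1, z.2) = (-(clampPair Y N z).1, (clampPair Y N z).2) := by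
  simp only [clampPair, Prod.mk.injEq, and_true]
  rcases le_total z.1 Y with h1 | h1 <;> rcases le_total (-Y) z.1 with h2 | h2 <;>
    simp only [max_def, min_def] <;> split_ifs <;> linarith

theorem slopeField_neg (z : ℝ × ℝ) : slopeField p β e (-z.1, z.2) =
    ((slopeField p β e z).1, -(slopeField p β e z).2) := by
  simp only [slopeField, slopeDrift_neg, slopeRate_neg, Prod.mk.injEq, true_and]
  ring

theorem lipschitzWith_clampPair (Y N : ℝ) : LipschitzWith 1 (clampPair Y N) := by
  have h1 : LipschitzWith 1 fun z : ℝ × ℝ => max (-Y) (min z.1 Y) :=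
    (LipschitzWith.prod_fst.min_const Y).const_max (-Y)
  have h2 : LipschitzWith 1 fun z : ℝ × ℝ => max 0 (min z.2 N) :=
    (LipschitzWith.prod_snd.min_const N).const_max 0
  rw [← max_self (1 : NNReal)]
  exact h1.prodMk h2

theorem exists_lipschitz_bound_slopeField (hp : 1 < p) (hY : 0 ≤ Y) (hN : 0 ≤ N) :
    ∃ K L : NNReal, LipschitzWith K (fun z => slopeField p β e (clampPair Y N z)) ∧
      ∀ z, ‖slopeField p β e (clampPair Y N z)‖ ≤ L := by
  have hcd := contDiff_slopeField (β := β) (e := e) hp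
  have hcomp : IsCompact (Icc (-Y) Y ×ˢ Icc 0 N) := isCompact_Icc.prod isCompact_Icc
  obtain ⟨K, hK⟩ := hcd.contDiffOn.exists_lipschitzOnWith one_ne_zero
    ((convex_Icc (-Y) Y).prod (convex_Icc 0 N)) hcomp
  obtain ⟨L, hL⟩ := hcomp.exists_bound_of_continuousOn hcd.continuous.continuousOn
  refine ⟨K * 1, L.toNNReal, ?_, fun z => (hL _ (clampPair_mem hY hN z)).trans
    (Real.le_coe_toNNReal L)⟩
  have h1 := hK.comp ((lipschitzWith_clampPair Y N).lipschitzOnWith (s := univ))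
    fun z _ => clampPair_mem hY hN z
  exact lipschitzOnWith_univ.mp h1

namespace IsSlopeTrajectory
variable {z w : ℝ → ℝ × ℝ}

theorem fst (hz : IsSlopeTrajectory p β e Y N z) (t : ℝ) :
    HasDerivAt (fun t => (z t).1) (slopeField p β e (clampPair Y N (z t))).1 t :=
  (ContinuousLinearMap.fst ℝ ℝ ℝ).hasFDerivAt.comp_hasDerivAt t (hz t)

theorem snd (hz : IsSlopeTrajectory p β e Y N z) (t : ℝ) :
    HasDerivAt (fun t => (z t).2) (slopeField p β e (clampPair Y N (z t))).2 t :=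
  (ContinuousLinearMap.snd ℝ ℝ ℝ).hasFDerivAt.comp_hasDerivAt t (hz t)

theorem continuous (hz : IsSlopeTrajectory p β e Y N z) : Continuous z :=
  continuous_iff_continuousAt.mpr fun t => (hz t).continuousAt

theorem ext (hp : 1 < p) (hY : 0 ≤ Y) (hN : 0 ≤ N) (hz : IsSlopeTrajectory p β e Y N z)
    (hw : IsSlopeTrajectory p β e Y N w) {t₀ : ℝ} (h0 : z t₀ = w t₀) : z = w := by
  obtain ⟨K, L, hK, -⟩ := exists_lipschitz_bound_slopeField (β := β) (e := e) hp hY hN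
  exact ODE_solution_unique_univ (s := fun _ => univ)
    (v := fun _ z => slopeField p β e (clampPair Y N z)) (fun _ => hK.lipschitzOnWith)
    (fun t => ⟨hz t, mem_univ _⟩) (fun t => ⟨hw t, mem_univ _⟩) h0

/-- The system is reversible under y ↦ -y. A zero of y at time s/2 makes the reflected trajectory
equal to the original one. -/
theorem reflect (hY : 0 ≤ Y) (hz : IsSlopeTrajectory p β e Y N z) (s : ℝ) :
    IsSlopeTrajectory p β e Y N fun t => (-(z (s - t)).1, (z (s - t)).2) := by
  intro t
  have h1 : HasDerivAt (fun t => s - t) (-1) t := by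
    simpa using (hasDerivAt_id t).const_sub s
  have h2 := ((hz.fst (s - t)).scomp t h1).neg.prodMk ((hz.snd (s - t)).scomp t h1)
  refine h2.congr_deriv ?_
  rw [clampPair_neg hY, slopeField_neg]
  simp

/-- Once y reaches Y, the drift is at least e, so y' ≤ 0. This holds for the truncated field, hence
needs no a priori bound on the trajectory. -/
theorem fst_le (hp : 1 < p) (he : 0 < e) (hY : 0 ≤ Y) (hYe : e ≤ slopeDrift p β Y)
    (hz : IsSlopeTrajectory p β e Y N z) (h0 : (z 0).1 = 0) {t : ℝ} (ht : 0 ≤ t) :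
    (z t).1 ≤ Y := by
  have := le_max_add_of_deriv_le (f := fun t => (z t).1) (a := 0) (b := t) (m := Y) le_rfl
    (fun s _ => hz.fst s) (fun s _ hs => ?_) ⟨ht, le_rfl⟩
  · simpa [h0, hY] using this
  · have h1 : (clampPair Y N (z s)).1 = Y := by
      rw [clampPair, min_eq_right hs, max_eq_right (by linarith)]
    have h2 : 0 ≤ (clampPair Y N (z s)).2 := le_max_left _ _
    rw [slopeField, h1]
    refine div_nonpos_of_nonpos_of_nonneg ?_ (slopeRate_pos hp Y).le
    have := mul_nonneg he.le h2
    linarith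

end IsSlopeTrajectory

/-- As long as the slope is nonnegative the projection is inactive and the power increases. -/
theorem IsSlopeTrajectory.clampPair_eq (hp : 1 < p) (he : 0 < e) (hY : 0 ≤ Y)
    (hYe : e ≤ slopeDrift p β Y) {τ μ : ℝ} (hN : Real.exp (p * Y * τ) ≤ N)
    {z : ℝ → ℝ × ℝ} (hz : IsSlopeTrajectory p β e Y N z) (h0 : z 0 = (0, μ)) (hμ : 0 ≤ μ)
    (hμ1 : μ ≤ 1) (hnn : ∀ t ∈ Icc 0 τ, 0 ≤ (z t).1) {t : ℝ} (ht : t ∈ Icc 0 τ) :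
    clampPair Y N (z t) = z t ∧ μ ≤ (z t).2 := by
  have hN0 : 0 ≤ N := (Real.exp_pos _).le.trans hN
  have hc : ContinuousOn (fun t => (z t).2) (Icc 0 t) := hz.continuous.snd.continuousOn
  have hfst : ∀ s ∈ Icc 0 τ, (clampPair Y N (z s)).1 = (z s).1 := fun s hs => by
    have h1 := hz.fst_le hp he hY hYe (by rw [h0]) hs.1
    rw [clampPair, min_eq_left h1, max_eq_right (by linarith [hnn s hs])]
  have hmono : MonotoneOn (fun t => (z t).2) (Icc 0 t) := by
    refine monotoneOn_of_deriv_nonneg (convex_Icc 0 t) hc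
      (fun s _ => (hz.snd s).differentiableAt.differentiableWithinAt) fun s hs => ?_
    rw [interior_Icc] at hs
    have hs' : s ∈ Icc 0 τ := ⟨hs.1.le, hs.2.le.trans ht.2⟩
    rw [(hz.snd s).deriv, slopeField, hfst s hs']
    have h1 := hnn s hs'
    have h2 : 0 ≤ (clampPair Y N (z s)).2 := le_max_left _ _
    have : 0 ≤ p := by linarith
    positivity
  have hlow : μ ≤ (z t).2 := by
    have := hmono ⟨le_rfl, ht.1⟩ ⟨ht.1, le_rfl⟩ ht.1
    simpa [h0] using this
  -- The second component grows at a rate of at most p Y, so from μ ≤ 1 it stays below exp(p Y τ) ≤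
  -- N and the upper clamp is inactive.
  have hup : |(z t).2| ≤ |(z 0).2| * Real.exp (p * Y * (t - 0)) := by
    refine abs_le_of_abs_deriv_le_right ht.1 hc (fun s _ => hz.snd s) fun s hs => ?_
    have hs' : s ∈ Icc 0 τ := ⟨hs.1.le, hs.2.le.trans ht.2⟩
    have h1 := hz.fst_le hp he hY hYe (by rw [h0]) hs'.1
    have h2 : |(clampPair Y N (z s)).2| ≤ |(z s).2| := by
      simp only [clampPair]
      rcases le_total (z s).2 0 with h3 | h3
      · rw [min_eq_left (h3.trans hN0), max_eq_left h3, abs_zero]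
        exact abs_nonneg _
      · rw [max_eq_right (le_min h3 hN0), abs_of_nonneg (le_min h3 hN0), abs_of_nonneg h3]
        exact min_le_left _ _
    rw [slopeField, hfst s hs', abs_mul, abs_mul, abs_of_nonneg (hnn s hs'),
      abs_of_pos (by linarith : 0 < p)]
    have := hnn s hs'
    have : 0 ≤ p := by linarith
    gcongr
  rw [h0, abs_of_nonneg hμ, sub_zero] at hup
  have h3 : (z t).2 ≤ N := by
    refine (le_abs_self _).trans (hup.trans (le_trans ?_ hN))
    have h4 : Real.exp (p * Y * t) ≤ Real.exp (p * Y * τ) := by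
      have : 0 ≤ p := by linarith
      have := ht.2
      gcongr
    calc μ * Real.exp (p * Y * t) ≤ 1 * Real.exp (p * Y * τ) := by gcongr
      _ = _ := one_mul _
  exact ⟨clampPair_of_mem ⟨by linarith [hnn t ht], hz.fst_le hp he hY hYe (by rw [h0]) ht.1⟩
    ⟨hμ.trans hlow, h3⟩, hlow⟩

theorem exists_le_slopeDrift (hp : 1 < p) (hβ : 0 < β) (e : ℝ) :
    ∃ Y, 0 < Y ∧ e ≤ slopeDrift p β Y := by
  have h1 : 0 < (p - 1) * β := mul_pos (by linarith) hβ
  have ht : Tendsto (fun Y : ℝ => (p - 1) * β * Y - (p - 1) * β) atTop atTop :=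
    tendsto_atTop_add_const_right _ _ (tendsto_id.const_mul_atTop h1)
  obtain ⟨Y, hY1, hY2⟩ := ((eventually_ge_atTop 1).and (ht.eventually_ge_atTop e)).exists
  refine ⟨Y, by linarith, hY2.trans ?_⟩
  have hs : 1 ≤ 1 + Y ^ 2 := by linarith [sq_nonneg Y]
  have h2 : Y ≤ (1 + Y ^ 2) ^ (p / 2) := by
    have h3 : (Y ^ 2) ^ (1 / 2 : ℝ) ≤ (1 + Y ^ 2) ^ (1 / 2 : ℝ) :=
      Real.rpow_le_rpow (sq_nonneg Y) (by linarith) (by norm_num)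
    rw [← Real.sqrt_eq_rpow, Real.sqrt_sq (by linarith)] at h3
    exact h3.trans (Real.rpow_le_rpow_of_exponent_le hs (by linarith))
  have h3 := mul_one_add_sq_rpow_sub_one_nonneg p Y
  have h4 := mul_le_mul_of_nonneg_left h2 h1.le
  unfold slopeDrift
  linarith

end flow

/-! ### The shooting argument -/

/-- Admissible parameters of the shooting argument on the interval `[0, τ]`. -/
structure ShootingData (p β e Y N τ : ℝ) : Prop where
  one_lt : 1 < p
  beta_pos : 0 < β
  e_pos : 0 < e
  Y_pos : 0 < Y
  le_drift : e ≤ slopeDrift p β Y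
  exp_le : Real.exp (p * Y * τ) ≤ N
  τ_pos : 0 < τ

namespace ShootingData
variable {p β e Y N τ μ : ℝ} {z : ℝ → ℝ × ℝ}

theorem one_le (h : ShootingData p β e Y N τ) : 1 ≤ N := by
  refine le_trans (Real.one_le_exp ?_) h.exp_le
  have := h.one_lt
  have := h.Y_pos
  have := h.τ_pos
  positivity

theorem N_nonneg (h : ShootingData p β e Y N τ) : 0 ≤ N := zero_le_one.trans h.one_le

theorem exists_trajectory (h : ShootingData p β e Y N τ) (x : ℝ × ℝ) :
    ∃ z, z 0 = x ∧ IsSlopeTrajectory p β e Y N z := by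
  obtain ⟨K, L, hK, hL⟩ := exists_lipschitz_bound_slopeField (β := β) (e := e) h.one_lt h.Y_pos.le
    h.N_nonneg
  exact exists_global_solution (v := fun _ z => slopeField p β e (clampPair Y N z)) (fun _ => hK)
    (fun _ => continuous_const) (fun _ => hL) 0 x

theorem clampPair_zero (h : ShootingData p β e Y N τ) {μ : ℝ} (hμ : 0 ≤ μ) (hμ1 : μ ≤ 1) :
    clampPair Y N (0, μ) = (0, μ) :=
  clampPair_of_mem ⟨by linarith [h.Y_pos], h.Y_pos.le⟩ ⟨hμ, hμ1.trans h.one_le⟩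

theorem slopeField_zero (μ : ℝ) : slopeField p β e (0, μ) = (e * (1 - μ), 0) := by
  simp [slopeField, slopeRate_zero, slopeDrift_zero]

theorem exists_dist_le (h : ShootingData p β e Y N τ) : ∃ C > 0, ∀ (z w : ℝ → ℝ × ℝ) (μ μ' : ℝ),
    IsSlopeTrajectory p β e Y N z → IsSlopeTrajectory p β e Y N w → z 0 = (0, μ) → w 0 = (0, μ') →
    ∀ t ∈ Icc 0 τ, |(z t).1 - (w t).1| ≤ C * |μ - μ'| := by
  obtain ⟨K, L, hK, -⟩ := exists_lipschitz_bound_slopeField (β := β) (e := e) h.one_lt h.Y_pos.le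
    h.N_nonneg
  refine ⟨Real.exp (K * τ), Real.exp_pos _, fun z w μ μ' hz hw hz0 hw0 t ht => ?_⟩
  have h1 := dist_le_of_trajectories_ODE (a := 0) (b := τ) (δ := |μ - μ'|)
    (v := fun _ z => slopeField p β e (clampPair Y N z)) (fun _ => hK) hz.continuous.continuousOn
    (fun s _ => (hz s).hasDerivWithinAt) hw.continuous.continuousOn
    (fun s _ => (hw s).hasDerivWithinAt)
    (by rw [hz0, hw0, Prod.dist_eq]; simp [Real.dist_eq]) t ht
  have h2 : |(z t).1 - (w t).1| ≤ dist (z t) (w t) := by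
    rw [Prod.dist_eq, ← Real.dist_eq]
    exact le_max_left _ _
  refine h2.trans (h1.trans ?_)
  rw [mul_comm]
  have h3 : Real.exp (K * (t - 0)) ≤ Real.exp (K * τ) := by
    have := ht.2
    rw [sub_zero]
    gcongr
  exact mul_le_mul_of_nonneg_right h3 (abs_nonneg _)

/-- Trajectories that start near a given point have increasing slope for a uniform time. -/
theorem exists_pos_start (h : ShootingData p β e Y N τ) {μ₀ : ℝ} (h0 : 0 ≤ μ₀) (h1 : μ₀ < 1) :
    ∃ t₀ > 0, ∃ ε > 0, ∀ (z : ℝ → ℝ × ℝ) (μ : ℝ), IsSlopeTrajectory p β e Y N z → z 0 = (0, μ) →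
      |μ - μ₀| < ε → ∀ t, 0 < t → t ≤ t₀ → 0 < (z t).1 := by
  obtain ⟨K, L, hK, hL⟩ := exists_lipschitz_bound_slopeField (β := β) (e := e) h.one_lt h.Y_pos.le
    h.N_nonneg
  have hpos : 0 < (slopeField p β e (clampPair Y N (0, μ₀))).1 := by
    rw [h.clampPair_zero h0 h1.le, slopeField_zero]
    exact mul_pos h.e_pos (by linarith)
  obtain ⟨δ, hδ, hball⟩ := Metric.eventually_nhds_iff.mp
    ((continuous_fst.comp hK.continuous).continuousAt.eventually_const_lt hpos)
  -- The speed is at most L, so within this time a trajectory moves less than δ/2; starting within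
  -- δ/2 of the base point it stays where y' > 0. The summand 1 guards against L = 0.
  refine ⟨δ / (2 * (L + 1)), by positivity, δ / 2, by positivity,
    fun z μ hz hz0 hμ t ht htt => ?_⟩
  have hnear : ∀ s ∈ Icc 0 t, 0 < (slopeField p β e (clampPair Y N (z s))).1 := by
    intro s hs
    refine hball ?_
    have h2 : ‖z s - z 0‖ ≤ L * (s - 0) :=
      norm_image_sub_le_of_norm_deriv_le_segment' (fun u _ => (hz u).hasDerivWithinAt)
        (fun u _ => hL _) s ⟨hs.1, le_rfl⟩
    have h3 : L * (s - 0) < δ / 2 := by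
      have h4 : s ≤ δ / (2 * (L + 1)) := hs.2.trans htt
      rw [le_div_iff₀ (by positivity)] at h4
      have h5 : (0 : ℝ) ≤ L := L.coe_nonneg
      rcases hs.1.eq_or_lt with h6 | h6
      · rw [← h6]
        linarith
      · nlinarith
    have h4 : dist (z 0) (0, μ₀) < δ / 2 := by
      rw [hz0, Prod.dist_eq]
      simpa [Real.dist_eq, hδ] using hμ
    calc dist (z s) (0, μ₀) ≤ dist (z s) (z 0) + dist (z 0) (0, μ₀) := dist_triangle _ _ _
      _ < δ := by rw [dist_eq_norm]; linarith
  have hmono : StrictMonoOn (fun t => (z t).1) (Icc 0 t) := by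
    refine strictMonoOn_of_deriv_pos (convex_Icc 0 t) hz.continuous.fst.continuousOn fun s hs => ?_
    rw [interior_Icc] at hs
    rw [(hz.fst s).deriv]
    exact hnear s ⟨hs.1.le, hs.2.le⟩
  have := hmono ⟨le_rfl, ht.le⟩ ⟨ht.le, le_rfl⟩ ht
  simpa [hz0] using this

/-- Positivity of the slope on `(0, τ]` is an open condition. -/
theorem exists_pos_of_pos (h : ShootingData p β e Y N τ) {μ₀ : ℝ} (h0 : 0 ≤ μ₀) (h1 : μ₀ < 1)
    (hz : IsSlopeTrajectory p β e Y N z) (hz0 : z 0 = (0, μ₀)) (hpos : ∀ t ∈ Ioc 0 τ, 0 < (z t).1) :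
    ∃ ε > 0, ∀ (w : ℝ → ℝ × ℝ) (μ : ℝ), IsSlopeTrajectory p β e Y N w → w 0 = (0, μ) →
      |μ - μ₀| < ε → ∀ t ∈ Ioc 0 τ, 0 < (w t).1 := by
  obtain ⟨t₀, ht₀, ε, hε, hstart⟩ := h.exists_pos_start h0 h1
  obtain ⟨C, hC, hdist⟩ := h.exists_dist_le
  have hmin : ∃ m > 0, ∀ t ∈ Icc (min t₀ τ) τ, m ≤ (z t).1 := by
    obtain ⟨s, hs, hmin⟩ := (isCompact_Icc (a := min t₀ τ) (b := τ)).exists_isMinOn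
      (nonempty_Icc.mpr (min_le_right _ _)) hz.continuous.fst.continuousOn
    exact ⟨(z s).1, hpos s ⟨lt_of_lt_of_le (lt_min ht₀ h.τ_pos) hs.1, hs.2⟩, fun t ht => hmin ht⟩
  obtain ⟨m, hm, hmin⟩ := hmin
  refine ⟨min ε (m / C), lt_min hε (by positivity), fun w μ hw hw0 hμ t ht => ?_⟩
  rcases le_total t t₀ with h2 | h2
  · exact hstart w μ hw hw0 (hμ.trans_le (min_le_left _ _)) t ht.1 h2
  · have h3 := hdist w z μ μ₀ hw hz hw0 hz0 t ⟨ht.1.le, ht.2⟩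
    have h4 : C * |μ - μ₀| < m := by
      have := hμ.trans_le (min_le_right _ _)
      rwa [lt_div_iff₀ hC, mul_comm] at this
    have h5 := hmin t ⟨(min_le_left _ _).trans h2, ht.2⟩
    linarith [(abs_le.mp (h3.trans h4.le)).1, neg_abs_le ((w t).1 - (z t).1)]

/-- The line where the second component vanishes is invariant, and on it y' = e > 0 whenever y = 0,
so the slope cannot return to zero. -/
theorem pos_of_zero (h : ShootingData p β e Y N τ) (hz : IsSlopeTrajectory p β e Y N z)
    (hz0 : z 0 = (0, 0)) {t : ℝ} (ht : t ∈ Ioc 0 τ) : 0 < (z t).1 := by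
  have hp := h.one_lt
  have hsnd : ∀ s, (z s).2 = 0 := by
    refine fun s => eq_zero_of_abs_deriv_le (t₀ := 0) hz.snd (fun m => ⟨p * Y, fun x _ => ?_⟩)
      (by rw [hz0]) s
    have h1 := clampPair_mem h.Y_pos.le h.N_nonneg (z x)
    have h2 : |(clampPair Y N (z x)).2| ≤ |(z x).2| := by
      simp only [clampPair]
      rcases le_total (z x).2 0 with h3 | h3
      · rw [min_eq_left (h3.trans h.N_nonneg), max_eq_left h3, abs_zero]
        exact abs_nonneg _
      · rw [max_eq_right (le_min h3 h.N_nonneg), abs_of_nonneg (le_min h3 h.N_nonneg),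
          abs_of_nonneg h3]
        exact min_le_left _ _
    have h3 : |(clampPair Y N (z x)).1| ≤ Y := abs_le.mpr h1.1
    rw [slopeField, abs_mul, abs_mul, abs_of_pos (by linarith : 0 < p)]
    have := h.Y_pos
    gcongr
  obtain ⟨t₀, ht₀, ε, hε, hstart⟩ := h.exists_pos_start le_rfl zero_lt_one
  have hs : 0 < (z (min t₀ t)).1 :=
    hstart z 0 hz hz0 (by simpa using hε) _ (lt_min ht₀ ht.1) (min_le_left _ _)
  refine pos_of_deriv_pos_at_zero (f := fun t => (z t).1) (a := min t₀ t) (b := t)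
    hz.continuous.fst.continuousOn hs (fun s _ hs0 => ⟨hz.fst s, ?_⟩) ⟨min_le_right _ _, le_rfl⟩
  have h3 : z s = (0, 0) := Prod.ext hs0 (hsnd s)
  rw [h3, h.clampPair_zero le_rfl zero_le_one, slopeField_zero]
  simpa using h.e_pos

/-- A nonnegative slope has no interior zeros. -/
theorem pos_of_nonneg (h : ShootingData p β e Y N τ) (hμ : 0 ≤ μ) (hμ1 : μ < 1)
    (hz : IsSlopeTrajectory p β e Y N z) (hz0 : z 0 = (0, μ))
    (hnn : ∀ t ∈ Icc 0 τ, 0 ≤ (z t).1) {t : ℝ} (ht : t ∈ Ioo 0 τ) : 0 < (z t).1 := by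
  have ht' : t ∈ Icc 0 τ := ⟨ht.1.le, ht.2.le⟩
  refine lt_of_le_of_ne (hnn t ht') fun h0 => ?_
  have hloc : IsLocalMin (fun t => (z t).1) t := by
    filter_upwards [Ioo_mem_nhds ht.1 ht.2] with s hs
    rw [← h0]
    exact hnn s ⟨hs.1.le, hs.2.le⟩
  have h1 := hloc.hasDerivAt_eq_zero (hz.fst t)
  have h2 := (hz.clampPair_eq h.one_lt h.e_pos h.Y_pos.le h.le_drift h.exp_le hz0 hμ hμ1.le hnn
    ht').1
  have hzt : z t = (0, (z t).2) := Prod.ext h0.symm rfl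
  rw [h2, hzt, slopeField_zero] at h1
  -- An interior zero would be a minimum of y, hence the point (0, 1). That is an equilibrium, so
  -- uniqueness would make the whole trajectory constant, against μ < 1.
  have h3 : (z t).2 = 1 := by
    have := (mul_eq_zero.mp h1).resolve_left h.e_pos.ne'
    linarith
  have hconst : IsSlopeTrajectory p β e Y N fun _ => (0, 1) := by
    intro s
    rw [h.clampPair_zero zero_le_one le_rfl, slopeField_zero]
    exact (hasDerivAt_const s ((0 : ℝ), (1 : ℝ))).congr_deriv (Prod.ext (by simp) rfl)
  have h4 := hz.ext h.one_lt h.Y_pos.le h.N_nonneg hconst (t₀ := t) (by rw [hzt, h3])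
  have h5 := congrArg Prod.snd (congrFun h4 0)
  rw [hz0] at h5
  simp only at h5
  linarith

/-- The shooting argument: if some trajectory becomes negative before `τ`, then there is one that
vanishes for the first time at `τ`. -/
theorem exists_first_zero (h : ShootingData p β e Y N τ)
    (hneg : ∃ μ, 0 ≤ μ ∧ μ < 1 ∧ ∀ z, IsSlopeTrajectory p β e Y N z → z 0 = (0, μ) →
      ∃ t ∈ Icc 0 τ, (z t).1 < 0) :
    ∃ μ z, 0 < μ ∧ μ < 1 ∧ IsSlopeTrajectory p β e Y N z ∧ z 0 = (0, μ) ∧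
      (∀ t ∈ Icc 0 τ, 0 ≤ (z t).1) ∧ (z τ).1 = 0 := by
  choose φ hφ0 hφ using fun μ => h.exists_trajectory (0, μ)
  set B := {μ | 0 ≤ μ ∧ μ < 1 ∧ ∃ t ∈ Icc 0 τ, (φ μ t).1 < 0} with hB
  obtain ⟨μ₁, h1, h2, h3⟩ := hneg
  have hne : B.Nonempty := ⟨μ₁, h1, h2, h3 _ (hφ μ₁) (hφ0 μ₁)⟩
  have hbdd : BddBelow B := ⟨0, fun μ hμ => hμ.1⟩
  set m := sInf B with hm
  have hm0 : 0 ≤ m := le_csInf hne fun μ hμ => hμ.1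
  have hm1 : m < 1 := (csInf_le hbdd hne.some_mem).trans_lt hne.some_mem.2.1
  -- Positivity on (0, τ] is open in μ, whereas members of B come arbitrarily close to the infimum
  -- m.
  have hmA : ¬ ∀ t ∈ Ioc 0 τ, 0 < (φ m t).1 := by
    intro hpos
    obtain ⟨ε, hε, hnear⟩ := h.exists_pos_of_pos hm0 hm1 (hφ m) (hφ0 m) hpos
    obtain ⟨μ, hμ, hμε⟩ := exists_lt_of_csInf_lt hne (by linarith : sInf B < m + ε)
    have hμm : m ≤ μ := csInf_le hbdd hμ
    obtain ⟨t, ht, hlt⟩ := hμ.2.2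
    rcases ht.1.eq_or_lt with h4 | h4
    · rw [← h4, hφ0] at hlt
      exact lt_irrefl _ hlt
    · have := hnear (φ μ) μ (hφ μ) (hφ0 μ) (by rw [abs_of_nonneg (by linarith)]; linarith) t
        ⟨h4, ht.2⟩
      linarith
  have hmpos : 0 < m := by
    refine lt_of_le_of_ne hm0 fun h4 => hmA fun t ht => h.pos_of_zero (hφ m) ?_ ht
    rw [hφ0, ← h4]
  -- Negativity at a time t is open as well: otherwise m - δ would still belong to B.
  have hmB : ∀ t ∈ Icc 0 τ, 0 ≤ (φ m t).1 := by
    intro t ht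
    by_contra hcon
    obtain ⟨C, hC, hdist⟩ := h.exists_dist_le
    set δ := min (m / 2) (-(φ m t).1 / (2 * C)) with hδ
    have hcon : (φ m t).1 < 0 := not_le.mp hcon
    have hδpos : 0 < δ := lt_min (by linarith) (div_pos (by linarith) (by positivity))
    have h4 := hdist (φ (m - δ)) (φ m) (m - δ) m (hφ _) (hφ _) (hφ0 _) (hφ0 _) t ht
    have h5 : |m - δ - m| = δ := by
      rw [show m - δ - m = -δ by ring, abs_neg, abs_of_pos hδpos]
    have h6 : C * δ ≤ -(φ m t).1 / 2 := by
      have := min_le_right (m / 2) (-(φ m t).1 / (2 * C))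
      rw [← hδ, le_div_iff₀ (by positivity)] at this
      linarith
    rw [h5] at h4
    have h7 : (φ (m - δ) t).1 < 0 := by linarith [(abs_le.mp h4).2]
    have h8 : m - δ ∈ B :=
      ⟨by linarith [min_le_left (m / 2) (-(φ m t).1 / (2 * C))], by linarith, t, ht, h7⟩
    linarith [csInf_le hbdd h8]
  refine ⟨m, φ m, hmpos, hm1, hφ m, hφ0 m, hmB, ?_⟩
  by_contra hτ
  refine hmA fun t ht => ?_
  rcases ht.2.eq_or_lt with h4 | h4
  · rw [h4]
    exact lt_of_le_of_ne (hmB τ ⟨h.τ_pos.le, le_rfl⟩) (Ne.symm hτ)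
  · exact h.pos_of_nonneg hm0 hm1 (hφ m) (hφ0 m) hmB ⟨ht.1, h4⟩

end ShootingData

/-! ### Comparison with the linearized slope system -/

section bounds
variable {p β : ℝ}

/-- The derivative of the drift is y times a continuous function, so the drift is of second order at
0 and cannot disturb the linearization. -/
theorem exists_slopeDrift_le_sq (p β : ℝ) {Y : ℝ} (hY : 0 ≤ Y) :
    ∃ G, 0 ≤ G ∧ ∀ y ∈ Icc 0 Y, slopeDrift p β y ≤ G * y ^ 2 := by
  have h1 := continuous_one_add_sq_rpow ((p - 2) / 2)
  have h2 := continuous_one_add_sq_rpow ((p - 4) / 2)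
  have hc : Continuous fun y : ℝ => (p - 1) * β * p * (1 + y ^ 2) ^ ((p - 2) / 2) +
      (p - 2) ^ 2 * (1 + y ^ 2) ^ ((p - 4) / 2) := by fun_prop
  obtain ⟨G, hG⟩ := (isCompact_Icc (a := (0 : ℝ)) (b := Y)).exists_bound_of_continuousOn
    hc.continuousOn
  have hG0 : 0 ≤ G := (norm_nonneg _).trans (hG 0 ⟨le_rfl, hY⟩)
  refine ⟨G, hG0, fun y hy => ?_⟩
  have hd : ∀ u : ℝ, HasDerivAt (fun u => G * u ^ 2 - slopeDrift p β u)
      (G * (2 * u) - ((p - 1) * β * p * u * (1 + u ^ 2) ^ ((p - 2) / 2) +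
        (p - 2) ^ 2 * u * (1 + u ^ 2) ^ ((p - 4) / 2))) u := fun u => by
    refine ((((hasDerivAt_id u).pow 2).const_mul G).sub (hasDerivAt_slopeDrift u)).congr_deriv ?_
    simp
  have hmono : MonotoneOn (fun u => G * u ^ 2 - slopeDrift p β u) (Icc 0 Y) := by
    refine monotoneOn_of_deriv_nonneg (convex_Icc 0 Y)
      (fun u _ => (hd u).continuousAt.continuousWithinAt)
      (fun u _ => (hd u).differentiableAt.differentiableWithinAt) fun u hu => ?_
    rw [interior_Icc] at hu
    rw [(hd u).deriv]
    have h3 := (abs_le.mp (hG u ⟨hu.1.le, hu.2.le⟩)).2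
    have h4 := mul_le_mul_of_nonneg_left h3 hu.1.le
    have h5 := mul_nonneg hG0 hu.1.le
    linarith
  have := hmono ⟨le_rfl, hY⟩ hy hy.1
  simp only [slopeDrift_zero] at this
  linarith

theorem exists_slopeRate_ge (hp : 1 < p) {Y : ℝ} (hY : 0 ≤ Y) :
    ∃ d > 0, ∀ y ∈ Icc 0 Y, d ≤ slopeRate p y := by
  have hc : Continuous (slopeRate p) := by
    have h2 := continuous_one_add_sq_rpow ((p - 4) / 2)
    unfold slopeRate
    fun_prop
  obtain ⟨s, -, hmin⟩ := (isCompact_Icc (a := (0 : ℝ)) (b := Y)).exists_isMinOn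
    (nonempty_Icc.mpr hY) hc.continuousOn
  exact ⟨slopeRate p s, slopeRate_pos hp s, fun y hy => hmin hy⟩

end bounds

/-- Trajectories that start close to the equilibrium become negative before `π / ν` if `ν` is less
than the frequency of the linearization. -/
theorem ShootingData.exists_neg {p β e Y N τ ν : ℝ} (h : ShootingData p β e Y N τ) (hν : 0 < ν)
    (hντ : ν * τ = Real.pi) (hlt : ν ^ 2 < p * e) :
    ∃ μ, 0 ≤ μ ∧ μ < 1 ∧ ∀ z, IsSlopeTrajectory p β e Y N z → z 0 = (0, μ) →
      ∃ t ∈ Icc 0 τ, (z t).1 < 0 := by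
  have hp := h.one_lt
  have he := h.e_pos
  have hτ := h.τ_pos
  have hπ := Real.pi_pos
  have hp0 : 0 < p := by linarith
  obtain ⟨G, hG0, hG⟩ := exists_slopeDrift_le_sq p β h.Y_pos.le
  obtain ⟨d, hd0, hd⟩ := exists_slopeRate_ge hp h.Y_pos.le
  -- One third of the spectral gap p e - ν²: one third is spent on the factor (1 + y²)^((p-2)/2),
  -- one on 1 - μ, and one remains to absorb the drift.
  set κ := (p * e - ν ^ 2) / 3 with hκ
  have hκ0 : 0 < κ := by rw [hκ]; linarith
  obtain ⟨y₁, hy₁, hS⟩ : ∃ y₁ > 0, ∀ u : ℝ, 0 ≤ u → u < y₁ →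
      ν ^ 2 * (1 + u ^ 2) ^ ((p - 2) / 2) < ν ^ 2 + κ := by
    have hc : ContinuousAt (fun u : ℝ => ν ^ 2 * (1 + u ^ 2) ^ ((p - 2) / 2)) 0 :=
      (continuous_const.mul (continuous_one_add_sq_rpow _)).continuousAt
    obtain ⟨δ, hδ, hball⟩ := Metric.eventually_nhds_iff.mp
      (hc.eventually_lt_const (by simpa using hκ0 : _ < ν ^ 2 + κ))
    exact ⟨δ, hδ, fun u hu hu1 =>
      hball (by rw [Real.dist_eq, sub_zero, abs_of_nonneg hu]; exact hu1)⟩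
  -- The distance 1 - μ from the equilibrium. Since y ≤ (e/d) ι t, the conditions keep p e times the
  -- second component near p e, make the drift term absorbable, and keep y below y₁.
  obtain ⟨ι, hι0, hι1, hι2, hι3, hι4⟩ : ∃ ι : ℝ, 0 < ι ∧ ι < 1 ∧ p * e * ι < κ ∧
      G * (e / d * ι) < κ * (2 / Real.pi) ∧ e / d * ι * τ < y₁ := by
    have hlim : ∀ (A C : ℝ), 0 < C → ∀ᶠ ι in 𝓝[>] (0 : ℝ), A * ι < C := fun A C hC =>
      ((tendsto_nhdsWithin_of_tendsto_nhds ((continuous_const.mul continuous_id).tendsto' 0 0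
        (by simp))).eventually_lt_const hC : ∀ᶠ ι in 𝓝[>] (0 : ℝ), A * id ι < C)
    have hmem : ∀ᶠ ι in 𝓝[>] (0 : ℝ), 0 < ι := self_mem_nhdsWithin
    obtain ⟨ι, h1, h2, h3, h4, h5⟩ := hmem.and
      ((hlim 1 1 one_pos).and ((hlim (p * e) κ hκ0).and ((hlim (G * (e / d)) (κ * (2 / Real.pi))
        (by positivity)).and (hlim (e / d * τ) y₁ hy₁)))) |>.exists
    exact ⟨ι, h1, by linarith, h3, by linarith, by linarith⟩
  refine ⟨1 - ι, by linarith, by linarith, fun z hz hz0 => ?_⟩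
  by_contra hcon
  push Not at hcon
  have hclamp := fun t ht => hz.clampPair_eq hp he h.Y_pos.le h.le_drift h.exp_le hz0
    (by linarith) (by linarith) hcon (t := t) ht
  have hYle : ∀ t ∈ Icc 0 τ, (z t).1 ∈ Icc 0 Y := fun t ht =>
    ⟨hcon t ht, hz.fst_le hp he h.Y_pos.le h.le_drift (by rw [hz0]) ht.1⟩
  have hpos := fun t ht => h.pos_of_nonneg (by linarith) (by linarith) hz hz0 hcon (t := t) ht
  have hlin : ∀ t ∈ Icc 0 τ, (z t).1 ≤ e / d * ι * t := by
    intro t ht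
    have := le_max_add_of_deriv_le (f := fun t => (z t).1) (a := 0) (b := t) (m := 0)
      (C := e / d * ι) (by positivity) (fun s _ => hz.fst s) (fun s hs _ => ?_) ⟨ht.1, le_rfl⟩
    · simpa [hz0] using this
    · have hs' : s ∈ Icc 0 τ := ⟨hs.1, hs.2.trans ht.2⟩
      rw [(hclamp s hs').1, slopeField]
      have h1 := (hclamp s hs').2
      have h2 := hd _ (hYle s hs')
      have h3 := slopeDrift_nonneg hp h.beta_pos (z s).1
      have h4 : e * (1 - (z s).2) ≤ e * ι := mul_le_mul_of_nonneg_left (by linarith) he.le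
      rw [div_le_iff₀ (by linarith), div_mul_eq_mul_div, div_mul_eq_mul_div, le_div_iff₀ hd0]
      have h5 : 0 ≤ e * ι := by positivity
      nlinarith
  -- The Wronskian of F(y) and sin(νt), up to the drift. If y stayed nonnegative, P would decrease
  -- strictly from P(0) = 0 to P(τ) = ν F(y(τ)) ≥ 0.
  set P : ℝ → ℝ := fun t => e * (1 - (z t).2) * Real.sin (ν * t) -
    ν * slopeFlux p (z t).1 * Real.cos (ν * t) with hP
  have hdP : ∀ t ∈ Icc 0 τ, HasDerivAt P (((ν ^ 2 * (1 + (z t).1 ^ 2) ^ ((p - 2) / 2) -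
      p * e * (z t).2) * (z t).1) * Real.sin (ν * t) +
      ν * slopeDrift p β (z t).1 * Real.cos (ν * t)) t := by
    intro t ht
    have hνt : HasDerivAt (fun t => ν * t) ν t := by simpa using (hasDerivAt_id t).const_mul ν
    refine ((((hz.snd t).const_sub 1).const_mul e).mul hνt.sin).sub
      ((((hasDerivAt_slopeFlux _).comp t (hz.fst t)).const_mul ν).mul hνt.cos) |>.congr_deriv ?_
    rw [(hclamp t ht).1]
    have := (slopeRate_pos hp (z t).1).ne'
    simp only [slopeField, slopeFlux, Function.comp]
    field_simp
    ring
  have hanti : StrictAntiOn P (Icc 0 τ) := by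
    refine strictAntiOn_of_deriv_neg (convex_Icc 0 τ)
      (fun t ht => (hdP t ht).continuousAt.continuousWithinAt) fun t ht => ?_
    rw [interior_Icc] at ht
    have ht' : t ∈ Icc 0 τ := ⟨ht.1.le, ht.2.le⟩
    rw [(hdP t ht').deriv]
    have hy := hpos t ht
    have hνt : ν * t < Real.pi := by
      rw [← hντ]
      exact mul_lt_mul_of_pos_left ht.2 hν
    have hsin : 0 < Real.sin (ν * t) := Real.sin_pos_of_pos_of_lt_pi (mul_pos hν ht.1) hνt
    have hyl := hlin t ht'
    have hysmall : (z t).1 < y₁ := by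
      have : e / d * ι * t ≤ e / d * ι * τ := mul_le_mul_of_nonneg_left ht.2.le (by positivity)
      linarith
    have h1 : ν ^ 2 * (1 + (z t).1 ^ 2) ^ ((p - 2) / 2) - p * e * (z t).2 < -κ := by
      have h2 := hS _ hy.le hysmall
      have h3 := mul_le_mul_of_nonneg_left (hclamp t ht').2 (by positivity : 0 ≤ p * e)
      linarith
    have h4 : ((ν ^ 2 * (1 + (z t).1 ^ 2) ^ ((p - 2) / 2) - p * e * (z t).2) * (z t).1) *
        Real.sin (ν * t) < -κ * (z t).1 * Real.sin (ν * t) := by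
      gcongr
    -- Only the first quarter wave matters, since afterwards the cosine is nonpositive. There the
    -- drift is at most a constant times y t, and Jordan's inequality bounds sin(νt) below by a
    -- multiple of t.
    have h5 : ν * slopeDrift p β (z t).1 * Real.cos (ν * t) ≤ κ * (z t).1 * Real.sin (ν * t) := by
      have hη := slopeDrift_nonneg hp h.beta_pos (z t).1
      rcases le_total (ν * t) (Real.pi / 2) with h6 | h6
      · have h7 : 2 / Real.pi * (ν * t) ≤ Real.sin (ν * t) :=
          Real.mul_le_sin (mul_pos hν ht.1).le h6
        have h8 := Real.cos_le_one (ν * t)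
        have h9 : slopeDrift p β (z t).1 ≤ G * ((z t).1 * (e / d * ι * t)) := by
          refine (hG _ (hYle t ht')).trans (mul_le_mul_of_nonneg_left ?_ hG0)
          rw [sq]
          exact mul_le_mul_of_nonneg_left hyl hy.le
        calc ν * slopeDrift p β (z t).1 * Real.cos (ν * t) ≤ ν * slopeDrift p β (z t).1 * 1 := by
              gcongr
          _ ≤ ν * (G * ((z t).1 * (e / d * ι * t))) := by
              rw [mul_one]
              gcongr
          _ = (G * (e / d * ι)) * (ν * t * (z t).1) := by ring
          _ ≤ (κ * (2 / Real.pi)) * (ν * t * (z t).1) := by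
              have : 0 ≤ ν * t * (z t).1 := mul_nonneg (mul_pos hν ht.1).le hy.le
              gcongr
          _ = κ * (z t).1 * (2 / Real.pi * (ν * t)) := by ring
          _ ≤ _ := by gcongr
      · have h7 : Real.cos (ν * t) ≤ 0 :=
          Real.cos_nonpos_of_pi_div_two_le_of_le h6 (by linarith)
        have h8 : ν * slopeDrift p β (z t).1 * Real.cos (ν * t) ≤ 0 :=
          mul_nonpos_of_nonneg_of_nonpos (mul_nonneg hν.le hη) h7
        have h9 : 0 < κ * (z t).1 * Real.sin (ν * t) := by positivity
        linarith
    linarith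
  have h1 := hanti ⟨le_rfl, hτ.le⟩ ⟨hτ.le, le_rfl⟩ hτ
  have h2 : P 0 = 0 := by simp [hP, hz0, slopeFlux_zero]
  have h3 : P τ = ν * slopeFlux p (z τ).1 := by simp [hP, hντ]
  rw [h2, h3] at h1
  have h4 : 0 ≤ slopeFlux p (z τ).1 :=
    mul_nonneg (hcon τ ⟨hτ.le, le_rfl⟩) (Real.rpow_nonneg (one_add_sq_pos _).le _)
  linarith [mul_nonneg hν.le h4]

/-! ### Nonconstant positive solutions -/

/-- Nonconstant periodic trajectories of the slope system. -/
theorem exists_periodic_slope {p β e ν : ℝ} (hp : 1 < p) (hβ : 0 < β) (hν : 0 < ν)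
    (hlt : ν ^ 2 < p * e) : ∃ y y' E : ℝ → ℝ, (∀ t, HasDerivAt y (y' t) t) ∧
      (∀ t, slopeRate p (y t) * y' t = e * (1 - E t) - slopeDrift p β (y t)) ∧
      (∀ t, HasDerivAt E (p * y t * E t) t) ∧ (∀ t, 0 < E t) ∧
      Function.Periodic E (2 * Real.pi / ν) ∧ StrictMonoOn E (Icc 0 (Real.pi / ν)) ∧
      ∀ t, E (2 * Real.pi / ν - t) = E t := by
  have hπ := Real.pi_pos
  have he : 0 < e := by
    have : 0 < p * e := lt_of_le_of_lt (sq_nonneg ν) hlt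
    exact pos_of_mul_pos_right this (by linarith)
  obtain ⟨Y, hY, hYe⟩ := exists_le_slopeDrift hp hβ e
  set τ := Real.pi / ν with hτ
  have hτ0 : 0 < τ := div_pos hπ hν
  have h : ShootingData p β e Y (Real.exp (p * Y * τ)) τ := ⟨hp, hβ, he, hY, hYe, le_rfl, hτ0⟩
  set N := Real.exp (p * Y * τ)
  obtain ⟨μ, z, hμ0, hμ1, hz, hz0, hnn, hzτ⟩ :=
    h.exists_first_zero (h.exists_neg hν (mul_div_cancel₀ _ hν.ne') hlt)
  have hclamp := fun t ht => hz.clampPair_eq hp he hY.le hYe le_rfl hz0 hμ0.le hμ1.le hnn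
    (t := t) ht
  -- The slope vanishes at 0 and at τ, so the trajectory is invariant under the reflections about
  -- both times; their composition is the period 2τ.
  have hr0 := (hz.reflect hY.le 0).ext hp hY.le h.N_nonneg hz (t₀ := 0) (by simp [hz0])
  have hrτ := (hz.reflect hY.le (2 * τ)).ext hp hY.le h.N_nonneg hz (t₀ := τ) (by
    rw [show 2 * τ - τ = τ by ring, hzτ, neg_zero]
    exact Prod.ext hzτ.symm rfl)
  have e1 : ∀ t, z (-t) = (-(z t).1, (z t).2) := fun t => by
    have := congrFun hr0 (-t)
    rw [zero_sub, neg_neg] at this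
    exact this.symm
  have e2 : ∀ t, z (2 * τ - t) = (-(z t).1, (z t).2) := fun t => by
    have := congrFun hrτ (2 * τ - t)
    rw [sub_sub_cancel] at this
    exact this.symm
  have hper : Function.Periodic z (2 * τ) := fun t => by
    rw [show t + 2 * τ = 2 * τ - -t by ring, e2, e1, neg_neg]
  have hgood : ∀ t, clampPair Y N (z t) = z t ∧ 0 < (z t).2 := by
    intro t
    obtain ⟨s, hs, hst⟩ := hper.exists_mem_Ico₀ (by linarith) t
    rw [hst]
    rcases le_total s τ with h1 | h1
    · have := hclamp s ⟨hs.1, h1⟩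
      exact ⟨this.1, hμ0.trans_le this.2⟩
    · have h2 := hclamp (2 * τ - s) ⟨by linarith [hs.2], by linarith⟩
      rw [show s = 2 * τ - (2 * τ - s) by ring, e2]
      refine ⟨?_, hμ0.trans_le h2.2⟩
      rw [clampPair_neg hY.le, h2.1]
  have e3 : 2 * Real.pi / ν = 2 * τ := by rw [hτ]; ring
  rw [e3]
  refine ⟨fun t => (z t).1, fun t => (slopeField p β e (z t)).1, fun t => (z t).2, fun t => ?_,
    fun t => ?_, fun t => ?_, fun t => (hgood t).2, fun t => by simp only [hper t], ?_,
    fun t => by simp only [e2]⟩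
  · have := hz.fst t
    rwa [(hgood t).1] at this
  · exact mul_div_cancel₀ _ (slopeRate_pos hp _).ne'
  · have := hz.snd t
    rwa [(hgood t).1] at this
  · refine strictMonoOn_of_deriv_pos (convex_Icc 0 τ) hz.continuous.snd.continuousOn
      fun t ht => ?_
    rw [interior_Icc] at ht
    rw [(hz.snd t).deriv, (hgood t).1, slopeField]
    have h1 := h.pos_of_nonneg hμ0.le hμ1 hz hz0 hnn ht
    have h2 := (hgood t).2
    have : 0 < p := by linarith
    positivity

/-- By reflection the value at 0 is attained nowhere else in [0, 2τ), as E is strictly increasing up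
to τ and mirrored afterwards. -/
theorem hasLeastPeriod_of_reflection {E : ℝ → ℝ} {τ : ℝ} (hτ : 0 < τ)
    (hper : Function.Periodic E (2 * τ)) (hmono : StrictMonoOn E (Icc 0 τ))
    (hrefl : ∀ t, E (2 * τ - t) = E t) : HasLeastPeriod E (2 * τ) := by
  refine ⟨⟨by linarith, hper⟩, fun S hS => ?_⟩
  by_contra hcon
  have hcon : S < 2 * τ := not_le.mp hcon
  have h1 : E S = E 0 := by
    have := hS.2 0
    rwa [zero_add] at this
  have hS0 : 0 < S := hS.1
  rcases le_total S τ with h2 | h2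
  · have := hmono ⟨le_rfl, hτ.le⟩ ⟨hS0.le, h2⟩ hS0
    linarith
  · have := hmono ⟨le_rfl, hτ.le⟩ ⟨by linarith, by linarith⟩ (by linarith : 0 < 2 * τ - S)
    rw [hrefl] at this
    linarith

theorem exists_nonconstant_positive {p q b : ℝ} (h : Exponents p q (betaq p q)) {k : ℕ}
    (hk : 1 ≤ k) (hlt : (k : ℝ) ^ 2 < p * (b - ((p - 1) * betaq p q + (p - 2)))) :
    ∃ ω : ℝ → ℝ, IsPeriodicSolution p q (b * betaq p q ^ (p - 1)) ω ∧ (∀ σ, 0 < ω σ) ∧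
      (∃ σ τ, ω σ ≠ ω τ) ∧ HasLeastPeriod ω (2 * Real.pi / k) := by
  have hπ := Real.pi_pos
  have hr := h.r_pos
  have hp := h.one_lt
  have hk0 : (0 : ℝ) < k := by exact_mod_cast hk
  set e := b - ((p - 1) * betaq p q + (p - 2)) with he
  have he0 : 0 < e := by
    have : 0 < p * e := lt_of_le_of_lt (sq_nonneg (k : ℝ)) hlt
    exact pos_of_mul_pos_right this (by linarith)
  obtain ⟨y, y', E, hdy, hode, hdE, hE, hper, hmono, hrefl⟩ :=
    exists_periodic_slope hp h.pos hk0 hlt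
  have e3 : 2 * Real.pi / k = 2 * (Real.pi / k) := by ring
  have hleast : HasLeastPeriod E (2 * Real.pi / k) := by
    rw [e3] at hper hrefl ⊢
    exact hasLeastPeriod_of_reflection (by positivity) hper hmono hrefl
  have hB : 0 < betaq p q ^ (p - 1) := Real.rpow_pos_of_pos h.pos _
  -- The inverse of v = β^(1-p) ω^r with v = e E, where r = q + 1 - p.
  set ω : ℝ → ℝ := fun t => (e * betaq p q ^ (p - 1) * E t) ^ (1 / (q + 1 - p)) with hω
  have hbase : ∀ t, 0 < e * betaq p q ^ (p - 1) * E t := fun t => mul_pos (mul_pos he0 hB) (hE t)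
  have hpos : ∀ t, 0 < ω t := fun t => Real.rpow_pos_of_pos (hbase t) _
  have hpow : ∀ t, ω t ^ (q + 1 - p) = e * betaq p q ^ (p - 1) * E t := fun t => by
    rw [hω, ← Real.rpow_mul (hbase t).le, one_div_mul_cancel hr.ne', Real.rpow_one]
  have hd : ∀ t, HasDerivAt ω (betaq p q * ω t * y t) t := by
    intro t
    refine (((hdE t).const_mul (e * betaq p q ^ (p - 1))).rpow_const (p := 1 / (q + 1 - p))
      (Or.inl (hbase t).ne')).congr_deriv ?_
    rw [Real.rpow_sub_one (hbase t).ne']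
    change _ = betaq p q * (e * betaq p q ^ (p - 1) * E t) ^ (1 / (q + 1 - p)) * y t
    have h1 := (hE t).ne'
    have h2 := hr.ne'
    have h3 := hB.ne'
    have h4 := he0.ne'
    have h5 := h.rel
    generalize (e * betaq p q ^ (p - 1) * E t) ^ (1 / (q + 1 - p)) = R
    generalize betaq p q ^ (p - 1) = B at *
    field_simp
    linear_combination -(y t * R) * h5
  have hiff : ∀ S, Function.Periodic ω S ↔ Function.Periodic E S := by
    intro S
    refine ⟨fun hS t => ?_, fun hS t => by simp only [hω, hS t]⟩
    have h1 := hpow (t + S)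
    rw [hS t, hpow t] at h1
    exact (mul_left_cancel₀ (mul_pos he0 hB).ne' h1).symm
  refine ⟨ω, isPeriodicSolution_of_slope h hpos hd hdy (fun t => ?_) ?_, hpos,
    ⟨0, Real.pi / k, fun heq => ?_⟩, ?_⟩
  · rw [hode t, hpow t, ← he, show 1 - p = -(p - 1) by ring, Real.rpow_neg h.pos.le]
    have := hB.ne'
    field_simp
  · rw [hiff]
    have := hper.nat_mul k
    rwa [show (k : ℝ) * (2 * Real.pi / k) = 2 * Real.pi by field_simp] at this
  · have hτ : 0 < Real.pi / k := by positivity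
    have h1 := hmono ⟨le_rfl, hτ.le⟩ ⟨hτ.le, le_rfl⟩ hτ
    have h2 := hpow 0
    rw [heq, hpow] at h2
    exact h1.ne (mul_left_cancel₀ (mul_pos he0 hB).ne' h2).symm
  · refine ⟨⟨hleast.1.1, (hiff _).mpr hleast.1.2⟩, fun S hS => ?_⟩
    exact hleast.2 ⟨hS.1, (hiff _).mp hS.2⟩

theorem sq_lt_of_le_kqPlus {p q b : ℝ} (h : Exponents p q (betaq p q))
    (hb : (p - 1) * betaq p q + (p - 2) < b) {k : ℕ}
    (hk : k ≤ kqPlus p q (b * betaq p q ^ (p - 1))) :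
    (k : ℝ) ^ 2 < p * (b - ((p - 1) * betaq p q + (p - 2))) := by
  have hB : 0 < betaq p q ^ (p - 1) := Real.rpow_pos_of_pos h.pos _
  have hp := h.one_lt
  have e1 : p * betaq p q ^ (1 - p) * (b * betaq p q ^ (p - 1) - cq p q) =
      p * (b - ((p - 1) * betaq p q + (p - 2))) := by
    rw [cq_eq h, show 1 - p = -(p - 1) by ring, Real.rpow_neg h.pos.le]
    have := hB.ne'
    field_simp
  have hpos : 0 < p * (b - ((p - 1) * betaq p q + (p - 2))) :=
    mul_pos (by linarith) (by linarith)
  rw [kqPlus, e1] at hk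
  set R := p * (b - ((p - 1) * betaq p q + (p - 2)))
  -- The set is bounded and contains 0, so the supremum of naturals is attained and the strict
  -- inequality holds for it as well.
  have hmem : sSup {k : ℕ | (k : ℝ) < Real.sqrt R} ∈ {k : ℕ | (k : ℝ) < Real.sqrt R} := by
    refine Nat.sSup_mem ⟨0, ?_⟩ ⟨⌈Real.sqrt R⌉₊, fun n hn => ?_⟩
    · simpa using hpos
    · have h2 : (n : ℝ) < Real.sqrt R := hn
      exact Nat.cast_le.mp (h2.le.trans (Nat.le_ceil _))
  have h1 : (k : ℝ) < Real.sqrt R := lt_of_le_of_lt (by exact_mod_cast hk) hmem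
  exact (Real.lt_sqrt (Nat.cast_nonneg k)).mp h1

end SeparableSolutions

end

theorem theorem2 (p q c : ℝ) (hp : 1 < p) (hq : p - 1 < q) :
    -- the integral defining `M_q` is convergent and positive
    (c < SeparableSolutions.cq p q →
      IntervalIntegrable (SeparableSolutions.integrandMq p q c) MeasureTheory.volume
        0 (Real.pi / 2) ∧
      0 < ∫ θ in (0 : ℝ)..(Real.pi / 2), SeparableSolutions.integrandMq p q c θ) ∧
    -- (i) sign changing solutions
    (∃ ω : ℕ → ℝ → ℝ,
      (∀ k : ℕ, SeparableSolutions.kq p q c ≤ k →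
        SeparableSolutions.HasLeastPeriod (ω k) (2 * Real.pi / k)) ∧
      SeparableSolutions.signChangingSolutions p q c =
        ⋃ (k : ℕ) (_ : SeparableSolutions.kq p q c ≤ k),
          {f : ℝ → ℝ | ∃ ψ : ℝ, f = fun σ => ω k (σ + ψ)}) ∧
    -- (ii) positive solutions
    (c ≤ SeparableSolutions.cq p q → SeparableSolutions.positiveSolutions p q c = ∅) ∧
    (0 < c - SeparableSolutions.cq p q →
      c - SeparableSolutions.cq p q ≤ SeparableSolutions.betaq p q ^ (p - 1) / p →
      SeparableSolutions.positiveSolutions p q c =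
        {fun _ : ℝ => (c - SeparableSolutions.cq p q) ^ (1 / (q + 1 - p))}) ∧
    (SeparableSolutions.betaq p q ^ (p - 1) / p < c - SeparableSolutions.cq p q →
      (fun _ : ℝ => (c - SeparableSolutions.cq p q) ^ (1 / (q + 1 - p))) ∈
        SeparableSolutions.positiveSolutions p q c ∧
      ∃ ω : ℕ → ℝ → ℝ,
        (∀ k : ℕ, 1 ≤ k → k ≤ SeparableSolutions.kqPlus p q c →
          (∀ σ, 0 < ω k σ) ∧ (∃ σ τ, ω k σ ≠ ω k τ) ∧
          SeparableSolutions.HasLeastPeriod (ω k) (2 * Real.pi / k)) ∧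
        (⋃ (k : ℕ) (_ : 1 ≤ k ∧ k ≤ SeparableSolutions.kqPlus p q c),
          {f : ℝ → ℝ | ∃ ψ : ℝ, f = fun σ => ω k (σ + ψ)}) ⊆
          SeparableSolutions.positiveSolutions p q c) := by
  have h := SeparableSolutions.exponents_betaq hp hq
  have hβ := h.pos
  have hB : 0 < SeparableSolutions.betaq p q ^ (p - 1) := Real.rpow_pos_of_pos hβ _
  -- This normalization removes the powers of β: the critical value becomes (p-1)β + (p-2), and the
  -- bound β^(p-1)/p on c - c_q becomes p e ≤ 1.
  obtain ⟨b, rfl⟩ : ∃ b, c = b * SeparableSolutions.betaq p q ^ (p - 1) :=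
    ⟨c / SeparableSolutions.betaq p q ^ (p - 1), (div_mul_cancel₀ _ hB.ne').symm⟩
  have hlt := SeparableSolutions.mul_rpow_lt_cq_iff (b := b) h
  have hsub : b * SeparableSolutions.betaq p q ^ (p - 1) - SeparableSolutions.cq p q =
      (b - ((p - 1) * SeparableSolutions.betaq p q + (p - 2))) *
        SeparableSolutions.betaq p q ^ (p - 1) := by
    rw [SeparableSolutions.cq_eq h]
    ring
  have hp0 : 0 < p := by linarith
  refine ⟨fun hc => ⟨SeparableSolutions.intervalIntegrable_integrandMq h (hlt.mp hc), ?_⟩,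
    ⟨fun k => SeparableSolutions.polSolution p q (SeparableSolutions.betaq p q) b
      (SeparableSolutions.modeValue p q b k),
      fun k hk => SeparableSolutions.hasLeastPeriod_mode h hk,
      SeparableSolutions.signChangingSolutions_eq h⟩, fun hc => ?_, fun hc hc' => ?_,
    fun hc => ?_⟩
  · rw [SeparableSolutions.integral_integrandMq h]
    exact mul_pos (Real.rpow_pos_of_pos hβ _)
      (SeparableSolutions.integral_polD_div_polA_pos h (hlt.mp hc))
  · refine SeparableSolutions.positiveSolutions_eq_empty h ?_
    rw [← sub_nonpos, hsub] at hc
    linarith [nonpos_of_mul_nonpos_left hc hB]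
  · rw [hsub] at hc hc'
    refine SeparableSolutions.positiveSolutions_eq_singleton h
      (sub_pos.mp (pos_of_mul_pos_left hc hB.le)) ?_
    rw [le_div_iff₀ hp0] at hc'
    refine le_of_mul_le_mul_right ?_ hB
    linarith
  · have hb : (p - 1) * SeparableSolutions.betaq p q + (p - 2) < b := by
      have : 0 < b * SeparableSolutions.betaq p q ^ (p - 1) - SeparableSolutions.cq p q :=
        (div_pos hB hp0).trans hc
      rw [hsub] at this
      exact sub_pos.mp (pos_of_mul_pos_left this hB.le)
    refine ⟨SeparableSolutions.const_mem_positiveSolutions h hb, ?_⟩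
    have hex : ∀ k : ℕ, ∃ ω : ℝ → ℝ, 1 ≤ k →
        k ≤ SeparableSolutions.kqPlus p q (b * SeparableSolutions.betaq p q ^ (p - 1)) →
        SeparableSolutions.IsPeriodicSolution p q
          (b * SeparableSolutions.betaq p q ^ (p - 1)) ω ∧ (∀ σ, 0 < ω σ) ∧
          (∃ σ τ, ω σ ≠ ω τ) ∧ SeparableSolutions.HasLeastPeriod ω (2 * Real.pi / k) := by
      intro k
      by_cases hk : 1 ≤ k ∧
          k ≤ SeparableSolutions.kqPlus p q (b * SeparableSolutions.betaq p q ^ (p - 1))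
      · obtain ⟨ω, hω⟩ := SeparableSolutions.exists_nonconstant_positive h hk.1
          (SeparableSolutions.sq_lt_of_le_kqPlus h hb hk.2)
        exact ⟨ω, fun _ _ => hω⟩
      -- Outside the admissible range any function serves, which allows a choice over all k.
      · exact ⟨0, fun h1 h2 => absurd ⟨h1, h2⟩ hk⟩
    choose ω hω using hex
    refine ⟨ω, fun k h1 h2 => (hω k h1 h2).2, ?_⟩
    intro f hf
    simp only [Set.mem_iUnion, Set.mem_ofPred_eq, exists_prop] at hf
    obtain ⟨k, ⟨h1, h2⟩, ψ, rfl⟩ := hf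
    exact ⟨(hω k h1 h2).1.comp_add_const ψ, fun σ => (hω k h1 h2).2.1 (σ + ψ)⟩
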